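/- **Conventions.** All power series are formal, with complex coefficients. A formal mapping $F:(\mathbb C^k,0)\to(\mathbb C^p,0)$ is a $p$-tuple of series in $\mathbb C[[x]]$, $x=(x_1,\dots,x_k)$, without constant terms; $\mathrm{Rk}\,F$ is the rank of $\partial F/\partial x$ over the fraction field of $\mathbb C[[x]]$; $\bar F$ is obtained by conjugating coefficients. A formal manifold $\Sigma\subset\mathbb C^k$ of codimension $c$ and dimension $k-c$ is given by an ideal $\mathcal I(\Sigma)\subset\mathbb C[[x]]$ generated by $c$ series that vanish at $0$ and have linearly independent differentials at $0$; $\Sigma_1\subset\Sigma_2$ means $\mathcal I(\Sigma_2)\subset\mathcal I(\Sigma_1)$, and $F(\mathbb C^k)\subset\Sigma$ means $f\circ F=0$ for all $f\in\mathcal I(\Sigma)$. A formal vector field $X$ (a $\mathbb C$-linear derivation of $\mathbb C[[x]]$) is tangent to $\Sigma$ if $X\mathcal I(\Sigma)\subset\mathcal I(\Sigma)$. On $\mathbb C^N\times\mathbb C^N$ with coordinates $(Z,\zeta)$ let $\sigma(f)(Z,\zeta)=\bar f(\zeta,Z)$. A formal manifold $\mathcal M\subset\mathbb C^N\times\mathbb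 C^N$ is real if $\sigma(\mathcal I(\mathcal M))\subset\mathcal I(\mathcal M)$. Let $\mathcal M$ be real of codimension $d$ and let $\rho=(\rho_1,\dots,\rho_d)$ generate $\mathcal I(\mathcal M)$. Then $\mathcal M$ is generic if $\mathrm{rk}\,\partial\rho/\partial Z(0)=d$, and CR if the rank of $\partial\rho/\partial Z$ over the fraction field of $\mathbb C[[Z,\zeta]]/\mathcal I(\mathcal M)$ equals $\mathrm{rk}\,\partial\rho/\partial Z(0)$; these notions do not depend on the choice of $\rho$. A $(1,0)$- (resp. $(0,1)$-) vector field is one of the form $\sum a_j(Z,\zeta)\,\partial/\partial Z_j$ (resp. $\sum a_j(Z,\zeta)\,\partial/\partial\zeta_j$); the CR vector fields on $\mathcal M$ are the $(0,1)$-vector fields tangent to $\mathcal M$. $\mathfrak g_{\mathcal M}$ is the Lie algebra generated by all $(1,0)$- and $(0,1)$-vector fields tangent to $\mathcal M$, and $\mathfrak g_{\mathcal M}(0)$ is the space of their values at $0$. Let $\mathcal M$ be generic and $n=N-d$. A Segre variety mapping of $\mathcal M$ (for $\rho$) is a formal mapping $\gamma(\zeta,t):(\mathbb C^N\times\mathbb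 C^n,0)\to(\mathbb C^N,0)$ with $\rho(\gamma(\zeta,t),\zeta)=0$ and $\mathrm{rk}\,\partial\gamma/\partial t(0,0)=n$. The iterated Segre mappings relative to $\gamma$ are $$v^1(t^1)=\gamma(0,t^1),\qquad v^{j+1}(t^1,\dots,t^{j+1})=\gamma(\bar v^j(t^1,\dots,t^j),t^{j+1}),\qquad t^i\in\mathbb C^n.$$ **Theorem.** Let $\mathcal M\subset\mathbb C^N\times\mathbb C^N$ be a formal generic manifold of codimension $d$ with ideal generated by $\rho=(\rho_1,\dots,\rho_d)$, let $\gamma$ be a Segre variety mapping of $\mathcal M$, and let $v^j$, $j\ge1$, be the iterated Segre mappings relative to $\gamma$. Then $\mathrm{Rk}\,v^j$ is a nondecreasing function of $j$, and it is independent of the choice of the formal holomorphic coordinates (that is, of formal changes of coordinates $(Z,\zeta)\mapsto(H(Z),\bar H(\zeta))$), of the generators $\rho_j$, and of $\gamma$. There is an integer $k_0$, $1\le k_0\le d+1$, such that $\mathrm{Rk}\,v^j=\mathrm{Rk}\,v^{j+1}$ for $j\ge k_0$ and $\mathrm{Rk}\,v^j<\mathrm{Rk}\,v^{j+1}$ for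 $1\le j\le k_0-1$. Moreover: (i) There is a unique formal CR manifold $\mathcal O\subset\mathcal M$ with $\dim\mathcal O=\dim_{\mathbb C}\mathfrak g_{\mathcal M}(0)$ such that all CR vector fields on $\mathcal M$ are tangent to $\mathcal O$. The number $e=2N-d-\dim\mathfrak g_{\mathcal M}(0)$ is nonnegative, and there are $f_1,\dots,f_e\in\mathbb C[[Z]]$ such that $f_1,\dots,f_e,\rho_1,\dots,\rho_d$ generate $\mathcal I(\mathcal O)$. (ii) For any such $f_1,\dots,f_e$, the ideal of $\mathbb C[[Z]]$ generated by $f_1,\dots,f_e$ is the ideal of a formal manifold $\mathcal W\subset\mathbb C^N$, and $v^j(\mathbb C^{jn})\subset\mathcal W$ for all $j\ge1$. (iii) $\mathrm{Rk}\,v^{k_0}=\dim\mathfrak g_{\mathcal M}(0)+d-N=\dim\mathcal W$. -/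

import Mathlib

open MvPowerSeries

noncomputable section

namespace FormalSegre

/-- The ring `ℂ⟦x⟧` of formal power series in indeterminates `x` indexed by `σ`. -/
abbrev FPS (σ : Type) : Type := MvPowerSeries σ ℂ

/-- The ring `ℂ⟦Z, ζ⟧`: `Sum.inl k` is the index of `Z_k` and `Sum.inr k` that of `ζ_k`. -/
abbrev FPS₂ (N : ℕ) : Type := FPS (Fin N ⊕ Fin N)

section General

variable {σ τ : Type}

/-- A tuple of power series is a formal mapping `(ℂ^σ, 0) → (ℂ^τ, 0)` when all its components
have vanishing constant term. -/
def IsFormalMapping (F : τ → FPS σ) : Prop := ∀ i, constantCoeff (F i) = 0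

/-- The Jacobian matrix `∂F/∂x`, with entries in `ℂ⟦x⟧`. -/
def jacobian (F : τ → FPS σ) : Matrix τ σ (FPS σ) := Matrix.of fun i k => pderiv ℂ k (F i)

/-- The Jacobian matrix `∂F/∂x (0)` at the origin. -/
def jacobianZero (F : τ → FPS σ) : Matrix τ σ ℂ := (jacobian F).map constantCoeff

/-- The generic rank `Rk F`: the rank of `∂F/∂x` over the fraction field of `ℂ⟦x⟧`. -/
def Rk [Fintype σ] (F : τ → FPS σ) : ℕ :=
  ((jacobian F).map (algebraMap (FPS σ) (FractionRing (FPS σ)))).rank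

/-- `I` is a manifold ideal of codimension `c`: it is generated by `c` power series vanishing at
the origin whose differentials at the origin are linearly independent. -/
def IsManifoldIdeal (I : Ideal (FPS σ)) (c : ℕ) : Prop :=
  ∃ f : Fin c → FPS σ, IsFormalMapping f ∧ Ideal.span (Set.range f) = I ∧
    LinearIndependent ℂ (jacobianZero f).row

/-- `I` is the ideal of a formal manifold of dimension `m` in `ℂ^σ`. -/
def IsManifoldIdealOfDim [Fintype σ] (I : Ideal (FPS σ)) (m : ℕ) : Prop :=
  ∃ c, IsManifoldIdeal I c ∧ m + c = Fintype.card σ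

/-- A formal mapping `F : (ℂ^σ, 0) → (ℂ^τ, 0)` maps `ℂ^σ` into the formal manifold with
ideal `I`: `f ∘ F = 0` for all `f ∈ I`. -/
def MapsInto (F : τ → FPS σ) (I : Ideal (FPS τ)) : Prop := ∀ f ∈ I, subst F f = 0

/-- Formal vector fields: `ℂ`-linear derivations of `ℂ⟦x⟧`. -/
abbrev FormalVectorField (σ : Type) : Type := Derivation ℂ (FPS σ) (FPS σ)

/-- The formal vector field `V` is tangent to the formal manifold with ideal `I`. -/
def IsTangent (V : FormalVectorField σ) (I : Ideal (FPS σ)) : Prop := ∀ f ∈ I, V f ∈ I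

/-- Evaluation of formal vector fields at the origin, `∑ a_i ∂/∂x_i ↦ (a_i(0))_i`. -/
def evalZero : FormalVectorField σ →ₗ[ℂ] (σ → ℂ) where
  toFun V i := constantCoeff (V (X i))
  map_add' V W := by ext i; simp
  map_smul' c V := by ext i; simp

/-- The power series with complex conjugate coefficients. -/
def conjSeries : FPS σ →+* FPS σ := MvPowerSeries.map (starRingEnd ℂ)

end General

section CR

variable {N : ℕ}

/-- The involution `σ(f)(Z, ζ) = f̄(ζ, Z)` of `ℂ⟦Z, ζ⟧`. -/
def sigma (f : FPS₂ N) : FPS₂ N := conjSeries (rename Sum.swap f)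

/-- Reality of an ideal of `ℂ⟦Z, ζ⟧`. -/
def IsRealIdeal (I : Ideal (FPS₂ N)) : Prop := ∀ f ∈ I, sigma f ∈ I

/-- The matrix `∂ρ/∂Z`. -/
def jacobianZ {c : ℕ} (ρ : Fin c → FPS₂ N) : Matrix (Fin c) (Fin N) (FPS₂ N) :=
  (jacobian ρ).submatrix id Sum.inl

/-- The matrix `∂ρ/∂Z (0, 0)`. -/
def jacobianZZero {c : ℕ} (ρ : Fin c → FPS₂ N) : Matrix (Fin c) (Fin N) ℂ :=
  (jacobianZ ρ).map constantCoeff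

/-- `I` is the ideal of a formal generic manifold of codimension `c` in `ℂ^N × ℂ^N`. -/
def IsGeneric (I : Ideal (FPS₂ N)) (c : ℕ) : Prop :=
  IsManifoldIdeal I c ∧ IsRealIdeal I ∧
    ∃ ρ : Fin c → FPS₂ N, Ideal.span (Set.range ρ) = I ∧ (jacobianZZero ρ).rank = c

/-- `I` is the ideal of a formal CR manifold `𝓜`: it is a real manifold ideal, and `∂ρ/∂Z` has
constant rank along `𝓜`, i.e. its rank over the field of fractions of `ℂ⟦Z, ζ⟧ / I` is its rank
at the origin. (These two ranks do not depend on the generators `ρ`.) -/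
def IsCR (I : Ideal (FPS₂ N)) : Prop :=
  IsRealIdeal I ∧
    ∃ (c : ℕ) (ρ : Fin c → FPS₂ N), IsManifoldIdeal I c ∧ Ideal.span (Set.range ρ) = I ∧
      ((jacobianZ ρ).map fun a =>
        algebraMap (FPS₂ N ⧸ I) (FractionRing (FPS₂ N ⧸ I)) (Ideal.Quotient.mk I a)).rank =
      (jacobianZZero ρ).rank

/-- Formal `(1,0)`-vector fields `∑ a_j(Z, ζ) ∂/∂Z_j`. -/
def IsOneZero (V : FormalVectorField (Fin N ⊕ Fin N)) : Prop :=
  ∃ a : Fin N → FPS₂ N, V = ∑ j, a j • pderiv ℂ (Sum.inl j)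

/-- Formal `(0,1)`-vector fields `∑ a_j(Z, ζ) ∂/∂ζ_j`. -/
def IsZeroOne (V : FormalVectorField (Fin N ⊕ Fin N)) : Prop :=
  ∃ a : Fin N → FPS₂ N, V = ∑ j, a j • pderiv ℂ (Sum.inr j)

/-- The Lie algebra `𝔤_𝓜` generated by the formal `(1,0)`- and `(0,1)`-vector fields tangent
to the formal manifold `𝓜` with ideal `I`. -/
def lieAlg (I : Ideal (FPS₂ N)) : LieSubalgebra ℂ (FormalVectorField (Fin N ⊕ Fin N)) :=
  LieSubalgebra.lieSpan ℂ _ {V | (IsOneZero V ∨ IsZeroOne V) ∧ IsTangent V I}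

/-- The number `dim 𝔤_𝓜(0)`. -/
def dimLieAlgZero (I : Ideal (FPS₂ N)) : ℕ :=
  Module.finrank ℂ ((lieAlg I).toSubmodule.map evalZero)

/-- `O` is the ideal of a formal CR manifold `𝓞 ⊆ 𝓜` of dimension `dim 𝔤_𝓜(0)` to which all
formal CR vector fields of `𝓜` are tangent, `I` being the ideal of `𝓜`. -/
def IsCROrbit (I O : Ideal (FPS₂ N)) : Prop :=
  IsCR O ∧ I ≤ O ∧ IsManifoldIdealOfDim O (dimLieAlgZero I) ∧
    ∀ V, IsZeroOne V → IsTangent V I → IsTangent V O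

/-- `γ(ζ, t)` is a Segre variety mapping for the defining series `ρ`; here `Sum.inl` indexes `ζ`
and `Sum.inr` indexes `t`. -/
def IsSegreMapping {n d : ℕ} (ρ : Fin d → FPS₂ N) (γ : Fin N → FPS (Fin N ⊕ Fin n)) : Prop :=
  IsFormalMapping γ ∧
  (∀ j, subst (Sum.elim γ fun k => (X (Sum.inl k) : FPS (Fin N ⊕ Fin n))) (ρ j) = 0) ∧
  ((jacobianZero γ).submatrix id Sum.inr).rank = n

/-- The iterated Segre mappings `v^j(t^1, …, t^j)` relative to `γ`. The variable `t^{i+1}_k` has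
index `(i, k) : Fin j × Fin n`. The recursion starts with the zero mapping `v^0`, so that
`v^1(t^1) = γ(0, t^1)`, and `v^{j+1} = γ(v̄^j(t^1, …, t^j), t^{j+1})`. -/
def iterSegre {n : ℕ} (γ : Fin N → FPS (Fin N ⊕ Fin n)) :
    (j : ℕ) → Fin N → FPS (Fin j × Fin n)
  | 0 => fun _ => 0
  | j + 1 => fun i =>
      subst (Sum.elim
        (fun l => rename (Prod.map Fin.castSucc id) (conjSeries (iterSegre γ j l)))
        (fun k => (X (Fin.last j, k) : FPS (Fin (j + 1) × Fin n)))) (γ i)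

theorem iterSegre_one {n : ℕ} (γ : Fin N → FPS (Fin N ⊕ Fin n)) (i : Fin N) :
    iterSegre γ 1 i =
      subst (Sum.elim (fun _ => 0) (fun k => (X (0, k) : FPS (Fin 1 × Fin n)))) (γ i) := by
  simp [iterSegre]

/-- A formal change of coordinates `Z' = H(Z)` in `ℂ^N`. -/
def IsCoordChange (H : Fin N → FPS (Fin N)) : Prop :=
  IsFormalMapping H ∧ IsUnit (jacobianZero H)

/-- The induced change of coordinates `𝓗(Z, ζ) = (H(Z), H̄(ζ))` in `ℂ^N × ℂ^N`. -/
def doubled (H : Fin N → FPS (Fin N)) : Fin N ⊕ Fin N → FPS₂ N :=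
  Sum.elim (fun k => rename Sum.inl (H k)) (fun k => rename Sum.inr (conjSeries (H k)))

/-- `ρ'` is a tuple of defining series, in the coordinates `Z' = H(Z)`, of the formal manifold
whose ideal in the coordinates `Z` is `I`: the series `ρ'_j(H(Z), H̄(ζ))` generate `I`. -/
def IsDefiningIn {d : ℕ} (H : Fin N → FPS (Fin N)) (I : Ideal (FPS₂ N))
    (ρ' : Fin d → FPS₂ N) : Prop :=
  Ideal.span (Set.range fun j => (subst (doubled H) (ρ' j) : FPS₂ N)) = I

/-- The ideal of `ℂ⟦Z, ζ⟧` generated by `f_1(Z), …, f_e(Z), ρ_1(Z, ζ), …, ρ_d(Z, ζ)`. -/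
def joinIdeal {e d : ℕ} (f : Fin e → FPS (Fin N)) (ρ : Fin d → FPS₂ N) : Ideal (FPS₂ N) :=
  Ideal.span (Set.range (fun k => (rename Sum.inl (f k) : FPS₂ N)) ∪ Set.range ρ)

end CR

end FormalSegre

end

/-! Write r_j for Rk v^j and g for the Lie algebra of M. The map D = (v^{j+1}, v̄^j) takes its
values in M; let S be the tangent space of its image at the generic point, over the fraction field.
The projections of S to the Z- and ζ-directions have dimensions r_{j+1} and r_j. The kernel of the
ζ-projection contains the n derivatives in t^{j+1}, hence is the whole (1,0)-tangent space of M, and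
dim S = r_j + n. The kernel of the Z-projection lies in the (0,1)-tangent space, of dimension at
most n, so dim S ≤ r_{j+1} + n. Thus r_j ≤ r_{j+1}, and equality puts the values of all (1,0)- and
(0,1)-fields tangent to M into S. Fields with values in S lift, up to a factor, to the source of D,
so they are closed under brackets (`liftableAlg`, `mem_liftableAlg`). Then all of g has values in S,
and dim g(0) ≤ r_j + n (`Rk_iterSegre_step`).

Conversely, let O be the formal orbit of g: its ideal consists of the series whose iterated
derivatives along g all vanish at 0. By a formal Nagano theorem O is a graph of dimension dim g(0):
a frame of g dual to some coordinates commutes modulo the ideal, and Taylor expansion along it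
parametrizes O (`AdaptedFrame.orbitIdeal_eq_span`). Part of the frame has type (0,1) and kills Z, so
the Z-part of the graph is free of ζ and O is cut out of M by equations f(Z) = 0
(`exists_joinIdeal_eq_crOrbit`). Reality of O carries f = 0 from v^j to v^{j+1}
(`subst_iterSegre_eq_zero`), so r_j ≤ dim g(0) - n. Hence r_j = r_{j+1} exactly when r_j = dim g(0)
- n; as r_1 ≥ n and dim g(0) - n ≤ n + d, at most d strict steps occur.

O is unique because a competitor is real, hence tangent to the (1,0)-fields as well, so that its
ideal lies in the orbit ideal. The ranks do not depend on choices because the implicit function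
theorem lifts one chain of Segre mappings through another, block by block
(`exists_reparametrization`). -/

noncomputable section

namespace FormalSegre

/-! ### Ranks and minors of matrices over fields. -/

section Rank

variable {m n : Type*} [Fintype m] [Fintype n]

theorem exists_submatrix_rows_rank {K : Type*} [Field K] (A : Matrix m n K) :
    ∃ r : Fin A.rank → m, LinearIndependent K (A.submatrix r id).row := by
  obtain ⟨κ, a, ha, hspan, hli⟩ := exists_linearIndependent' K A.row
  have : Finite κ := Finite.of_injective a ha
  have := Fintype.ofFinite κ
  have hc : Fintype.card κ = A.rank := by
    rw [A.rank_eq_finrank_span_row, ← hspan]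
    exact (finrank_span_eq_card hli).symm
  let e : Fin A.rank ≃ κ := (finCongr hc.symm).trans (Fintype.equivFin κ).symm
  exact ⟨a ∘ e, (linearIndependent_equiv e).2 hli⟩

/-- A matrix over a field has a nonvanishing minor of size its rank. -/
theorem exists_minor_ne_zero {K : Type*} [Field K] (A : Matrix m n K) {k : ℕ} (hk : A.rank = k) :
    ∃ (r : Fin k → m) (c : Fin k → n), (A.submatrix r c).det ≠ 0 := by
  subst hk
  obtain ⟨r, hr⟩ := exists_submatrix_rows_rank A
  have h1 : ((A.submatrix r id).transpose).rank = A.rank := by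
    rw [Matrix.rank_transpose, hr.rank_matrix, Fintype.card_fin]
  obtain ⟨c, hc⟩ := exists_submatrix_rows_rank (A.submatrix r id).transpose
  let e := finCongr h1
  refine ⟨r, c ∘ e.symm, ?_⟩
  have h2 : LinearIndependent K
      ((A.submatrix r (c ∘ e.symm)).transpose).row :=
    (linearIndependent_equiv e.symm).2 hc
  have h3 := Matrix.linearIndependent_rows_iff_isUnit.1 h2
  rw [Matrix.isUnit_iff_isUnit_det, Matrix.det_transpose] at h3
  exact h3.ne_zero

omit [Fintype m] in
theorem card_le_rank_of_minor_ne_zero {K ι : Type*} [Field K] [Fintype ι] [DecidableEq ι]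
    (A : Matrix m n K) (r : ι → m) (c : ι → n) (h : (A.submatrix r c).det ≠ 0) :
    Fintype.card ι ≤ A.rank := by
  have := Matrix.rank_submatrix_le A r c
  rwa [Matrix.rank_of_det_ne_zero h] at this

/-- The rank of a matrix can only drop under further specialization. -/
theorem rank_map_le_of_ker_le {R K L : Type*} [CommRing R] [Field K] [Field L]
    (φ : R →+* K) (ψ : R →+* L) (h : ∀ x, φ x = 0 → ψ x = 0) (A : Matrix m n R) :
    (A.map ψ).rank ≤ (A.map φ).rank := by
  obtain ⟨r, c, hrc⟩ := exists_minor_ne_zero (A.map ψ) rfl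
  have h1 : ((A.map φ).submatrix r c).det ≠ 0 := by
    change (φ.mapMatrix (A.submatrix r c)).det ≠ 0
    change (ψ.mapMatrix (A.submatrix r c)).det ≠ 0 at hrc
    rw [← RingHom.map_det] at hrc ⊢
    exact fun h0 => hrc (h _ h0)
  simpa using card_le_rank_of_minor_ne_zero _ r c h1

theorem row_linearIndependent_iff_rank {K : Type*} [Field K] (A : Matrix m n K) :
    LinearIndependent K A.row ↔ A.rank = Fintype.card m := by
  rw [linearIndependent_iff_card_eq_finrank_span, A.rank_eq_finrank_span_row, Set.finrank, eq_comm]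

end Rank

/-! ### Division by coordinates, chain rule, vector fields in coordinates. -/

section Coefficients

variable {σ τ : Type}

/-- One variable at a time: the part of `f` free of `X s` satisfies the hypothesis for the remaining
variables, and the rest is divisible by `X s`. -/
theorem exists_eq_sum_X_mul (S : Finset σ) (f : FPS σ)
    (hf : ∀ m : σ →₀ ℕ, (∀ i ∈ S, m i = 0) → coeff m f = 0) :
    ∃ g : σ → FPS σ, f = ∑ i ∈ S, X i * g i := by
  classical
  induction S using Finset.induction_on generalizing f with
  | empty => exact ⟨0, by ext m; simp [hf m (by simp)]⟩
  | insert s S hs ih =>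
    let p : FPS σ := fun m => if m s = 0 then coeff m f else 0
    have hp : ∀ m, coeff m p = if m s = 0 then coeff m f else 0 := fun m => rfl
    obtain ⟨g, hg⟩ := ih p fun m hm => by
      rw [hp]
      split_ifs with h
      · exact hf m fun i hi => by
          rcases Finset.mem_insert.1 hi with rfl | hi
          exacts [h, hm i hi]
      · rfl
    obtain ⟨q, hq⟩ : (X s : FPS σ) ∣ f - p := by
      rw [X_dvd_iff]
      intro m hm
      rw [map_sub, hp, if_pos hm, sub_self]
    refine ⟨Function.update g s q, ?_⟩
    rw [Finset.sum_insert hs, Function.update_self, ← hq]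
    rw [Finset.sum_congr rfl (g := fun i => X i * g i), ← hg]
    · ring
    · intro i hi
      rw [Function.update_of_ne]
      rintro rfl
      exact hs hi

variable [Fintype σ]

theorem exists_eq_C_add_sum (f : FPS σ) :
    ∃ g : σ → FPS σ, f = C (constantCoeff f) + ∑ i, X i * g i := by
  classical
  obtain ⟨g, hg⟩ := exists_eq_sum_X_mul Finset.univ (f - C (constantCoeff f)) fun m hm => by
    have : m = 0 := Finsupp.ext fun i => hm i (Finset.mem_univ _)
    subst this
    simp
  exact ⟨g, by rw [← hg]; ring⟩

/-- Splitting off one coordinate raises the lower bound for the order of every `E f` by one, so the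
order is infinite. This stands in for continuity: operator identities reduce to the constant 1 and
to multiplication by coordinates. -/
theorem linearMap_eq_zero_of_X_mul (E : FPS σ →ₗ[ℂ] FPS τ) (F : σ → FPS τ)
    (hF : IsFormalMapping F) (h1 : E 1 = 0) (hX : ∀ i f, E (X i * f) = F i * E f) : E = 0 := by
  have key : ∀ k : ℕ, ∀ f, (k : ℕ∞) ≤ (E f).order := by
    intro k
    induction k with
    | zero => intro f; simp
    | succ k ih =>
      intro f
      obtain ⟨g, hg⟩ := exists_eq_C_add_sum f
      rw [hg, map_add, map_sum]
      have : E (C (constantCoeff f)) = 0 := by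
        have : (C (constantCoeff f) : FPS σ) = constantCoeff f • (1 : FPS σ) := by
          rw [smul_eq_C_mul, mul_one]
        rw [this, map_smul, h1, smul_zero]
      rw [this, zero_add]
      refine le_order fun m hm => ?_
      rw [map_sum]
      refine Finset.sum_eq_zero fun i _ => ?_
      rw [hX]
      refine coeff_of_lt_order (lt_of_lt_of_le hm (le_trans ?_ le_order_mul))
      push_cast
      rw [add_comm]
      exact add_le_add (one_le_order_iff_constCoeff_eq_zero.2 (hF i)) (ih _)
  ext1 f
  rw [LinearMap.zero_apply, ← order_eq_top_iff]
  refine ENat.eq_top_iff_forall_ge.2 fun k => key k f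

theorem hasSubst (F : σ → FPS τ) (hF : IsFormalMapping F) : HasSubst F :=
  hasSubst_of_constantCoeff_zero hF

theorem subst_formal_zero {F : σ → FPS τ} (hF : IsFormalMapping F) :
    subst F (0 : FPS σ) = 0 := by
  rw [← substAlgHom_apply (R := ℂ) (hasSubst F hF), map_zero]

theorem subst_formal_one {F : σ → FPS τ} (hF : IsFormalMapping F) :
    subst F (1 : FPS σ) = 1 := by
  rw [← substAlgHom_apply (R := ℂ) (hasSubst F hF), map_one]

theorem subst_formal_C {F : σ → FPS τ} (hF : IsFormalMapping F) (c : ℂ) :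
    subst F (C c : FPS σ) = C c := by
  rw [← substAlgHom_apply (R := ℂ) (hasSubst F hF)]
  exact (substAlgHom (R := ℂ) (hasSubst F hF)).commutes c

theorem subst_formal_sum {F : σ → FPS τ} (hF : IsFormalMapping F) {ι : Type*} (s : Finset ι)
    (f : ι → FPS σ) : subst F (∑ i ∈ s, f i) = ∑ i ∈ s, subst F (f i) := by
  simp only [← substAlgHom_apply (R := ℂ) (hasSubst F hF), map_sum]

theorem algHom_ext_of_X {φ ψ : FPS σ →ₐ[ℂ] FPS τ} (hφ : ∀ i, constantCoeff (φ (X i)) = 0)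
    (h : ∀ i, φ (X i) = ψ (X i)) : φ = ψ := by
  have := linearMap_eq_zero_of_X_mul (φ.toLinearMap - ψ.toLinearMap) (fun i => φ (X i)) hφ
    (by simp) (fun i f => by simp [h]; ring)
  ext1 f
  exact sub_eq_zero.1 (LinearMap.congr_fun this f)

theorem constantCoeff_subst_formal {F : σ → FPS τ} (hF : IsFormalMapping F) (f : FPS σ) :
    constantCoeff (subst F f) = constantCoeff f := by
  have h := constantCoeff_subst_eq_zero (hasSubst F hF) hF
    (f := f - C (constantCoeff f)) (by simp)
  rw [subst_sub (hasSubst F hF), map_sub, subst_formal_C hF, constantCoeff_C] at h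
  exact sub_eq_zero.1 h

/-- The chain rule. -/
theorem pderiv_subst {F : σ → FPS τ} (hF : IsFormalMapping F) (s : τ) (f : FPS σ) :
    pderiv ℂ s (subst F f) = ∑ i, subst F (pderiv ℂ i f) * pderiv ℂ s (F i) := by
  have hS := hasSubst F hF
  let E : FPS σ →ₗ[ℂ] FPS τ :=
    (pderiv ℂ s).toLinearMap ∘ₗ (substAlgHom (R := ℂ) hS).toLinearMap -
      ∑ i, LinearMap.mulRight ℂ (pderiv ℂ s (F i)) ∘ₗ (substAlgHom (R := ℂ) hS).toLinearMap ∘ₗ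
        (pderiv ℂ i).toLinearMap
  have hE : ∀ f, E f = pderiv ℂ s (subst F f) -
      ∑ i, subst F (pderiv ℂ i f) * pderiv ℂ s (F i) := by
    intro f
    simp [E]
  have h0 : E = 0 := by
    refine linearMap_eq_zero_of_X_mul E F hF ?_ fun i f => ?_
    · rw [hE, subst_formal_one hF]
      simp [subst_formal_zero hF]
    · simp only [hE]
      rw [subst_mul hS, subst_X hS, Derivation.leibniz]
      simp only [Derivation.leibniz, smul_eq_mul, subst_add hS, subst_mul hS, subst_X hS,
        add_mul, Finset.sum_add_distrib, mul_assoc, ← Finset.mul_sum]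
      have : ∑ x, subst F f * (subst F (pderiv ℂ x (X i)) * pderiv ℂ s (F x)) =
          subst F f * pderiv ℂ s (F i) := by
        rw [Finset.sum_eq_single i]
        · rw [pderiv_X_self, subst_formal_one hF, one_mul]
        · intro j _ hj
          rw [pderiv_X_of_ne hj.symm, subst_formal_zero hF]; simp
        · simp
      simp only [Finset.mul_sum] at this ⊢
      rw [this]
      rw [mul_sub, Finset.mul_sum]
      ring
  have := hE f
  rw [h0] at this
  exact (sub_eq_zero.1 this.symm)

theorem vectorField_apply (V : FormalVectorField σ) (f : FPS σ) :
    V f = ∑ i, V (X i) * pderiv ℂ i f := by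
  classical
  let E : FPS σ →ₗ[ℂ] FPS σ := V.toLinearMap -
      ∑ i, LinearMap.mulLeft ℂ (V (X i)) ∘ₗ (pderiv ℂ i).toLinearMap
  have hE : ∀ f, E f = V f - ∑ i, V (X i) * pderiv ℂ i f := by
    intro f
    simp [E]
  have h0 : E = 0 := by
    refine linearMap_eq_zero_of_X_mul E X (fun i => constantCoeff_X i) ?_ fun i f => ?_
    · rw [hE]; simp
    · simp only [hE, Derivation.leibniz, smul_eq_mul, mul_add, Finset.sum_add_distrib]
      have : ∑ x, V (X x) * (f * pderiv ℂ x (X i)) = V (X i) * f := by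
        rw [Finset.sum_eq_single i]
        · rw [pderiv_X_self, mul_one]
        · intro j _ hj
          rw [pderiv_X_of_ne hj.symm]; simp
        · simp
      rw [this, mul_sub, Finset.mul_sum]
      have h2 : ∀ x, V (X x) * (X i * pderiv ℂ x f) = X i * (V (X x) * pderiv ℂ x f) :=
        fun x => by ring
      simp only [h2]
      ring
  have := hE f
  rw [h0] at this
  exact (sub_eq_zero.1 this.symm)

theorem vectorField_eq_sum (V : FormalVectorField σ) :
    V = ∑ i, V (X i) • pderiv ℂ i := by
  ext1 f
  rw [vectorField_apply V f]
  change _ = Derivation.coeFnAddMonoidHom (∑ i, V (X i) • pderiv ℂ i) f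
  rw [map_sum, Finset.sum_apply]
  rfl

end Coefficients

/-! ### Renaming variables, and Hadamard's lemma. -/

section Variables

variable {σ τ υ : Type}

theorem sum_vectorField_apply {ι : Type*} (s : Finset ι) (V : ι → FormalVectorField σ)
    (f : FPS σ) : (∑ i ∈ s, V i) f = ∑ i ∈ s, V i f := by
  change Derivation.coeFnAddMonoidHom (∑ i ∈ s, V i) f = _
  rw [map_sum, Finset.sum_apply]
  rfl

theorem eq_rename_inl_killCompl [Finite σ] (f : FPS (σ ⊕ τ))
    (h : ∀ m : σ ⊕ τ →₀ ℕ, (∃ t, m (Sum.inr t) ≠ 0) → coeff m f = 0) :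
    f = rename Sum.inl (killCompl Function.Embedding.inl f) := by
  ext m
  by_cases hm : ∃ t, m (Sum.inr t) ≠ 0
  · rw [h m hm]
    symm
    obtain ⟨t, ht⟩ := hm
    refine coeff_rename_eq_zero _ _ ?_
    rintro ⟨x, rfl⟩
    exact ht (Finsupp.mapDomain_of_notMem_range _ _ (by simp))
  · push Not at hm
    have hm' : m ∈ Set.range (Finsupp.embDomain (M := ℕ)
        (Function.Embedding.inl : σ ↪ σ ⊕ τ)) := by
      rw [Finsupp.mem_range_embDomain_iff]
      rintro (s | t) hs
      · exact ⟨s, rfl⟩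
      · exact absurd (hm t) (by simpa using hs)
    obtain ⟨x, rfl⟩ := hm'
    have := coeff_embDomain_rename (R := ℂ) (Function.Embedding.inl : σ ↪ σ ⊕ τ)
      (killCompl Function.Embedding.inl f) x
    rw [coeff_killCompl] at this
    exact this.symm

theorem exists_rename_inl_of_pderiv_eq_zero [Finite σ] (f : FPS (σ ⊕ τ))
    (h : ∀ t, pderiv ℂ (Sum.inr t) f = 0) : ∃ g : FPS σ, f = rename Sum.inl g := by
  classical
  refine ⟨_, eq_rename_inl_killCompl f fun m ⟨t, ht⟩ => ?_⟩
  have h1 := congrArg (coeff (m - Finsupp.single (Sum.inr t) 1)) (h t)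
  rw [coeff_pderiv, tsub_add_cancel_of_le (by simpa using Nat.one_le_iff_ne_zero.2 ht)] at h1
  simp only [map_zero, mul_eq_zero] at h1
  exact h1.resolve_right (Nat.cast_add_one_ne_zero _)

theorem pderiv_comm (i j : σ) (f : FPS σ) :
    pderiv ℂ i (pderiv ℂ j f) = pderiv ℂ j (pderiv ℂ i f) := by
  classical
  ext n
  simp only [coeff_pderiv]
  by_cases h : i = j
  · subst h; rfl
  · rw [add_right_comm]
    simp [h, Ne.symm h]
    ring

theorem isFormalMapping_X_comp (e : σ → τ) : IsFormalMapping fun i => (X (e i) : FPS τ) :=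
  fun _ => constantCoeff_X _

theorem rename_eq_subst_X [Fintype σ] (e : σ → τ) (f : FPS σ) :
    rename e f = subst (fun i => (X (e i) : FPS τ)) f :=
  rename_eq_subst e f

theorem pderiv_rename [Fintype σ] (e : σ ↪ τ) (i : σ) (f : FPS σ) :
    pderiv ℂ (e i) (rename e f) = rename e (pderiv ℂ i f) := by
  rw [rename_eq_subst_X, pderiv_subst (isFormalMapping_X_comp e), Finset.sum_eq_single i,
    pderiv_X_self, mul_one, rename_eq_subst_X]
  · intro j _ hj
    rw [pderiv_X_of_ne (fun h => hj (e.injective h)), mul_zero]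
  · simp

theorem pderiv_rename_of_notMem [Fintype σ] (e : σ → τ) {t : τ} (ht : ∀ i, e i ≠ t) (f : FPS σ) :
    pderiv ℂ t (rename e f) = 0 := by
  rw [rename_eq_subst_X, pderiv_subst (isFormalMapping_X_comp e)]
  refine Finset.sum_eq_zero fun j _ => ?_
  rw [pderiv_X_of_ne (ht j), mul_zero]

theorem subst_rename [Fintype σ] [Fintype τ] (e : σ → τ) {F : τ → FPS υ} (hF : IsFormalMapping F)
    (f : FPS σ) : subst F (rename e f) = subst (fun i => F (e i)) f := by
  rw [rename_eq_subst_X, subst_comp_subst_apply (hasSubst _ (isFormalMapping_X_comp e))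
    (hasSubst F hF)]
  congr 1
  ext1 i
  rw [subst_X (hasSubst F hF)]

theorem rename_subst [Fintype σ] [Fintype τ] (e : τ → υ) {F : σ → FPS τ} (hF : IsFormalMapping F)
    (f : FPS σ) : rename e (subst F f) = subst (fun i => rename e (F i)) f := by
  rw [rename_eq_subst_X, subst_comp_subst_apply (hasSubst F hF)
    (hasSubst _ (isFormalMapping_X_comp e))]
  simp only [rename_eq_subst_X]

theorem IsFormalMapping.subst [Fintype σ] {ι : Type} {F : σ → FPS τ} (hF : IsFormalMapping F)
    {G : ι → FPS σ} (hG : IsFormalMapping G) :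
    IsFormalMapping fun i => (MvPowerSeries.subst F (G i) : FPS τ) :=
  fun i => by rw [constantCoeff_subst_formal hF, hG i]

theorem IsFormalMapping.sumElim {ι κ : Type} {F : ι → FPS τ} {G : κ → FPS τ}
    (hF : IsFormalMapping F) (hG : IsFormalMapping G) : IsFormalMapping (Sum.elim F G) := by
  rintro (i | i)
  exacts [hF i, hG i]

/-- Hadamard's lemma. With `H(x, y) = h(x + y)`, the series `H - h(x)` vanishes at `y = 0`, so it is
a combination of the `y_i`; then `x = G`, `y = F - G` is substituted. Differentiating in `y_i` at
the origin identifies the constant terms. -/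
theorem subst_sub_subst [Fintype σ] {F G : σ → FPS τ} (hF : IsFormalMapping F)
    (hG : IsFormalMapping G) (h : FPS σ) :
    ∃ c : σ → FPS τ, subst F h - subst G h = ∑ i, c i * (F i - G i) ∧
      ∀ i, constantCoeff (c i) = constantCoeff (pderiv ℂ i h) := by
  classical
  have hT : IsFormalMapping (fun i : σ => (X (Sum.inl i) + X (Sum.inr i) : FPS (σ ⊕ σ))) :=
    fun i => by simp
  set H : FPS (σ ⊕ σ) :=
    subst (fun i : σ => (X (Sum.inl i) + X (Sum.inr i) : FPS (σ ⊕ σ))) h with hH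
  have hkill : killCompl Function.Embedding.inl H = h := by
    have : (killCompl Function.Embedding.inl).comp (substAlgHom (R := ℂ) (hasSubst _ hT)) =
        AlgHom.id ℂ (FPS σ) := by
      have hX : ∀ i : σ, ((killCompl Function.Embedding.inl).comp
          (substAlgHom (R := ℂ) (hasSubst _ hT))) (X i) = X i := by
        intro i
        rw [AlgHom.comp_apply, substAlgHom_X, map_add]
        have h1 := killCompl_X (R := ℂ) (e := (Function.Embedding.inl : σ ↪ σ ⊕ σ)) i
        have h2 := killCompl_X_eq_zero (R := ℂ) (e := (Function.Embedding.inl : σ ↪ σ ⊕ σ))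
          (t := Sum.inr i) (by simp)
        rw [h2, add_zero]
        exact h1
      refine algHom_ext_of_X (fun i => ?_) fun i => ?_
      · rw [hX, constantCoeff_X]
      · rw [hX]; rfl
    have := DFunLike.congr_fun this h
    simpa [substAlgHom_apply] using this
  obtain ⟨g, hg⟩ := exists_eq_sum_X_mul (Finset.univ.image (Sum.inr : σ → σ ⊕ σ))
    (H - rename Sum.inl h) fun m hm => by
      have hm' : m ∈ Set.range (Finsupp.embDomain (M := ℕ)
          (Function.Embedding.inl : σ ↪ σ ⊕ σ)) := by
        rw [Finsupp.mem_range_embDomain_iff]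
        rintro (s | t) hs
        · exact ⟨s, rfl⟩
        · exact absurd (hm (Sum.inr t) (by simp)) (by simpa using hs)
      obtain ⟨x, rfl⟩ := hm'
      have h1 := coeff_embDomain_rename (R := ℂ) (Function.Embedding.inl : σ ↪ σ ⊕ σ) h x
      have h2 := coeff_killCompl (R := ℂ) (e := (Function.Embedding.inl : σ ↪ σ ⊕ σ)) H x
      rw [hkill] at h2
      rw [map_sub, ← h2, ← h1]
      exact sub_self _
  rw [Finset.sum_image (fun a _ b _ hab => Sum.inr_injective hab)] at hg
  have hE : IsFormalMapping (Sum.elim G fun i => F i - G i) :=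
    hG.sumElim fun i => by simp [hF i, hG i]
  refine ⟨fun i => subst (Sum.elim G fun i => F i - G i) (g (Sum.inr i)), ?_, fun i => ?_⟩
  · have h1 := congrArg (subst (Sum.elim G fun i => F i - G i)) hg
    rw [subst_sub (hasSubst _ hE), subst_formal_sum hE, subst_rename _ hE, hH,
      subst_comp_subst_apply (hasSubst _ hT) (hasSubst _ hE)] at h1
    simp only [subst_add (hasSubst _ hE), subst_mul (hasSubst _ hE), subst_X (hasSubst _ hE),
      Sum.elim_inl, Sum.elim_inr, add_sub_cancel] at h1
    refine h1.trans (Finset.sum_congr rfl fun i _ => mul_comm _ _)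
  · rw [constantCoeff_subst_formal hE]
    have h1 := congrArg (fun f => constantCoeff (pderiv ℂ (Sum.inr i) f)) hg
    simp only [map_sub, map_sum, Derivation.leibniz, smul_eq_mul, map_add, map_mul,
      constantCoeff_X, zero_mul, zero_add] at h1
    rw [pderiv_rename_of_notMem Sum.inl (by simp), map_zero, sub_zero, hH, pderiv_subst hT,
      map_sum] at h1
    simp only [map_mul, constantCoeff_subst_formal hT, map_add] at h1
    rw [Finset.sum_eq_single i, Finset.sum_eq_single i] at h1
    · rw [pderiv_X_self, pderiv_X_of_ne (by simp)] at h1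
      simpa using h1.symm
    · intro j _ hj
      rw [pderiv_X_of_ne (fun h => hj (Sum.inr_injective h))]; simp
    · simp
    · intro j _ hj
      rw [pderiv_X_of_ne (fun h => hj (Sum.inr_injective h)), pderiv_X_of_ne (by simp)]; simp
    · simp

end Variables

/-! ### Conjugation of coefficients. -/

section Conjugation

variable {σ τ : Type}

theorem conjSeries_conjSeries (f : FPS σ) : conjSeries (conjSeries f) = f := by
  ext m; simp [conjSeries]

theorem conjSeries_X (i : σ) : conjSeries (X i : FPS σ) = X i := map_X _ _

theorem constantCoeff_conjSeries (f : FPS σ) :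
    constantCoeff (conjSeries f) = starRingEnd ℂ (constantCoeff f) := constantCoeff_map _ _

theorem conjSeries_injective : Function.Injective (conjSeries : FPS σ → FPS σ) :=
  Function.LeftInverse.injective conjSeries_conjSeries

theorem pderiv_conjSeries (i : σ) (f : FPS σ) :
    pderiv ℂ i (conjSeries f) = conjSeries (pderiv ℂ i f) := by
  ext m; simp [conjSeries, coeff_pderiv]

theorem conjSeries_subst [Fintype σ] {F : σ → FPS τ} (hF : IsFormalMapping F) (f : FPS σ) :
    conjSeries (subst F f) = subst (fun i => conjSeries (F i)) (conjSeries f) :=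
  map_subst (hasSubst F hF) f

theorem conjSeries_rename [Fintype σ] (e : σ → τ) (f : FPS σ) :
    conjSeries (rename e f) = rename e (conjSeries f) := by
  rw [rename_eq_subst_X, conjSeries_subst (isFormalMapping_X_comp e), rename_eq_subst_X]
  simp only [conjSeries_X]

theorem IsFormalMapping.conjSeries {F : τ → FPS σ} (hF : IsFormalMapping F) :
    IsFormalMapping fun i => FormalSegre.conjSeries (F i) :=
  fun i => by rw [constantCoeff_conjSeries, hF i, map_zero]

end Conjugation

/-! ### Generators of manifold ideals. -/

section ManifoldIdeals

variable {σ ι : Type} [Fintype ι] [DecidableEq ι]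

theorem jacobianZero_apply {τ : Type} (f : τ → FPS σ) (i : τ) (k : σ) :
    jacobianZero f i k = constantCoeff (pderiv ℂ k (f i)) := rfl

omit [DecidableEq ι] in
theorem jacobianZero_of_eq_sum {κ : Type} {f : κ → FPS σ} {g : ι → FPS σ}
    (hg : IsFormalMapping g) (a : Matrix κ ι (FPS σ)) (h : ∀ i, f i = ∑ j, a i j * g j) :
    jacobianZero f = a.map constantCoeff * jacobianZero g := by
  ext i k
  simp [jacobianZero_apply, h, Matrix.mul_apply, hg _]

theorem isUnit_det_of_map {A : Matrix ι ι (FPS σ)}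
    (h : (A.map constantCoeff).det ≠ 0) : IsUnit A.det := by
  rw [isUnit_iff_constantCoeff, RingHom.map_det]
  exact h.isUnit

/-- At the origin the Jacobian of `f` factors through the square matrix expressing `f` by `g`; full
rank makes that matrix invertible at the origin, hence over power series. -/
theorem generators_of_mem_span [Fintype σ] {f g : ι → FPS σ} (hg : IsFormalMapping g)
    (hfg : ∀ i, f i ∈ Ideal.span (Set.range g)) (hf : LinearIndependent ℂ (jacobianZero f).row) :
    Ideal.span (Set.range f) = Ideal.span (Set.range g) ∧
      LinearIndependent ℂ (jacobianZero g).row := by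
  have h1 : ∀ i, ∃ c : ι → FPS σ, ∑ j, c j * g j = f i := fun i =>
    (Ideal.mem_span_range_iff_exists_fun).1 (hfg i)
  choose a ha using h1
  let A : Matrix ι ι (FPS σ) := Matrix.of a
  have hA := jacobianZero_of_eq_sum hg A fun i => (ha i).symm
  rw [row_linearIndependent_iff_rank] at hf
  have hr1 : Fintype.card ι ≤ (jacobianZero g).rank := by
    rw [← hf, hA]; exact Matrix.rank_mul_le_right _ _
  have hr2 : Fintype.card ι ≤ (A.map constantCoeff).rank := by
    rw [← hf, hA]; exact Matrix.rank_mul_le_left _ _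
  have hu : IsUnit A.det := by
    refine isUnit_det_of_map ?_
    have := (row_linearIndependent_iff_rank (A.map constantCoeff)).2
      (le_antisymm (Matrix.rank_le_card_height _) hr2)
    rw [Matrix.linearIndependent_rows_iff_isUnit, Matrix.isUnit_iff_isUnit_det] at this
    exact this.ne_zero
  refine ⟨le_antisymm (Ideal.span_le.2 ?_) (Ideal.span_le.2 ?_), ?_⟩
  · rintro _ ⟨i, rfl⟩
    exact hfg i
  · rintro _ ⟨i, rfl⟩
    have hAg : A.mulVec g = f := by
      ext1 i
      exact ha i
    have : g = A⁻¹.mulVec f := by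
      rw [← hAg, Matrix.mulVec_mulVec, Matrix.nonsing_inv_mul _ hu, Matrix.one_mulVec]
    rw [this]
    exact Ideal.sum_mem _ fun j _ => Ideal.mul_mem_left _ _ (Ideal.subset_span ⟨j, rfl⟩)
  · rw [row_linearIndependent_iff_rank]
    exact le_antisymm (Matrix.rank_le_card_height _) hr1

omit [Fintype ι] [DecidableEq ι] in
theorem linearIndependent_jacobianZero_comp {κ : Type} (f : κ → FPS σ) (e : ι ≃ κ) :
    LinearIndependent ℂ (jacobianZero (f ∘ e)).row ↔ LinearIndependent ℂ (jacobianZero f).row := by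
  have : (jacobianZero (f ∘ e)).row = (jacobianZero f).row ∘ e := rfl
  rw [this, linearIndependent_equiv]

omit [DecidableEq ι] in
theorem isManifoldIdeal_span {f : ι → FPS σ} (hf : IsFormalMapping f)
    (hli : LinearIndependent ℂ (jacobianZero f).row) :
    IsManifoldIdeal (Ideal.span (Set.range f)) (Fintype.card ι) := by
  refine ⟨f ∘ (Fintype.equivFin ι).symm, fun i => hf _, ?_, ?_⟩
  · rw [EquivLike.range_comp]
  · exact (linearIndependent_jacobianZero_comp f _).2 hli

theorem IsManifoldIdeal.constantCoeff_eq_zero {I : Ideal (FPS σ)} {c : ℕ}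
    (hI : IsManifoldIdeal I c) {f : FPS σ} (hf : f ∈ I) : constantCoeff f = 0 := by
  obtain ⟨g, hg, rfl, -⟩ := hI
  have : Ideal.span (Set.range g) ≤ RingHom.ker (constantCoeff (σ := σ) (R := ℂ)) := by
    rw [Ideal.span_le]
    rintro _ ⟨i, rfl⟩
    exact hg i
  exact this hf

/-- Any system of generators of the right cardinality has independent differentials. -/
theorem IsManifoldIdeal.linearIndependent [Fintype σ] {I : Ideal (FPS σ)} {c : ℕ}
    (hI : IsManifoldIdeal I c) (hc : Fintype.card ι = c) {g : ι → FPS σ}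
    (hg : Ideal.span (Set.range g) = I) :
    IsFormalMapping g ∧ LinearIndependent ℂ (jacobianZero g).row := by
  have hg0 : IsFormalMapping g := fun i =>
    hI.constantCoeff_eq_zero (hg ▸ Ideal.subset_span ⟨i, rfl⟩)
  refine ⟨hg0, ?_⟩
  obtain ⟨f, hf, hfI, hli⟩ := hI
  let e : ι ≃ Fin c := Fintype.equivFinOfCardEq hc
  refine (generators_of_mem_span (f := f ∘ e) hg0 (fun i => ?_)
    ((linearIndependent_jacobianZero_comp f e).2 hli)).2
  rw [hg, ← hfI]
  exact Ideal.subset_span ⟨_, rfl⟩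

/-- Both the uniqueness of the CR orbit and its equations `f(Z) = 0` are obtained by proving one
inclusion and counting codimensions. -/
theorem IsManifoldIdeal.eq_of_le [Fintype σ] {I J : Ideal (FPS σ)} {c : ℕ}
    (hI : IsManifoldIdeal I c) (hJ : IsManifoldIdeal J c) (h : I ≤ J) : I = J := by
  obtain ⟨f, hf, rfl, hfli⟩ := hI
  obtain ⟨g, hg, rfl, -⟩ := hJ
  exact (generators_of_mem_span hg (fun i => h (Ideal.subset_span ⟨i, rfl⟩)) hfli).1

/-- Cramer's rule: the differentials of `ρ` in all directions are combinations of those in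
directions for which the Jacobian determinant does not vanish at the origin. -/
theorem exists_pderiv_eq_sum {ρ : ι → FPS σ} {c : ι → σ}
    (h : ((jacobianZero ρ).submatrix id c).det ≠ 0) (s : σ) :
    ∃ w : ι → FPS σ, ∀ i, pderiv ℂ s (ρ i) = ∑ k, w k * pderiv ℂ (c k) (ρ i) := by
  let A : Matrix ι ι (FPS σ) := (jacobian ρ).submatrix id c
  have hu : IsUnit A.det := isUnit_det_of_map h
  refine ⟨A⁻¹.mulVec fun i => pderiv ℂ s (ρ i), fun i => ?_⟩
  have h1 : A.mulVec (A⁻¹.mulVec fun i => pderiv ℂ s (ρ i)) = fun i => pderiv ℂ s (ρ i) := by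
    rw [Matrix.mulVec_mulVec, Matrix.mul_nonsing_inv _ hu, Matrix.one_mulVec]
  have h2 := congrFun h1 i
  rw [← h2]
  exact Finset.sum_congr rfl fun k _ => mul_comm _ _

end ManifoldIdeals

/-! ### The ideal of the orbit of a set of vector fields. -/

section Orbit

variable {σ : Type}

/-- The successive action of a list of vector fields on a power series. -/
def wordAction (l : List (FormalVectorField σ)) (f : FPS σ) : FPS σ := l.foldl (fun g V => V g) f

@[simp] theorem wordAction_nil (f : FPS σ) : wordAction [] f = f := rfl

@[simp] theorem wordAction_cons (V : FormalVectorField σ) (l : List (FormalVectorField σ))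
    (f : FPS σ) : wordAction (V :: l) f = wordAction l (V f) := rfl

theorem wordAction_add (l : List (FormalVectorField σ)) (f g : FPS σ) :
    wordAction l (f + g) = wordAction l f + wordAction l g := by
  induction l generalizing f g with
  | nil => rfl
  | cons V l ih => simp [ih]

theorem wordAction_zero (l : List (FormalVectorField σ)) : wordAction l (0 : FPS σ) = 0 := by
  induction l with
  | nil => rfl
  | cons V l ih => simp [ih]

/-- The largest ideal of series vanishing at the origin that is stable under the vector fields
in `S`: all words in `S` applied to its elements vanish at the origin. -/
def orbitIdeal (S : Set (FormalVectorField σ)) : Ideal (FPS σ) where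
  carrier := {f | ∀ l : List (FormalVectorField σ), (∀ V ∈ l, V ∈ S) →
    constantCoeff (wordAction l f) = 0}
  zero_mem' l _ := by rw [wordAction_zero, map_zero]
  add_mem' hf hg l hl := by rw [wordAction_add, map_add, hf l hl, hg l hl, add_zero]
  smul_mem' a f hf l hl := by
    rw [smul_eq_mul]
    -- By Leibniz `V(a f) = a V f + f V a`, and `V f` has the same property as `f`; so the induction
    -- must allow both factors to change.
    induction l generalizing a f with
    | nil => simpa using Or.inr (hf [] (by simp))
    | cons V l ih =>
      have hl' : ∀ W ∈ l, W ∈ S := fun W hW => hl W (List.mem_cons_of_mem _ hW)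
      have hV : V ∈ S := hl V List.mem_cons_self
      rw [wordAction_cons, Derivation.leibniz, smul_eq_mul, smul_eq_mul, wordAction_add, map_add,
        ih a (V f) (fun l' h' => ?_) hl', mul_comm f, ih (V a) f hf hl', add_zero]
      exact hf (V :: l') (by simpa using ⟨hV, h'⟩)

theorem constantCoeff_of_mem_orbitIdeal {S : Set (FormalVectorField σ)} {f : FPS σ}
    (hf : f ∈ orbitIdeal S) : constantCoeff f = 0 := hf [] (by simp)

theorem isTangent_orbitIdeal {S : Set (FormalVectorField σ)} {V : FormalVectorField σ}
    (hV : V ∈ S) : IsTangent V (orbitIdeal S) :=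
  fun _ hf l hl => hf (V :: l) (by simpa using ⟨hV, hl⟩)

/-- Words in `S` never leave `J`, and `J` vanishes at the origin. -/
theorem le_orbitIdeal {S : Set (FormalVectorField σ)} {J : Ideal (FPS σ)}
    (h0 : ∀ f ∈ J, constantCoeff f = 0) (hS : ∀ V ∈ S, IsTangent V J) : J ≤ orbitIdeal S := by
  intro f hf l hl
  induction l generalizing f with
  | nil => exact h0 f hf
  | cons V l ih =>
    exact ih (hS V (hl V List.mem_cons_self) f hf)
      fun W hW => hl W (List.mem_cons_of_mem _ hW)

end Orbit

/-! ### Taylor expansion along almost commuting vector fields. -/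

section Taylor

variable {σ : Type} [Fintype σ]

omit [Fintype σ] in
-- Swapping adjacent letters costs an element of `Q`, and later letters keep it in `Q`, where
-- constant terms vanish.
theorem wordAction_perm {Q : Ideal (FPS σ)} (X' : σ → FormalVectorField σ)
    (h0 : ∀ f ∈ Q, constantCoeff f = 0) (hX : ∀ i, IsTangent (X' i) Q)
    (hcomm : ∀ i j f, X' i (X' j f) - X' j (X' i f) ∈ Q) {l l' : List σ} (h : l.Perm l')
    (f : FPS σ) : constantCoeff (wordAction (l.map X') f) =
      constantCoeff (wordAction (l'.map X') f) := by
  have hQ : ∀ (l : List σ) f, f ∈ Q → constantCoeff (wordAction (l.map X') f) = 0 := by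
    intro l
    induction l with
    | nil => exact h0
    | cons i l ih => exact fun f hf => ih _ (hX i f hf)
  induction h generalizing f with
  | nil => rfl
  | cons i _ ih => exact ih _
  | swap i j l =>
    have := hQ l _ (hcomm i j f)
    simp only [List.map_cons, wordAction_cons]
    have h2 : X' i (X' j f) = (X' i (X' j f) - X' j (X' i f)) + X' j (X' i f) := by ring
    rw [h2, wordAction_add, map_add, this, zero_add]
  | trans _ _ ih1 ih2 => exact (ih1 f).trans (ih2 f)

/-- The Taylor expansion of `f` at the origin along the vector fields `X'`. -/
def taylorAlong (X' : σ → FormalVectorField σ) (f : FPS σ) : FPS σ := fun m =>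
  (∏ i, ((m i).factorial : ℂ))⁻¹ * constantCoeff (wordAction (m.toMultiset.toList.map X') f)

theorem coeff_taylorAlong (X' : σ → FormalVectorField σ) (f : FPS σ) (m : σ →₀ ℕ) :
    coeff m (taylorAlong X' f) = (∏ i, ((m i).factorial : ℂ))⁻¹ *
      constantCoeff (wordAction (m.toMultiset.toList.map X') f) := rfl

theorem constantCoeff_taylorAlong (X' : σ → FormalVectorField σ) (f : FPS σ) :
    constantCoeff (taylorAlong X' f) = constantCoeff f := by
  rw [← coeff_zero_eq_constantCoeff_apply, coeff_taylorAlong]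
  simp

theorem pderiv_taylorAlong {Q : Ideal (FPS σ)} (X' : σ → FormalVectorField σ)
    (h0 : ∀ f ∈ Q, constantCoeff f = 0) (hX : ∀ i, IsTangent (X' i) Q)
    (hcomm : ∀ i j f, X' i (X' j f) - X' j (X' i f) ∈ Q) (i : σ) (f : FPS σ) :
    pderiv ℂ i (taylorAlong X' f) = taylorAlong X' (X' i f) := by
  classical
  ext m
  rw [coeff_pderiv, coeff_taylorAlong, coeff_taylorAlong]
  -- The extra letter `i` may be moved to the front, where it acts on `f` first; the factor `m i +
  -- 1` from differentiation cancels against the factorial.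
  have hl : (m + Finsupp.single i 1).toMultiset.toList.Perm (i :: m.toMultiset.toList) := by
    rw [← Multiset.coe_eq_coe, Multiset.coe_toList, ← Multiset.cons_coe, Multiset.coe_toList]
    rw [map_add, Finsupp.toMultiset_single, one_smul, add_comm, Multiset.singleton_add]
  rw [wordAction_perm X' h0 hX hcomm hl, List.map_cons, wordAction_cons]
  have hp : ∏ j : σ, (((m + Finsupp.single i 1 : σ →₀ ℕ) j).factorial : ℂ) =
      (m i + 1) * ∏ j, ((m j).factorial : ℂ) := by
    rw [← Finset.mul_prod_erase _ _ (Finset.mem_univ i),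
      ← Finset.mul_prod_erase (a := i) _ (fun j => ((m j).factorial : ℂ)) (Finset.mem_univ i),
      ← mul_assoc]
    congr 1
    · simp [Nat.factorial_succ]
    · refine Finset.prod_congr rfl fun j hj => ?_
      simp [(Finset.ne_of_mem_erase hj).symm]
  rw [hp, mul_inv]
  have h1 : (m i + 1 : ℂ) ≠ 0 := Nat.cast_add_one_ne_zero _
  field_simp

end Taylor

/-! ### A formal Nagano theorem. -/

section Nagano

variable {σ : Type} [Fintype σ]

/-- Data adapted to a Lie algebra `g` of vector fields, stable under multiplication by series:
vector fields `frame i`, `i ∈ I`, in `g`, dual to the coordinates `x_i`, `i ∈ I`, and spanning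
the values of `g` at the origin. -/
structure AdaptedFrame (g : LieSubalgebra ℂ (FormalVectorField σ)) (I : Finset σ) where
  smul_mem : ∀ (a : FPS σ), ∀ V ∈ g, a • V ∈ g
  frame : σ → FormalVectorField σ
  frame_mem : ∀ i, frame i ∈ g
  frame_eq_zero : ∀ i ∉ I, frame i = 0
  frame_self : ∀ i ∈ I, frame i (X i) = 1
  frame_of_ne : ∀ i, ∀ j ∈ I, i ≠ j → frame i (X j) = 0
  injective : ∀ V ∈ g, (∀ i ∈ I, constantCoeff (V (X i)) = 0) → ∀ i, constantCoeff (V (X i)) = 0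

namespace AdaptedFrame

variable {g : LieSubalgebra ℂ (FormalVectorField σ)} {I : Finset σ} (A : AdaptedFrame g I)

omit [Fintype σ] in
theorem frame_frame_X {j k : σ} (hk : k ∈ I) (V : FormalVectorField σ) :
    V (A.frame j (X k)) = 0 := by
  by_cases h : j = k
  · subst h
    rw [A.frame_self j hk, Derivation.map_one_eq_zero]
  · rw [A.frame_of_ne j k hk h, map_zero]

/-- The members of `g` annihilating the coordinates `x_i`, `i ∈ I`. -/
def vertical (g : LieSubalgebra ℂ (FormalVectorField σ)) (I : Finset σ) :
    Set (FormalVectorField σ) := {V | V ∈ g ∧ ∀ i ∈ I, V (X i) = 0}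

include A in
omit [Fintype σ] in
-- Frame and vertical fields send `X k`, `k ∈ I`, to constants, which derivations kill.
theorem lie_vertical {V W : FormalVectorField σ} (hV : V ∈ Set.range A.frame ∪ vertical g I)
    (hW : W ∈ vertical g I) : ⁅V, W⁆ ∈ vertical g I := by
  refine ⟨g.lie_mem ?_ hW.1, fun k hk => ?_⟩
  · rcases hV with ⟨i, rfl⟩ | hV
    exacts [A.frame_mem i, hV.1]
  · rw [Derivation.commutator_apply, hW.2 k hk, map_zero]
    rcases hV with ⟨i, rfl⟩ | hV
    · rw [A.frame_frame_X hk, sub_zero]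
    · rw [hV.2 k hk, map_zero, sub_zero]

include A in
theorem constantCoeff_vertical {W : FormalVectorField σ} (hW : W ∈ vertical g I) (f : FPS σ) :
    constantCoeff (W f) = 0 := by
  rw [vectorField_apply W f, map_sum]
  refine Finset.sum_eq_zero fun i _ => ?_
  rw [map_mul, A.injective W hW.1 (fun i hi => by rw [hW.2 i hi, map_zero]) i, zero_mul]

include A in
-- The vertical field is moved past all later letters by `V W = [V, W] + W V`, the bracket being
-- vertical again; applied last, a vertical field gives a series vanishing at the origin.
theorem vertical_mem_orbitIdeal_aux {W : FormalVectorField σ} (hW : W ∈ vertical g I) (f : FPS σ) :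
    W f ∈ orbitIdeal (Set.range A.frame ∪ vertical g I) := by
  intro l hl
  induction l generalizing W f with
  | nil => exact A.constantCoeff_vertical hW f
  | cons V l ih =>
    have hl' : ∀ U ∈ l, U ∈ Set.range A.frame ∪ vertical g I :=
      fun U hU => hl U (List.mem_cons_of_mem _ hU)
    have hV := hl V List.mem_cons_self
    have : V (W f) = ⁅V, W⁆ f + W (V f) := by rw [Derivation.commutator_apply]; ring
    rw [wordAction_cons, this, wordAction_add, map_add, ih (A.lie_vertical hV hW) f hl',
      ih hW (V f) hl', add_zero]

omit [Fintype σ] in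
theorem sub_sum_mem_vertical {V : FormalVectorField σ} (hV : V ∈ g) :
    V - ∑ i ∈ I, V (X i) • A.frame i ∈ vertical g I := by
  classical
  refine ⟨g.sub_mem hV (g.toSubmodule.sum_mem fun i _ => A.smul_mem _ _ (A.frame_mem i)),
    fun k hk => ?_⟩
  rw [Derivation.sub_apply, sum_vectorField_apply, Finset.sum_eq_single k]
  · rw [Derivation.smul_apply, A.frame_self k hk, smul_eq_mul, mul_one, sub_self]
  · intro i _ hik
    rw [Derivation.smul_apply, A.frame_of_ne i k hk hik, smul_zero]
  · exact fun h => absurd hk h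

/-- Every member of `g` is a series combination of the frame plus a vertical field, so stability
under these two kinds of fields is enough. -/
theorem orbitIdeal_aux_le :
    orbitIdeal (Set.range A.frame ∪ vertical g I) ≤ orbitIdeal (g : Set (FormalVectorField σ)) := by
  refine le_orbitIdeal (fun f hf => constantCoeff_of_mem_orbitIdeal hf) fun V hV f hf => ?_
  have h1 : V f = (V - ∑ i ∈ I, V (X i) • A.frame i) f + ∑ i ∈ I, V (X i) * A.frame i f := by
    rw [Derivation.sub_apply, sum_vectorField_apply]
    simp
  rw [h1]
  refine Ideal.add_mem _ (A.vertical_mem_orbitIdeal_aux (A.sub_sum_mem_vertical hV) f) ?_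
  exact Ideal.sum_mem _ fun i _ => Ideal.mul_mem_left _ _
    (isTangent_orbitIdeal (Or.inl ⟨i, rfl⟩) f hf)

theorem mem_orbitIdeal_of_frame {f : FPS σ}
    (h : ∀ l : List σ, constantCoeff (wordAction (l.map A.frame) f) = 0) :
    f ∈ orbitIdeal (g : Set (FormalVectorField σ)) := by
  refine A.orbitIdeal_aux_le fun l hl => ?_
  induction l generalizing f with
  | nil => exact h []
  | cons V l ih =>
    have hl' : ∀ U ∈ l, U ∈ Set.range A.frame ∪ vertical g I :=
      fun U hU => hl U (List.mem_cons_of_mem _ hU)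
    rcases hl V List.mem_cons_self with ⟨i, rfl⟩ | hV
    · exact ih (fun l' => h (i :: l')) hl'
    · exact A.vertical_mem_orbitIdeal_aux hV f l hl'

/-- The bracket of two frame fields is vertical. -/
theorem frame_comm (i j : σ) (f : FPS σ) :
    A.frame i (A.frame j f) - A.frame j (A.frame i f) ∈
      orbitIdeal (g : Set (FormalVectorField σ)) := by
  rw [← Derivation.commutator_apply]
  refine A.orbitIdeal_aux_le (A.vertical_mem_orbitIdeal_aux
    ⟨g.lie_mem (A.frame_mem i) (A.frame_mem j), fun k hk => ?_⟩ f)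
  rw [Derivation.commutator_apply, A.frame_frame_X hk, A.frame_frame_X hk,
    sub_zero]

/-- The Taylor expansion along the frame. -/
def taylor (f : FPS σ) : FPS σ := taylorAlong A.frame f

theorem constantCoeff_taylor (f : FPS σ) : constantCoeff (A.taylor f) = constantCoeff f :=
  constantCoeff_taylorAlong _ f

theorem pderiv_taylor (i : σ) (f : FPS σ) :
    pderiv ℂ i (A.taylor f) = A.taylor (A.frame i f) :=
  pderiv_taylorAlong A.frame (fun _ => constantCoeff_of_mem_orbitIdeal)
    (fun i => isTangent_orbitIdeal (A.frame_mem i)) A.frame_comm i f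

theorem taylor_zero : A.taylor 0 = 0 := by
  ext m
  rw [taylor, coeff_taylorAlong, wordAction_zero]
  simp

theorem pderiv_taylor_eq_zero {i : σ} (hi : i ∉ I) (f : FPS σ) :
    pderiv ℂ i (A.taylor f) = 0 := by
  rw [A.pderiv_taylor, A.frame_eq_zero i hi, Derivation.zero_apply, A.taylor_zero]

theorem frame_eq_pderiv {h : FPS σ} (hh : ∀ i ∉ I, pderiv ℂ i h = 0) (i : σ) :
    A.frame i h = pderiv ℂ i h := by
  by_cases hi : i ∈ I
  · rw [vectorField_apply, Finset.sum_eq_single i]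
    · rw [A.frame_self i hi, one_mul]
    · intro j _ hj
      by_cases hjI : j ∈ I
      · rw [A.frame_of_ne i j hjI hj.symm, zero_mul]
      · rw [hh j hjI, mul_zero]
    · simp
  · rw [A.frame_eq_zero i hi, hh i hi, Derivation.zero_apply]

theorem frame_taylor (i : σ) (f : FPS σ) : A.frame i (A.taylor f) = A.taylor (A.frame i f) := by
  rw [A.frame_eq_pderiv (fun j hj => A.pderiv_taylor_eq_zero hj f), A.pderiv_taylor]

/-- The expansion intertwines the frame with itself, so `f` and `A.taylor f` have the same frame
derivatives at the origin. -/
theorem sub_taylor_mem (f : FPS σ) :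
    f - A.taylor f ∈ orbitIdeal (g : Set (FormalVectorField σ)) := by
  refine A.mem_orbitIdeal_of_frame fun l => ?_
  induction l generalizing f with
  | nil => simp [A.constantCoeff_taylor]
  | cons i l ih => rw [List.map_cons, wordAction_cons, map_sub, A.frame_taylor, ih]

include A in
/-- A series in the orbit ideal depending only on the coordinates `x_i`, `i ∈ I`, vanishes. -/
theorem eq_zero_of_mem {h : FPS σ} (hQ : h ∈ orbitIdeal (g : Set (FormalVectorField σ)))
    (hh : ∀ i ∉ I, pderiv ℂ i h = 0) : h = 0 := by
  have key : ∀ (k : ℕ) (m : σ →₀ ℕ), m.degree = k → ∀ h : FPS σ,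
      h ∈ orbitIdeal (g : Set (FormalVectorField σ)) → (∀ i ∉ I, pderiv ℂ i h = 0) →
      coeff m h = 0 := by
    intro k
    induction k with
    | zero =>
      intro m hm h hQ _
      have : m = 0 := (Finsupp.degree_eq_zero_iff m).1 hm
      subst this
      exact constantCoeff_of_mem_orbitIdeal hQ
    | succ k ih =>
      intro m hm h hQ hh
      obtain ⟨i, hi⟩ : ∃ i, m i ≠ 0 := by
        by_contra! h0
        have : m = 0 := Finsupp.ext h0
        simp [this] at hm
      have hle : Finsupp.single i 1 ≤ m := by simpa using Nat.one_le_iff_ne_zero.2 hi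
      -- On series in the coordinates from `I` the frame acts by partial derivatives, so these
      -- derivatives remain in the orbit ideal.
      have h1 := ih (m - Finsupp.single i 1) (by
        have := congrArg Finsupp.degree (tsub_add_cancel_of_le hle)
        rw [map_add, Finsupp.degree_single] at this
        omega) (pderiv ℂ i h) (by
        rw [← A.frame_eq_pderiv hh]
        exact isTangent_orbitIdeal (A.frame_mem i) h hQ) (fun j hj => by
        rw [pderiv_comm, hh j hj, map_zero])
      rw [coeff_pderiv, tsub_add_cancel_of_le hle] at h1
      exact (mul_eq_zero.1 h1).resolve_right (Nat.cast_add_one_ne_zero _)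
  ext m
  exact key _ m rfl h hQ hh

/-- The parametrization of the orbit by the coordinates `x_i`, `i ∈ I`. -/
def param (i : σ) : FPS σ := A.taylor (X i)

theorem isFormalMapping_param : IsFormalMapping A.param :=
  fun i => by rw [param, constantCoeff_taylor, constantCoeff_X]

theorem pderiv_subst_param {i : σ} (hi : i ∉ I) (f : FPS σ) :
    pderiv ℂ i (subst A.param f) = 0 := by
  rw [pderiv_subst A.isFormalMapping_param]
  refine Finset.sum_eq_zero fun j _ => ?_
  rw [param, A.pderiv_taylor_eq_zero hi, mul_zero]

theorem param_of_mem {i : σ} (hi : i ∈ I) : A.param i = X i := by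
  refine (sub_eq_zero.1 (A.eq_zero_of_mem (A.sub_taylor_mem (X i)) fun j hj => ?_)).symm
  rw [map_sub, A.pderiv_taylor_eq_zero hj, sub_zero, pderiv_X_of_ne]
  rintro rfl
  exact hj hi

theorem span_le_orbitIdeal :
    Ideal.span (Set.range fun l : {l // l ∉ I} => X l.1 - A.param l.1) ≤
      orbitIdeal (g : Set (FormalVectorField σ)) := by
  rw [Ideal.span_le]
  rintro _ ⟨l, rfl⟩
  exact A.sub_taylor_mem _

theorem sub_subst_param_mem (f : FPS σ) : f - subst A.param f ∈
    Ideal.span (Set.range fun l : {l // l ∉ I} => X l.1 - A.param l.1) := by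
  obtain ⟨c, hc, -⟩ := subst_sub_subst (F := X) (fun i => constantCoeff_X i)
    A.isFormalMapping_param f
  rw [subst_self, id] at hc
  rw [hc]
  refine Ideal.sum_mem _ fun i _ => ?_
  by_cases hi : i ∈ I
  · rw [A.param_of_mem hi, sub_self, mul_zero]
    exact Ideal.zero_mem _
  · exact Ideal.mul_mem_left _ _ (Ideal.subset_span ⟨⟨i, hi⟩, rfl⟩)

/-- Modulo the orbit ideal `f` equals its composition with `param`, a series in the coordinates from
`I`, and only zero is such a series in the ideal. -/
theorem mem_orbitIdeal_iff_subst {f : FPS σ} :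
    f ∈ orbitIdeal (g : Set (FormalVectorField σ)) ↔ subst A.param f = 0 := by
  have h1 := A.span_le_orbitIdeal (A.sub_subst_param_mem f)
  refine ⟨fun hf => A.eq_zero_of_mem ?_ fun i hi => A.pderiv_subst_param hi f, fun hf => ?_⟩
  · have := Ideal.sub_mem _ hf h1
    rwa [sub_sub_cancel] at this
  · rwa [hf, sub_zero] at h1

theorem orbitIdeal_eq_span : orbitIdeal (g : Set (FormalVectorField σ)) =
    Ideal.span (Set.range fun l : {l // l ∉ I} => X l.1 - A.param l.1) := by
  refine le_antisymm (fun f hf => ?_) A.span_le_orbitIdeal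
  have := A.sub_subst_param_mem f
  rwa [A.mem_orbitIdeal_iff_subst.1 hf, sub_zero] at this

include A in
theorem isPrime_orbitIdeal : (orbitIdeal (g : Set (FormalVectorField σ))).IsPrime := by
  have : orbitIdeal (g : Set (FormalVectorField σ)) =
      RingHom.ker (substAlgHom (R := ℂ) (hasSubst _ A.isFormalMapping_param)) := by
    ext f
    rw [A.mem_orbitIdeal_iff_subst, RingHom.mem_ker, substAlgHom_apply]
  rw [this]
  have : IsDomain (FPS σ) := NoZeroDivisors.to_isDomain _
  exact RingHom.ker_isPrime _

include A in
/-- A formal version of Nagano's theorem: the orbit is a formal manifold. -/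
theorem isManifoldIdeal_orbitIdeal :
    IsManifoldIdeal (orbitIdeal (g : Set (FormalVectorField σ)))
      (Fintype.card σ - I.card) := by
  classical
  rw [A.orbitIdeal_eq_span]
  have hc : Fintype.card {l // l ∉ I} = Fintype.card σ - I.card := by
    rw [Fintype.card_subtype_compl, Fintype.card_coe]
  rw [← hc]
  refine isManifoldIdeal_span (fun l => by simp [A.isFormalMapping_param _]) ?_
  rw [Fintype.linearIndependent_iff]
  intro a ha l
  have h1 := congrFun ha l.1
  rw [Finset.sum_apply, Finset.sum_eq_single l] at h1
  · simpa [jacobianZero_apply, param, A.pderiv_taylor_eq_zero l.2, pderiv_X_self] using h1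
  · intro b _ hb
    have hb' : b.1 ≠ l.1 := fun h => hb (Subtype.ext h)
    simp [jacobianZero_apply, param, A.pderiv_taylor_eq_zero l.2, pderiv_X_of_ne hb']
  · simp

end AdaptedFrame

end Nagano

/-! ### Solving linear equations for vector fields; the implicit function theorem. -/

section Elimination

variable {σ ι : Type} [Fintype ι] [DecidableEq ι]

/-- The vector field `∂_s - ∑ w_k ∂_{c_k}`. -/
def elimField (c : ι → σ) (w : ι → FPS σ) (s : σ) : FormalVectorField σ :=
  pderiv ℂ s - ∑ k, w k • pderiv ℂ (c k)

omit [DecidableEq ι] in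
theorem elimField_apply (c : ι → σ) (w : ι → FPS σ) (s : σ) (f : FPS σ) :
    elimField c w s f = pderiv ℂ s f - ∑ k, w k * pderiv ℂ (c k) f := by
  rw [elimField, Derivation.sub_apply, sum_vectorField_apply]
  rfl

omit [DecidableEq ι] in
theorem elimField_X_self {c : ι → σ} (w : ι → FPS σ) {s : σ} (hs : s ∉ Set.range c) :
    elimField c w s (X s) = 1 := by
  rw [elimField_apply, pderiv_X_self, Finset.sum_eq_zero, sub_zero]
  intro k _
  rw [pderiv_X_of_ne (fun h => hs ⟨k, h.symm⟩), mul_zero]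

omit [DecidableEq ι] in
theorem elimField_X_of_ne {c : ι → σ} (w : ι → FPS σ) {s t : σ} (ht : t ∉ Set.range c)
    (hst : s ≠ t) : elimField c w s (X t) = 0 := by
  rw [elimField_apply, pderiv_X_of_ne hst.symm, Finset.sum_eq_zero, sub_zero]
  intro k _
  rw [pderiv_X_of_ne (fun h => ht ⟨k, h.symm⟩), mul_zero]

theorem exists_elimField {ρ : ι → FPS σ} {c : ι → σ}
    (h : ((jacobianZero ρ).submatrix id c).det ≠ 0) (s : σ) :
    ∃ w : ι → FPS σ, ∀ i, elimField c w s (ρ i) = 0 := by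
  obtain ⟨w, hw⟩ := exists_pderiv_eq_sum h s
  exact ⟨w, fun i => by rw [elimField_apply, hw i, sub_self]⟩

theorem injective_of_minor_ne_zero {κ : Type} {A : Matrix ι κ ℂ} {c : ι → κ}
    (h : (A.submatrix id c).det ≠ 0) : Function.Injective c := by
  intro i j hij
  by_contra hne
  exact h (Matrix.det_zero_of_column_eq hne fun k => by simp [hij])

theorem constantCoeff_vectorField_eq_zero [Fintype σ] {ρ : ι → FPS σ} {c : ι → σ}
    (h : ((jacobianZero ρ).submatrix id c).det ≠ 0) {V : FormalVectorField σ}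
    (hV : ∀ i, constantCoeff (V (ρ i)) = 0)
    (h0 : ∀ t ∉ Set.range c, constantCoeff (V (X t)) = 0) (t : σ) :
    constantCoeff (V (X t)) = 0 := by
  classical
  by_cases ht : t ∈ Set.range c
  · have h1 : ((jacobianZero ρ).submatrix id c).mulVec
        (fun k => constantCoeff (V (X (c k)))) = 0 := by
      ext1 i
      have h2 := hV i
      rw [vectorField_apply, map_sum, ← Finset.sum_subset (Finset.subset_univ
        (Finset.univ.image c)), Finset.sum_image
        (fun _ _ _ _ h' => injective_of_minor_ne_zero h h')] at h2
      · refine Eq.trans ?_ h2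
        refine Finset.sum_congr rfl fun k _ => ?_
        rw [map_mul, mul_comm]
        rfl
      · intro s _ hs
        rw [map_mul, h0 s (by simpa using hs), zero_mul]
    obtain ⟨k, rfl⟩ := ht
    exact congrFun (Matrix.eq_zero_of_mulVec_eq_zero h h1) k
  · exact h0 t ht

/-- The vector fields annihilating the series `G j`. -/
def annihilatorAlg (G : ι → FPS σ) : LieSubalgebra ℂ (FormalVectorField σ) where
  carrier := {V | ∀ j, V (G j) = 0}
  add_mem' hV hW j := by rw [Derivation.add_apply, hV j, hW j, add_zero]
  zero_mem' j := rfl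
  smul_mem' c V hV j := by rw [Derivation.smul_apply, hV j, smul_zero]
  lie_mem' hV hW j := by
    rw [Derivation.commutator_apply, hV j, hW j, map_zero, map_zero, sub_zero]

/-- The formal implicit function theorem. -/
theorem exists_implicit_function {α : Type} [Fintype α] {G : ι → FPS (α ⊕ ι)}
    (hG : IsFormalMapping G) (hdet : ((jacobianZero G).submatrix id Sum.inr).det ≠ 0) :
    ∃ θ : ι → FPS α, IsFormalMapping θ ∧
      ∀ j, subst (Sum.elim (X : α → FPS α) θ) (G j) = 0 := by
  classical
  choose w hw using fun a : α => exists_elimField hdet (Sum.inl a)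
  have hr : ∀ a : α, (Sum.inl a : α ⊕ ι) ∉ Set.range (Sum.inr : ι → α ⊕ ι) := by simp
  -- The Nagano graph for the Lie algebra of fields annihilating `G` lies in `G = 0`; its components
  -- over the `α`-coordinates will be `θ`.
  let A : AdaptedFrame (annihilatorAlg G) (Finset.univ.disjSum (∅ : Finset ι)) :=
    { smul_mem := fun a V hV j => by
        rw [Derivation.smul_apply, hV j, smul_zero]
      frame := Sum.elim (fun a => elimField Sum.inr (w a) (Sum.inl a)) 0
      frame_mem := by
        rintro (a | b)
        · exact hw a
        · exact (annihilatorAlg G).zero_mem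
      frame_eq_zero := by
        rintro (a | b) h
        · simp at h
        · rfl
      frame_self := by
        rintro (a | b) h
        · exact elimField_X_self _ (hr a)
        · simp at h
      frame_of_ne := by
        rintro (a | b) (a' | b') h hne
        · exact elimField_X_of_ne _ (hr a') hne
        · simp at h
        · rfl
        · simp at h
      injective := fun V hV h0 => by
        refine constantCoeff_vectorField_eq_zero hdet (fun j => by rw [hV j, map_zero]) ?_
        rintro (a | b) ht
        · exact h0 _ (by simp)
        · simp at ht }
  have hp : ∀ b, ∃ θ : FPS α, A.param (Sum.inr b) = rename Sum.inl θ := fun b =>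
    exists_rename_inl_of_pderiv_eq_zero _ fun t => A.pderiv_taylor_eq_zero (by simp) _
  choose θ hθ using hp
  have hθ0 : IsFormalMapping θ := fun b => by
    have := A.isFormalMapping_param (Sum.inr b)
    rwa [hθ b, constantCoeff_rename] at this
  refine ⟨θ, hθ0, fun j => ?_⟩
  have hE : IsFormalMapping (Sum.elim (X : α → FPS α) θ) :=
    IsFormalMapping.sumElim (fun i => constantCoeff_X i) hθ0
  have hGQ : G j ∈ orbitIdeal (annihilatorAlg G : Set (FormalVectorField (α ⊕ ι))) := by
    refine A.mem_orbitIdeal_of_frame fun l => ?_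
    cases l with
    | nil => exact hG j
    | cons i l => rw [List.map_cons, wordAction_cons, A.frame_mem i j, wordAction_zero, map_zero]
  have h1 := A.mem_orbitIdeal_iff_subst.1 hGQ
  have h2 : A.param = fun i => rename Sum.inl (Sum.elim (X : α → FPS α) θ i) := by
    ext1 i
    rcases i with a | b
    · rw [A.param_of_mem (by simp), Sum.elim_inl, rename_X]
    · rw [hθ b, Sum.elim_inr]
  rw [h2, ← rename_subst Sum.inl hE] at h1
  exact rename_injective (R := ℂ) (Function.Embedding.inl : α ↪ α ⊕ ι)
    (h1.trans (map_zero _).symm)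

end Elimination

/-! ### The involution σ and the Lie algebra of a real manifold. -/

section Sigma

variable {N : ℕ}

/-- The involution `sigma` as a ring homomorphism. -/
def sigmaHom : FPS₂ N →+* FPS₂ N :=
  conjSeries.comp (rename (R := ℂ) (Sum.swap : Fin N ⊕ Fin N → Fin N ⊕ Fin N)).toRingHom

theorem sigmaHom_apply (f : FPS₂ N) : sigmaHom f = sigma f := rfl

theorem sigma_sigma (f : FPS₂ N) : sigma (sigma f) = f := by
  rw [sigma, sigma, ← conjSeries_rename, conjSeries_conjSeries, rename_rename]
  simp

theorem sigma_C (c : ℂ) : sigma (C c : FPS₂ N) = C (starRingEnd ℂ c) := by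
  rw [sigma, rename_C, conjSeries, map_C]

theorem sigma_smul (c : ℂ) (f : FPS₂ N) : sigma (c • f) = starRingEnd ℂ c • sigma f := by
  rw [smul_eq_C_mul, smul_eq_C_mul, ← sigma_C]
  exact map_mul sigmaHom _ _

theorem constantCoeff_sigma (f : FPS₂ N) :
    constantCoeff (sigma f) = starRingEnd ℂ (constantCoeff f) := by
  rw [sigma, constantCoeff_conjSeries, constantCoeff_rename]

theorem pderiv_sigma (i : Fin N ⊕ Fin N) (f : FPS₂ N) :
    pderiv ℂ i (sigma f) = sigma (pderiv ℂ i.swap f) := by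
  rw [sigma, pderiv_conjSeries]
  have := pderiv_rename (Equiv.sumComm (Fin N) (Fin N)).toEmbedding i.swap f
  have h2 : (Equiv.sumComm (Fin N) (Fin N)).toEmbedding i.swap = i := Sum.swap_swap i
  rw [h2] at this
  exact congrArg conjSeries this

theorem sigma_rename_inl (f : FPS (Fin N)) :
    sigma (rename Sum.inl f) = rename Sum.inr (conjSeries f) := by
  rw [sigma, rename_rename, conjSeries_rename]
  rfl

/-- The vector field `σ V σ`. -/
def sigmaField (V : FormalVectorField (Fin N ⊕ Fin N)) : FormalVectorField (Fin N ⊕ Fin N) :=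
  Derivation.mk'
    { toFun := fun f => sigma (V (sigma f))
      map_add' := fun f g => by simp only [← sigmaHom_apply, map_add]
      map_smul' := fun c f => by
        rw [sigma_smul, Derivation.map_smul, sigma_smul, Complex.conj_conj, RingHom.id_apply] }
    fun f g => by
      change sigma (V (sigma (f * g))) = f * sigma (V (sigma g)) + g * sigma (V (sigma f))
      have h : sigma (f * g) = sigma f * sigma g := map_mul sigmaHom f g
      rw [h, Derivation.leibniz]
      simp only [smul_eq_mul, ← sigmaHom_apply, map_add, map_mul]
      simp only [sigmaHom_apply, sigma_sigma]

theorem sigmaField_apply (V : FormalVectorField (Fin N ⊕ Fin N)) (f : FPS₂ N) :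
    sigmaField V f = sigma (V (sigma f)) := rfl

theorem sigma_vectorField (V : FormalVectorField (Fin N ⊕ Fin N)) (f : FPS₂ N) :
    sigma (V f) = sigmaField V (sigma f) := by rw [sigmaField_apply, sigma_sigma]

theorem sigmaField_sigmaField (V : FormalVectorField (Fin N ⊕ Fin N)) :
    sigmaField (sigmaField V) = V := by
  ext1 f
  rw [sigmaField_apply, sigmaField_apply, sigma_sigma, sigma_sigma]

theorem IsTangent.sigmaField {I : Ideal (FPS₂ N)} (hI : IsRealIdeal I)
    {V : FormalVectorField (Fin N ⊕ Fin N)} (hV : IsTangent V I) :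
    IsTangent (FormalSegre.sigmaField V) I :=
  fun f hf => hI _ (hV _ (hI f hf))

theorem IsOneZero.sigmaField {V : FormalVectorField (Fin N ⊕ Fin N)} (hV : IsOneZero V) :
    IsZeroOne (FormalSegre.sigmaField V) := by
  obtain ⟨a, rfl⟩ := hV
  refine ⟨fun j => sigma (a j), ?_⟩
  ext1 f
  rw [sigmaField_apply, sum_vectorField_apply, sum_vectorField_apply, ← sigmaHom_apply, map_sum]
  refine Finset.sum_congr rfl fun j _ => ?_
  rw [Derivation.smul_apply, Derivation.smul_apply, smul_eq_mul, map_mul, pderiv_sigma,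
    sigmaHom_apply, sigmaHom_apply, sigma_sigma]
  rfl

theorem IsZeroOne.sigmaField {V : FormalVectorField (Fin N ⊕ Fin N)} (hV : IsZeroOne V) :
    IsOneZero (FormalSegre.sigmaField V) := by
  obtain ⟨a, rfl⟩ := hV
  refine ⟨fun j => sigma (a j), ?_⟩
  ext1 f
  rw [sigmaField_apply, sum_vectorField_apply, sum_vectorField_apply, ← sigmaHom_apply, map_sum]
  refine Finset.sum_congr rfl fun j _ => ?_
  rw [Derivation.smul_apply, Derivation.smul_apply, smul_eq_mul, map_mul, pderiv_sigma,
    sigmaHom_apply, sigmaHom_apply, sigma_sigma]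
  rfl

theorem isZeroOne_iff (V : FormalVectorField (Fin N ⊕ Fin N)) :
    IsZeroOne V ↔ ∀ k, V (X (Sum.inl k)) = 0 := by
  refine ⟨?_, fun h => ⟨fun j => V (X (Sum.inr j)), ?_⟩⟩
  · rintro ⟨a, rfl⟩ k
    rw [sum_vectorField_apply]
    refine Finset.sum_eq_zero fun j _ => ?_
    rw [Derivation.smul_apply, pderiv_X_of_ne (by simp), smul_zero]
  · conv_lhs => rw [vectorField_eq_sum V, Fintype.sum_sum_type]
    simp [h]

theorem isOneZero_iff (V : FormalVectorField (Fin N ⊕ Fin N)) :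
    IsOneZero V ↔ ∀ k, V (X (Sum.inr k)) = 0 := by
  refine ⟨?_, fun h => ⟨fun j => V (X (Sum.inl j)), ?_⟩⟩
  · rintro ⟨a, rfl⟩ k
    rw [sum_vectorField_apply]
    refine Finset.sum_eq_zero fun j _ => ?_
    rw [Derivation.smul_apply, pderiv_X_of_ne (by simp), smul_zero]
  · conv_lhs => rw [vectorField_eq_sum V, Fintype.sum_sum_type]
    simp [h]

variable {I : Ideal (FPS₂ N)}

/-- The generators are stable under multiplication by series, and `a [V, W] = [a V, W] + W(a) V`
passes this on to brackets. -/
theorem smul_mem_lieAlg {V : FormalVectorField (Fin N ⊕ Fin N)} (hV : V ∈ lieAlg I) (a : FPS₂ N) :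
    a • V ∈ lieAlg I := by
  induction hV using LieSubalgebra.lieSpan_induction generalizing a with
  | mem V hV =>
    refine LieSubalgebra.subset_lieSpan ⟨?_, fun f hf => ?_⟩
    · simp only [isZeroOne_iff, isOneZero_iff, Derivation.smul_apply] at hV ⊢
      refine hV.1.imp (fun h k => ?_) (fun h k => ?_) <;> rw [h k, smul_zero]
    · exact I.mul_mem_left a (hV.2 f hf)
  | zero => rw [smul_zero]; exact (lieAlg I).zero_mem
  | add V W _ _ hV hW => rw [smul_add]; exact (lieAlg I).add_mem (hV a) (hW a)
  | smul c V _ hV => rw [smul_comm]; exact (lieAlg I).smul_mem c (hV a)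
  | lie V W hV' hW' hV hW =>
    have : a • ⁅V, W⁆ = ⁅a • V, W⁆ + W a • V := by
      ext1 f
      simp only [Derivation.smul_apply, Derivation.add_apply, Derivation.commutator_apply,
        smul_eq_mul, Derivation.leibniz]
      ring
    rw [this]
    exact (lieAlg I).add_mem ((lieAlg I).lie_mem (hV a) hW') (hV _)

theorem isTangent_of_mem_lieAlg {J : Ideal (FPS₂ N)}
    (h : ∀ V, IsOneZero V ∨ IsZeroOne V → IsTangent V I → IsTangent V J)
    {V : FormalVectorField (Fin N ⊕ Fin N)} (hV : V ∈ lieAlg I) : IsTangent V J := by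
  induction hV using LieSubalgebra.lieSpan_induction with
  | mem V hV => exact h V hV.1 hV.2
  | zero => exact fun f _ => J.zero_mem
  | add V W _ _ hV hW => exact fun f hf => J.add_mem (hV f hf) (hW f hf)
  | smul c V _ hV => exact fun f hf => Submodule.smul_of_tower_mem J c (hV f hf)
  | lie V W _ _ hV hW =>
    intro f hf
    rw [Derivation.commutator_apply]
    exact J.sub_mem (hV _ (hW f hf)) (hW _ (hV f hf))

theorem sigmaField_mem_lieAlg (hI : IsRealIdeal I) {V : FormalVectorField (Fin N ⊕ Fin N)}
    (hV : V ∈ lieAlg I) : sigmaField V ∈ lieAlg I := by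
  induction hV using LieSubalgebra.lieSpan_induction with
  | mem V hV =>
    exact LieSubalgebra.subset_lieSpan
      ⟨hV.1.symm.imp IsZeroOne.sigmaField IsOneZero.sigmaField, hV.2.sigmaField hI⟩
  | zero =>
    have : sigmaField (0 : FormalVectorField (Fin N ⊕ Fin N)) = 0 := by
      ext1 f
      exact map_zero sigmaHom
    rw [this]
    exact (lieAlg I).zero_mem
  | add V W _ _ hV hW =>
    have : sigmaField (V + W) = sigmaField V + sigmaField W := by
      ext1 f
      exact map_add sigmaHom _ _
    rw [this]
    exact (lieAlg I).add_mem hV hW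
  | smul c V _ hV =>
    have : sigmaField (c • V) = starRingEnd ℂ c • sigmaField V := by
      ext1 f
      exact sigma_smul _ _
    rw [this]
    exact (lieAlg I).smul_mem _ hV
  | lie V W _ _ hV hW =>
    have : sigmaField ⁅V, W⁆ = ⁅sigmaField V, sigmaField W⁆ := by
      ext1 f
      simp only [sigmaField_apply, Derivation.commutator_apply, sigma_sigma]
      exact map_sub sigmaHom _ _
    rw [this]
    exact (lieAlg I).lie_mem hV hW

/-- The orbit of a real manifold is real. -/
theorem isRealIdeal_orbitIdeal (hI : IsRealIdeal I) :
    IsRealIdeal (orbitIdeal (lieAlg I : Set (FormalVectorField (Fin N ⊕ Fin N)))) := by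
  intro f hf
  have hle : (orbitIdeal (lieAlg I : Set (FormalVectorField (Fin N ⊕ Fin N)))).comap sigmaHom ≤
      orbitIdeal (lieAlg I : Set (FormalVectorField (Fin N ⊕ Fin N))) := by
    refine le_orbitIdeal (fun f hf => ?_) fun V hV f hf => ?_
    · have := constantCoeff_of_mem_orbitIdeal (Ideal.mem_comap.1 hf)
      rw [sigmaHom_apply, constantCoeff_sigma] at this
      simpa using this
    · rw [Ideal.mem_comap, sigmaHom_apply, sigma_vectorField]
      exact isTangent_orbitIdeal (sigmaField_mem_lieAlg hI hV) _ hf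
  refine hle ?_
  rw [Ideal.mem_comap, sigmaHom_apply, sigma_sigma]
  exact hf

end Sigma

/-! ### Coordinates on a subspace, and the dimension of g(0). -/

section LinearAlgebra

theorem det_ne_zero_of_card_le_rank {K ι : Type*} [Field K] [Fintype ι] [DecidableEq ι]
    {A : Matrix ι ι K} (h : Fintype.card ι ≤ A.rank) : A.det ≠ 0 := by
  have := (row_linearIndependent_iff_rank A).2 (le_antisymm (Matrix.rank_le_card_height _) h)
  rw [Matrix.linearIndependent_rows_iff_isUnit, Matrix.isUnit_iff_isUnit_det] at this
  exact this.ne_zero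

theorem exists_columns_det_ne_zero {K m : Type*} [Field K] [Fintype m] {k : ℕ}
    (A : Matrix (Fin k) m K) (hA : A.rank = k) :
    ∃ c : Fin k → m, (A.submatrix id c).det ≠ 0 := by
  obtain ⟨r, c, h⟩ := exists_minor_ne_zero A hA
  refine ⟨c, det_ne_zero_of_card_le_rank ?_⟩
  exact card_le_rank_of_minor_ne_zero (A.submatrix id c) r id h

/-- Reduced row echelon form: the coordinates are the columns of a nonzero maximal minor of a basis
matrix, and the inverse minor normalizes the basis. -/
theorem exists_coordinates {K ι : Type*} [Field K] [Fintype ι] [DecidableEq ι]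
    (P : Submodule K (ι → K)) : ∃ A : Finset ι,
      (∀ v ∈ P, (∀ a ∈ A, v a = 0) → v = 0) ∧
      ∀ a ∈ A, ∃ v ∈ P, ∀ b ∈ A, v b = if a = b then 1 else 0 := by
  classical
  let b := Module.finBasis K P
  let B : Matrix (Fin (Module.finrank K P)) ι K := Matrix.of fun i => (b i : ι → K)
  have hB : LinearIndependent K B.row :=
    b.linearIndependent.map' P.subtype (Submodule.ker_subtype P)
  have hr : B.rank = Module.finrank K P := by
    rw [hB.rank_matrix, Fintype.card_fin]
  obtain ⟨c, hc⟩ := exists_columns_det_ne_zero B hr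
  have hmem : ∀ x : Fin (Module.finrank K P) → K, Matrix.vecMul x B ∈ P := by
    intro x
    have : Matrix.vecMul x B = ∑ i, x i • (b i : ι → K) := by
      ext j
      simp [Matrix.vecMul, dotProduct, B]
    rw [this]
    exact P.sum_mem fun i _ => P.smul_mem _ (b i).2
  have hval : ∀ (x : Fin (Module.finrank K P) → K) (j), Matrix.vecMul x B (c j) =
      Matrix.vecMul x (B.submatrix id c) j := fun x j => rfl
  have hinj : Function.Injective c := by
    intro i j hij
    by_contra hne
    exact hc (Matrix.det_zero_of_column_eq hne fun k => by simp [hij])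
  refine ⟨Finset.univ.image c, fun v hv h0 => ?_, fun a ha => ?_⟩
  · obtain ⟨x, rfl⟩ : ∃ x, v = Matrix.vecMul x B := by
      refine ⟨b.repr ⟨v, hv⟩, ?_⟩
      have h1 := congrArg P.subtype (b.sum_repr ⟨v, hv⟩)
      rw [map_sum] at h1
      ext j
      refine (congrFun h1 j).symm.trans ?_
      simp [Matrix.vecMul, dotProduct, B]
    have hx : x = 0 := by
      refine Matrix.eq_zero_of_vecMul_eq_zero hc ?_
      ext1 j
      rw [← hval]
      exact h0 _ (Finset.mem_image_of_mem _ (Finset.mem_univ _))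
    rw [hx, Matrix.zero_vecMul]
  · obtain ⟨i, -, rfl⟩ := Finset.mem_image.1 ha
    refine ⟨_, hmem (Matrix.vecMul (Pi.single i 1) (B.submatrix id c)⁻¹), fun b' hb' => ?_⟩
    obtain ⟨j, -, rfl⟩ := Finset.mem_image.1 hb'
    rw [hval, Matrix.vecMul_vecMul, Matrix.nonsing_inv_mul _ hc.isUnit, Matrix.vecMul_one,
      Pi.single_apply]
    simp only [hinj.eq_iff, eq_comm]

end LinearAlgebra

/-- Restriction to the coordinates from `I` is injective on `g(0)` by the last axiom of the frame,
and surjective by duality. -/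
theorem AdaptedFrame.finrank_map_evalZero {σ : Type} [Fintype σ]
    {g : LieSubalgebra ℂ (FormalVectorField σ)} {I : Finset σ} (A : AdaptedFrame g I) :
    Module.finrank ℂ (g.toSubmodule.map evalZero) = I.card := by
  classical
  let L : (g.toSubmodule.map evalZero) →ₗ[ℂ] (I → ℂ) :=
    (LinearMap.funLeft ℂ ℂ (fun i : I => i.1)) ∘ₗ (g.toSubmodule.map evalZero).subtype
  have hL : ∀ v i, L v i = v.1 i.1 := fun v i => rfl
  have hbij : Function.Bijective L := by
    refine ⟨?_, fun y => ?_⟩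
    · rw [← LinearMap.ker_eq_bot, LinearMap.ker_eq_bot']
      rintro ⟨v, V, hV, rfl⟩ h
      ext i
      exact A.injective V hV (fun i hi => congrFun h ⟨i, hi⟩) i
    · let V : FormalVectorField σ := ∑ i : I, y i • A.frame i.1
      refine ⟨⟨evalZero V, V, g.toSubmodule.sum_mem fun i _ =>
        g.toSubmodule.smul_mem _ (A.frame_mem _), rfl⟩, ?_⟩
      ext j
      rw [hL]
      change constantCoeff (V (X j.1)) = _
      rw [sum_vectorField_apply, map_sum, Finset.sum_eq_single j]
      · rw [Derivation.smul_apply, A.frame_self j.1 j.2]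
        simp
      · intro i _ hij
        rw [Derivation.smul_apply, A.frame_of_ne i.1 j.1 j.2 (fun h => hij (Subtype.ext h))]
        simp
      · simp
  rw [LinearEquiv.finrank_eq (LinearEquiv.ofBijective L hbij), Module.finrank_fintype_fun_eq_card,
    Fintype.card_coe]

theorem isTangent_span {σ ι : Type} {V : FormalVectorField σ} {ρ : ι → FPS σ}
    (h : ∀ i, V (ρ i) ∈ Ideal.span (Set.range ρ)) : IsTangent V (Ideal.span (Set.range ρ)) := by
  intro f hf
  refine Submodule.span_induction ?_ ?_ ?_ ?_ hf
  · rintro _ ⟨i, rfl⟩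
    exact h i
  · rw [map_zero]; exact Ideal.zero_mem _
  · intro x y _ _ hx hy
    rw [map_add]; exact Ideal.add_mem _ hx hy
  · intro a x hx' hx
    rw [smul_eq_mul, Derivation.leibniz, smul_eq_mul, smul_eq_mul]
    exact Ideal.add_mem _ (Ideal.mul_mem_left _ _ hx) (Ideal.mul_mem_right _ _ hx')

/-! ### An adapted frame for a generic manifold. -/

section Generic

variable {N n d : ℕ} {M : Ideal (FPS₂ N)} {ρ : Fin d → FPS₂ N}

theorem IsGeneric.isFormalMapping (hM : IsGeneric M d) (hρ : Ideal.span (Set.range ρ) = M) :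
    IsFormalMapping ρ :=
  fun i => hM.1.constantCoeff_eq_zero (hρ ▸ Ideal.subset_span ⟨i, rfl⟩)

theorem IsGeneric.rank_jacobianZZero (hM : IsGeneric M d) (hρ : Ideal.span (Set.range ρ) = M) :
    ((jacobianZero ρ).submatrix id Sum.inl).rank = d := by
  obtain ⟨ρ₀, hρ₀, hr⟩ := hM.2.2
  have h1 : ∀ i, ∃ c : Fin d → FPS₂ N, ∑ j, c j * ρ j = ρ₀ i := fun i =>
    Ideal.mem_span_range_iff_exists_fun.1 (by rw [hρ, ← hρ₀]; exact Ideal.subset_span ⟨i, rfl⟩)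
  choose a ha using h1
  have hA := jacobianZero_of_eq_sum (hM.isFormalMapping hρ) (Matrix.of a) fun i => (ha i).symm
  have h2 : jacobianZZero ρ₀ = (Matrix.of a).map constantCoeff *
      (jacobianZero ρ).submatrix id Sum.inl := by
    change (jacobianZero ρ₀).submatrix id Sum.inl = _
    rw [hA]; rfl
  refine le_antisymm (Matrix.rank_le_height _) ?_
  conv_lhs => rw [← hr, h2]
  exact Matrix.rank_mul_le_right _ _

/-- By reality `ρ` is a combination of `σ(ρ)`, whose `Z`-derivatives at the origin are the
conjugates of the `ζ`-derivatives of `ρ`. -/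
theorem IsGeneric.rank_jacobian_conj (hM : IsGeneric M d) (hρ : Ideal.span (Set.range ρ) = M) :
    ((jacobianZero ρ).submatrix id Sum.inr).rank = d := by
  have hf := hM.isFormalMapping hρ
  have h1 : ∀ i, ∃ c : Fin d → FPS₂ N, ∑ j, c j * ρ j = sigma (ρ i) := fun i =>
    Ideal.mem_span_range_iff_exists_fun.1 (by
      rw [hρ]; exact hM.2.1 _ (hρ ▸ Ideal.subset_span ⟨i, rfl⟩))
  choose a ha using h1
  have hσ : IsFormalMapping fun i => sigma (ρ i) := fun i => by
    rw [constantCoeff_sigma, hf i, map_zero]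
  have hA := jacobianZero_of_eq_sum (f := ρ) hσ (Matrix.of fun i j => sigma (a i j)) fun i => by
    rw [← sigma_sigma (ρ i), ← ha i, ← sigmaHom_apply, map_sum]
    simp only [map_mul]
    rfl
  have h2 : (jacobianZero fun i => sigma (ρ i)).submatrix id Sum.inl =
      ((jacobianZero ρ).submatrix id Sum.inr).map (starRingEnd ℂ) := by
    ext i k
    simp only [Matrix.submatrix_apply, Matrix.map_apply, jacobianZero_apply, id, pderiv_sigma,
      constantCoeff_sigma, Sum.swap_inl]
  refine le_antisymm (Matrix.rank_le_height _) ?_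
  have h3 := rank_map_le_of_ker_le (RingHom.id ℂ) (starRingEnd ℂ) (by simp)
    ((jacobianZero ρ).submatrix id Sum.inr)
  rw [← h2] at h3
  refine le_trans ?_ (h3.trans (le_of_eq (congrArg Matrix.rank (Matrix.map_id _))))
  conv_lhs => rw [← hM.rank_jacobianZZero hρ, hA]
  exact Matrix.rank_mul_le_right ((Matrix.of fun i j => sigma (a i j)).map constantCoeff) _

/-- The `(0,1)`-vector fields on a generic manifold obtained by solving the defining equations for
the coordinates `ζ_{c_1}, …, ζ_{c_d}`. -/
theorem exists_zeroOne_fields (hρ : Ideal.span (Set.range ρ) = M) {c : Fin d → Fin N}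
    (hc : ((jacobianZero ρ).submatrix id (Sum.inr ∘ c)).det ≠ 0) (b : Fin N) :
    ∃ w : Fin d → FPS₂ N, elimField (Sum.inr ∘ c) w (Sum.inr b) ∈ lieAlg M ∧
      IsZeroOne (elimField (Sum.inr ∘ c) w (Sum.inr b)) := by
  obtain ⟨w, hw⟩ := exists_elimField hc (Sum.inr b)
  have h01 : IsZeroOne (elimField (Sum.inr ∘ c) w (Sum.inr b)) :=
    (isZeroOne_iff _).2 fun k => elimField_X_of_ne _ (by simp) (by simp)
  refine ⟨w, LieSubalgebra.subset_lieSpan ⟨Or.inr h01, ?_⟩, h01⟩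
  subst hρ
  exact isTangent_span fun i => by rw [hw i]; exact Ideal.zero_mem _

theorem isTangent_lieAlg {V : FormalVectorField (Fin N ⊕ Fin N)} (hV : V ∈ lieAlg M) :
    IsTangent V M :=
  isTangent_of_mem_lieAlg (fun _ _ h => h) hV

theorem card_compl_range {c : Fin d → Fin N} (hn : n + d = N) (hc : Function.Injective c) :
    (Finset.univ.image c)ᶜ.card = n := by
  rw [Finset.card_compl, Finset.card_image_of_injective _ hc]
  simp
  omega

/-- The `ζ`-half of the frame solves `ρ = 0` for `d` of the `ζ`'s; the `Z`-half comes from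
coordinates on the `Z`-projection of `g(0)`. That the `ζ`-half has type (0,1) is what later frees
the equations of the orbit from `ζ`. -/
theorem exists_adaptedFrame (hn : n + d = N) (hM : IsGeneric M d)
    (hρ : Ideal.span (Set.range ρ) = M) :
    ∃ (A B : Finset (Fin N)) (F : AdaptedFrame (lieAlg M) (A.disjSum B)), B.card = n ∧
      ∀ b, IsZeroOne (F.frame (Sum.inr b)) := by
  classical
  have hf := hM.isFormalMapping hρ
  obtain ⟨c, hc⟩ := exists_columns_det_ne_zero _ (hM.rank_jacobian_conj hρ)
  rw [Matrix.submatrix_submatrix, Function.id_comp] at hc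
  have hcinj : Function.Injective c := fun i j h =>
    injective_of_minor_ne_zero hc (by simp [h])
  choose w hwL hw01 using exists_zeroOne_fields hρ hc
  set Y : Fin N → FormalVectorField (Fin N ⊕ Fin N) :=
    fun b => elimField (Sum.inr ∘ c) (w b) (Sum.inr b) with hY
  set B : Finset (Fin N) := (Finset.univ.image c)ᶜ with hB
  have hBr : ∀ b ∈ B, (Sum.inr b : Fin N ⊕ Fin N) ∉ Set.range (Sum.inr ∘ c) := by
    intro b hb
    simpa [hB] using hb
  have hYZ : ∀ b k, Y b (X (Sum.inl k)) = 0 := fun b => (isZeroOne_iff _).1 (hw01 b)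
  have hYs : ∀ b ∈ B, Y b (X (Sum.inr b)) = 1 := fun b hb => elimField_X_self _ (hBr b hb)
  have hYn : ∀ b, ∀ b' ∈ B, b ≠ b' → Y b (X (Sum.inr b')) = 0 := fun b b' hb' h =>
    elimField_X_of_ne _ (hBr b' hb') (by simpa using h)
  obtain ⟨A, hA1, hA2⟩ := exists_coordinates
    (((lieAlg M).toSubmodule.map evalZero).map
      (LinearMap.funLeft ℂ ℂ (Sum.inl : Fin N → Fin N ⊕ Fin N)))
  have hW : ∀ a : A, ∃ V ∈ lieAlg M, ∀ b ∈ A,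
      constantCoeff (V (X (Sum.inl b))) = if a.1 = b then 1 else 0 := by
    intro a
    obtain ⟨_, ⟨_, ⟨V, hV, rfl⟩, rfl⟩, hv⟩ := hA2 a.1 a.2
    exact ⟨V, hV, hv⟩
  choose W hWL hW using hW
  -- The fields `W` are dual to the coordinates at the origin only; inverting their matrix of values
  -- makes them dual identically.
  let m : Matrix A A (FPS₂ N) := Matrix.of fun a b => W a (X (Sum.inl b.1))
  have hm : m.map constantCoeff = 1 := by
    ext a b
    rw [Matrix.map_apply, Matrix.one_apply]
    exact (hW a b.1 b.2).trans (if_congr Subtype.ext_iff.symm rfl rfl)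
  have hmu : IsUnit m.det := isUnit_det_of_map (by rw [hm]; simp)
  let X₁ : A → FormalVectorField (Fin N ⊕ Fin N) := fun a => ∑ b, m⁻¹ a b • W b
  have hX₁L : ∀ a, X₁ a ∈ lieAlg M := fun a =>
    (lieAlg M).toSubmodule.sum_mem fun b _ => smul_mem_lieAlg (hWL b) _
  have hX₁ : ∀ a b : A, X₁ a (X (Sum.inl b.1)) = if a = b then 1 else 0 := by
    intro a b
    rw [← Matrix.one_apply, ← Matrix.nonsing_inv_mul m hmu, sum_vectorField_apply,
      Matrix.mul_apply]
    rfl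
  -- This correction removes the values on `ζ_b`, `b ∈ B`, and keeps those on `Z`, which `Y b`
  -- kills.
  let X₂ : A → FormalVectorField (Fin N ⊕ Fin N) := fun a =>
    X₁ a - ∑ b ∈ B, X₁ a (X (Sum.inr b)) • Y b
  have hX₂ : ∀ a f, X₂ a f = X₁ a f - ∑ b ∈ B, X₁ a (X (Sum.inr b)) * Y b f := by
    intro a f
    exact congrArg (X₁ a f - ·) (sum_vectorField_apply _ _ _)
  refine ⟨A, B, ?_, card_compl_range hn hcinj, ?_⟩
  · refine
      { smul_mem := fun a V hV => smul_mem_lieAlg hV a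
        frame := Sum.elim (fun a => if h : a ∈ A then X₂ ⟨a, h⟩ else 0)
          (fun b => if b ∈ B then Y b else 0)
        frame_mem := ?_
        frame_eq_zero := ?_
        frame_self := ?_
        frame_of_ne := ?_
        injective := ?_ }
    · rintro (a | b)
      · rw [Sum.elim_inl]
        split_ifs with h
        · exact (lieAlg M).sub_mem (hX₁L _)
            ((lieAlg M).toSubmodule.sum_mem fun b _ => smul_mem_lieAlg (hwL b) _)
        · exact (lieAlg M).zero_mem
      · rw [Sum.elim_inr]
        split_ifs with h
        · exact hwL b
        · exact (lieAlg M).zero_mem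
    · rintro (a | b) h
      · rw [Sum.elim_inl, dif_neg (by simpa using h)]
      · rw [Sum.elim_inr, if_neg (by simpa using h)]
    · rintro (a | b) h
      · rw [Finset.inl_mem_disjSum] at h
        rw [Sum.elim_inl, dif_pos h, hX₂, hX₁ ⟨a, h⟩ ⟨a, h⟩, if_pos rfl, Finset.sum_eq_zero, sub_zero]
        intro b _
        rw [hYZ, mul_zero]
      · rw [Finset.inr_mem_disjSum] at h
        rw [Sum.elim_inr, if_pos h, hYs b h]
    · rintro (a | b) (a' | b') h hne
      · rw [Finset.inl_mem_disjSum] at h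
        rw [Sum.elim_inl]
        split_ifs with ha
        · rw [hX₂, hX₁ ⟨a, ha⟩ ⟨a', h⟩, if_neg (by simpa using hne), Finset.sum_eq_zero, sub_zero]
          intro b _
          rw [hYZ, mul_zero]
        · rfl
      · rw [Finset.inr_mem_disjSum] at h
        rw [Sum.elim_inl]
        split_ifs with ha
        · rw [hX₂, Finset.sum_eq_single b', hYs b' h, mul_one, sub_self]
          · intro b _ hb
            rw [hYn b b' h hb, mul_zero]
          · exact fun h' => absurd h h'
        · rfl
      · rw [Sum.elim_inr]
        split_ifs
        · exact hYZ _ _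
        · rfl
      · rw [Finset.inr_mem_disjSum] at h
        rw [Sum.elim_inr]
        split_ifs
        · exact hYn _ _ h (by simpa using hne)
        · rfl
    · intro V hV h0
      -- The choice of `A` makes the `Z`-value vanish; tangency to `M` and the minor `hc` then
      -- determine the `ζ`-value.
      have hZ := hA1 (LinearMap.funLeft ℂ ℂ Sum.inl (evalZero V)) ⟨_, ⟨V, hV, rfl⟩, rfl⟩
        fun a ha => h0 (Sum.inl a) (by simpa using ha)
      refine constantCoeff_vectorField_eq_zero hc (fun i => ?_) ?_
      · exact hM.1.constantCoeff_eq_zero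
          (isTangent_lieAlg hV _ (hρ ▸ Ideal.subset_span ⟨i, rfl⟩))
      · rintro (k | k) hk
        · exact congrFun hZ k
        · refine h0 _ ?_
          rw [Finset.inr_mem_disjSum]
          simpa [hB] using hk
  · intro b
    change IsZeroOne (if b ∈ B then Y b else 0)
    split_ifs
    · exact hw01 b
    · exact (isZeroOne_iff _).2 fun k => rfl

end Generic

/-! ### The CR orbit and its equations. -/

variable {N n d : ℕ} {M : Ideal (FPS₂ N)} {ρ : Fin d → FPS₂ N}

/-- The ideal of the orbit through the origin of the Lie algebra of a formal manifold. -/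
def crOrbit (M : Ideal (FPS₂ N)) : Ideal (FPS₂ N) :=
  orbitIdeal (lieAlg M : Set (FormalVectorField (Fin N ⊕ Fin N)))

section Join

variable {ι : Type}

/-- The series `f_k(Z)` followed by the series `ρ_j(Z, ζ)`. -/
def joinTuple (f : ι → FPS (Fin N)) (ρ : Fin d → FPS₂ N) : ι ⊕ Fin d → FPS₂ N :=
  Sum.elim (fun k => rename Sum.inl (f k)) ρ

theorem joinIdeal_eq_span {e : ℕ} (f : Fin e → FPS (Fin N)) (ρ : Fin d → FPS₂ N) :
    joinIdeal f ρ = Ideal.span (Set.range (joinTuple f ρ)) := by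
  rw [joinIdeal, joinTuple, Set.Sum.elim_range]

theorem constantCoeff_pderiv_rename_inl (f : FPS (Fin N)) (k : Fin N) :
    constantCoeff (pderiv ℂ (Sum.inl k) (rename Sum.inl f : FPS₂ N)) =
      constantCoeff (pderiv ℂ k f) := by
  have := pderiv_rename (Function.Embedding.inl : Fin N ↪ Fin N ⊕ Fin N) k f
  rw [← constantCoeff_rename (R := ℂ) (f := (Sum.inl : Fin N → Fin N ⊕ Fin N))]
  exact congrArg constantCoeff this

theorem joinTuple_row_inl [Fintype ι] (f : ι → FPS (Fin N)) (a : ι ⊕ Fin d → ℂ) (k : Fin N) :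
    (∑ i, a i • (jacobianZero (joinTuple f ρ)).row i) (Sum.inl k) =
      (∑ i, a (Sum.inl i) • (jacobianZero f).row i) k +
      (∑ j, a (Sum.inr j) • (jacobianZero ρ).row j) (Sum.inl k) := by
  simp only [Finset.sum_apply, Pi.smul_apply, Fintype.sum_sum_type, Matrix.row_apply,
    jacobianZero_apply, joinTuple, Sum.elim_inl, Sum.elim_inr, constantCoeff_pderiv_rename_inl]

theorem joinTuple_row_inr [Fintype ι] (f : ι → FPS (Fin N)) (a : ι ⊕ Fin d → ℂ) (k : Fin N) :
    (∑ i, a i • (jacobianZero (joinTuple f ρ)).row i) (Sum.inr k) =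
      (∑ j, a (Sum.inr j) • (jacobianZero ρ).row j) (Sum.inr k) := by
  simp only [Finset.sum_apply, Pi.smul_apply, Fintype.sum_sum_type, Matrix.row_apply,
    jacobianZero_apply, joinTuple, Sum.elim_inl, Sum.elim_inr]
  rw [Finset.sum_eq_zero, zero_add]
  intro i _
  rw [pderiv_rename_of_notMem Sum.inl (by simp), map_zero, smul_zero]

theorem linearIndependent_joinTuple [Fintype ι] {f : ι → FPS (Fin N)}
    (hf : LinearIndependent ℂ (jacobianZero f).row)
    (hρ : ((jacobianZero ρ).submatrix id Sum.inr).rank = d) :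
    LinearIndependent ℂ (jacobianZero (joinTuple f ρ)).row := by
  rw [Fintype.linearIndependent_iff] at hf ⊢
  intro a ha
  have hρ' : LinearIndependent ℂ ((jacobianZero ρ).submatrix id Sum.inr).row :=
    (row_linearIndependent_iff_rank _).2 (by rw [hρ, Fintype.card_fin])
  rw [Fintype.linearIndependent_iff] at hρ'
  have h1 : ∀ j, a (Sum.inr j) = 0 := hρ' _ (by
    ext1 k
    have := joinTuple_row_inr (ρ := ρ) f a k
    rw [ha] at this
    rw [Finset.sum_apply] at this ⊢
    exact this.symm)
  have h2 : ∀ i, a (Sum.inl i) = 0 := hf _ (by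
    ext1 k
    have := joinTuple_row_inl (ρ := ρ) f a k
    rw [ha] at this
    simpa [h1] using this.symm)
  rintro (i | j)
  exacts [h2 i, h1 j]

theorem linearIndependent_of_joinTuple [Fintype ι] {f : ι → FPS (Fin N)}
    (h : LinearIndependent ℂ (jacobianZero (joinTuple f ρ)).row) :
    LinearIndependent ℂ (jacobianZero f).row := by
  rw [Fintype.linearIndependent_iff] at h ⊢
  intro a ha i
  refine h (Sum.elim a 0) ?_ (Sum.inl i)
  ext1 s
  rcases s with k | k
  · rw [joinTuple_row_inl]
    simp only [Sum.elim_inl, Sum.elim_inr, ha]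
    simp
  · rw [joinTuple_row_inr]
    simp

end Join

theorem le_crOrbit (hM : IsGeneric M d) : M ≤ crOrbit M :=
  le_orbitIdeal (fun _ hf => hM.1.constantCoeff_eq_zero hf) fun _ hV => isTangent_lieAlg hV

theorem isTangent_crOrbit {V : FormalVectorField (Fin N ⊕ Fin N)} (hV : V ∈ lieAlg M) :
    IsTangent V (crOrbit M) := isTangent_orbitIdeal hV

theorem isRealIdeal_crOrbit (hM : IsGeneric M d) : IsRealIdeal (crOrbit M) :=
  isRealIdeal_orbitIdeal hM.2.1

theorem constantCoeff_of_mem_crOrbit {f : FPS₂ N} (hf : f ∈ crOrbit M) : constantCoeff f = 0 :=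
  constantCoeff_of_mem_orbitIdeal hf

/-- The rank of `∂g/∂Z` for generators `g` of the orbit, at every point of the orbit. -/
theorem rank_jacobianZ_crOrbit {K : Type*} [Field K] (hn : n + d = N) (hM : IsGeneric M d)
    (φ : FPS₂ N →+* K) (hφ : ∀ f ∈ crOrbit M, φ f = 0) {c : ℕ} {g : Fin c → FPS₂ N}
    (hg : Ideal.span (Set.range g) = crOrbit M) : ((jacobianZ g).map φ).rank = d := by
  classical
  obtain ⟨ρ, -, hρ, -⟩ := hM.1
  have hgφ : ∀ i, φ (g i) = 0 := fun i => hφ _ (hg ▸ Ideal.subset_span ⟨i, rfl⟩)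
  refine le_antisymm ?_ ?_
  -- Upper bound: conjugating the (0,1)-half of the frame gives `n` (1,0)-fields tangent to the
  -- orbit, whose independent values are annihilated by the matrix.
  · obtain ⟨A, B, F, hB, hF⟩ := exists_adaptedFrame hn hM hρ
    let L : B → FormalVectorField (Fin N ⊕ Fin N) := fun b => sigmaField (F.frame (Sum.inr b.1))
    have hL : ∀ b, L b ∈ lieAlg M := fun b => sigmaField_mem_lieAlg hM.2.1 (F.frame_mem _)
    have hL10 : ∀ b k, L b (X (Sum.inr k)) = 0 := fun b => (isOneZero_iff _).1 (hF b.1).sigmaField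
    let Lm : Matrix (Fin N) B K := Matrix.of fun k b => φ (L b (X (Sum.inl k)))
    have hLv : ∀ b b' : B, L b (X (Sum.inl b'.1)) = if b' = b then 1 else 0 := by
      intro b b'
      have hX : sigma (X (Sum.inl b'.1) : FPS₂ N) = X (Sum.inr b'.1) := by
        rw [sigma, rename_X, conjSeries_X]; rfl
      rw [sigmaField_apply, hX]
      split_ifs with h
      · subst h
        rw [F.frame_self _ (by simp)]
        exact map_one sigmaHom
      · rw [F.frame_of_ne _ _ (by simp) (fun h' => h (Subtype.ext (Sum.inr_injective h').symm))]
        exact map_zero sigmaHom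
    have hLm : Fintype.card B ≤ Lm.rank := by
      refine card_le_rank_of_minor_ne_zero Lm (Subtype.val : B → Fin N) id ?_
      have : Lm.submatrix (Subtype.val : B → Fin N) id = 1 := by
        ext b' b
        rw [Matrix.submatrix_apply, Matrix.one_apply]
        change φ (L b (X (Sum.inl b'.1))) = _
        rw [hLv]
        split_ifs <;> simp
      rw [this, Matrix.det_one]
      exact one_ne_zero
    have h0 : (jacobianZ g).map φ * Lm = 0 := by
      ext i b
      rw [Matrix.mul_apply, Matrix.zero_apply,
        ← hφ _ (isTangent_crOrbit (hL b) (g i) (hg ▸ Ideal.subset_span ⟨i, rfl⟩)),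
        vectorField_apply, Fintype.sum_sum_type]
      simp only [hL10, zero_mul, Finset.sum_const_zero, add_zero, map_sum, map_mul]
      exact Finset.sum_congr rfl fun k _ => mul_comm _ _
    have := Matrix.rank_add_rank_le_card_of_mul_eq_zero h0
    rw [Fintype.card_coe, hB] at hLm
    rw [Fintype.card_fin] at this
    omega
  -- Lower bound: `ρ` is a combination of `g`, and the derivatives of the coefficients drop out
  -- because `φ` kills `g`.
  · have h1 : ∀ i, ∃ a : Fin c → FPS₂ N, ∑ j, a j * g j = ρ i := fun i =>
      Ideal.mem_span_range_iff_exists_fun.1 (by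
        rw [hg]; exact le_crOrbit hM (hρ ▸ Ideal.subset_span ⟨i, rfl⟩))
    choose a ha using h1
    have hρg : (jacobianZ ρ).map φ = (Matrix.of a).map φ * (jacobianZ g).map φ := by
      ext i k
      rw [Matrix.map_apply, Matrix.mul_apply]
      change φ (pderiv ℂ (Sum.inl k) (ρ i)) = ∑ j, φ (a i j) * φ (pderiv ℂ (Sum.inl k) (g j))
      rw [← ha i, map_sum, map_sum]
      refine Finset.sum_congr rfl fun j _ => ?_
      rw [Derivation.leibniz, map_add, smul_eq_mul, smul_eq_mul, map_mul, map_mul, hgφ j, zero_mul,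
        add_zero]
    obtain ⟨k, hk⟩ := exists_columns_det_ne_zero _ (hM.rank_jacobianZZero hρ)
    have hu : IsUnit ((jacobianZ ρ).submatrix id k).det := isUnit_det_of_map hk
    have h2 : Fintype.card (Fin d) ≤ ((jacobianZ ρ).map φ).rank := by
      refine card_le_rank_of_minor_ne_zero _ id k ?_
      have := (hu.map φ).ne_zero
      rw [RingHom.map_det] at this
      exact this
    rw [Fintype.card_fin, hρg] at h2
    exact h2.trans (Matrix.rank_mul_le_right _ _)

theorem isPrime_crOrbit (hn : n + d = N) (hM : IsGeneric M d) : (crOrbit M).IsPrime := by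
  obtain ⟨ρ, -, hρ, -⟩ := hM.1
  obtain ⟨A, B, F, -, -⟩ := exists_adaptedFrame hn hM hρ
  exact F.isPrime_orbitIdeal

theorem isManifoldIdeal_crOrbit (hn : n + d = N) (hM : IsGeneric M d) :
    IsManifoldIdeal (crOrbit M) (2 * N - dimLieAlgZero M) := by
  obtain ⟨ρ, -, hρ, -⟩ := hM.1
  obtain ⟨A, B, F, -, -⟩ := exists_adaptedFrame hn hM hρ
  have := F.isManifoldIdeal_orbitIdeal
  rwa [← F.finrank_map_evalZero, Fintype.card_sum, Fintype.card_fin, ← two_mul] at this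

theorem dimLieAlgZero_le (hn : n + d = N) (hM : IsGeneric M d) :
    n ≤ dimLieAlgZero M ∧ dimLieAlgZero M + d ≤ 2 * N := by
  obtain ⟨ρ, -, hρ, -⟩ := hM.1
  obtain ⟨A, B, F, hB, -⟩ := exists_adaptedFrame hn hM hρ
  have h1 := F.finrank_map_evalZero
  have h2 : A.card ≤ N := by simpa using Finset.card_le_univ A
  rw [Finset.card_disjSum, hB] at h1
  change dimLieAlgZero M = _ at h1
  omega

theorem isCR_crOrbit (hn : n + d = N) (hM : IsGeneric M d) : IsCR (crOrbit M) := by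
  have hm := isManifoldIdeal_crOrbit hn hM
  have hprime := isPrime_crOrbit hn hM
  obtain ⟨g, -, hg, -⟩ := id hm
  refine ⟨isRealIdeal_crOrbit hM, _, g, hm, hg, ?_⟩
  have h1 := rank_jacobianZ_crOrbit hn hM ((algebraMap (FPS₂ N ⧸ crOrbit M)
    (FractionRing (FPS₂ N ⧸ crOrbit M))).comp (Ideal.Quotient.mk (crOrbit M)))
    (fun f hf => by
      rw [RingHom.comp_apply, Ideal.Quotient.eq_zero_iff_mem.2 hf, map_zero]) hg
  have h2 := rank_jacobianZ_crOrbit hn hM constantCoeff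
    (fun f hf => constantCoeff_of_mem_crOrbit hf) hg
  exact h1.trans h2.symm

theorem isCROrbit_crOrbit (hn : n + d = N) (hM : IsGeneric M d) : IsCROrbit M (crOrbit M) := by
  have hle := (dimLieAlgZero_le hn hM).2
  refine ⟨isCR_crOrbit hn hM, le_crOrbit hM, ⟨_, isManifoldIdeal_crOrbit hn hM, ?_⟩,
    fun V h01 hV => isTangent_crOrbit (LieSubalgebra.subset_lieSpan ⟨Or.inr h01, hV⟩)⟩
  rw [Fintype.card_sum, Fintype.card_fin]
  omega

/-- Conjugation by σ and reality of `O` turn tangency of the (0,1)-fields into tangency of the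
(1,0)-fields, hence of `lieAlg M`; maximality of the orbit ideal and the dimension do the rest. -/
theorem IsCROrbit.eq_crOrbit (hn : n + d = N) (hM : IsGeneric M d) {O : Ideal (FPS₂ N)}
    (hO : IsCROrbit M O) : O = crOrbit M := by
  obtain ⟨⟨hreal, -⟩, -, ⟨c, hc, hdim⟩, htan⟩ := hO
  have hle := (dimLieAlgZero_le hn hM).2
  rw [Fintype.card_sum, Fintype.card_fin] at hdim
  obtain rfl : c = 2 * N - dimLieAlgZero M := by omega
  refine hc.eq_of_le (isManifoldIdeal_crOrbit hn hM) ?_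
  refine le_orbitIdeal (fun f hf => hc.constantCoeff_eq_zero hf) fun V hV =>
    isTangent_of_mem_lieAlg (fun V h hV => ?_) hV
  rcases h with h | h
  · have := (htan _ h.sigmaField (hV.sigmaField hM.2.1)).sigmaField hreal
    rwa [sigmaField_sigmaField] at this
  · exact htan V h hV

theorem exists_joinIdeal_eq_crOrbit (hn : n + d = N) (hM : IsGeneric M d)
    (hρ : Ideal.span (Set.range ρ) = M) {e : ℕ} (he : e + d + dimLieAlgZero M = 2 * N) :
    ∃ f : Fin e → FPS (Fin N), joinIdeal f ρ = crOrbit M := by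
  classical
  obtain ⟨A, B, F, hB, hF⟩ := exists_adaptedFrame hn hM hρ
  have hdim := F.finrank_map_evalZero
  rw [Finset.card_disjSum, hB] at hdim
  change dimLieAlgZero M = _ at hdim
  -- The `ζ`-derivatives of this component are expansions of (0,1)-frame fields applied to `Z_l`,
  -- which are zero.
  have hφ : ∀ l, ∃ φ : FPS (Fin N), F.param (Sum.inl l) = rename Sum.inl φ := fun l =>
    exists_rename_inl_of_pderiv_eq_zero _ fun b => by
      rw [AdaptedFrame.param, F.pderiv_taylor, (isZeroOne_iff _).1 (hF b) l, F.taylor_zero]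
  choose φ hφ using hφ
  have hA : Fintype.card {l // l ∉ A} = e := by
    have h2 : A.card ≤ N := by simpa using Finset.card_le_univ A
    rw [Fintype.card_subtype_compl, Fintype.card_coe, Fintype.card_fin]
    omega
  let f : {l // l ∉ A} → FPS (Fin N) := fun l => X l.1 - φ l.1
  let E : Fin e ≃ {l // l ∉ A} := (Fintype.equivFinOfCardEq hA).symm
  have hfQ : ∀ l, (rename Sum.inl (f l) : FPS₂ N) ∈ crOrbit M := by
    intro l
    have : (rename Sum.inl (f l) : FPS₂ N) = X (Sum.inl l.1) - F.param (Sum.inl l.1) := by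
      rw [hφ, ← rename_X (R := ℂ) (Sum.inl : Fin N → Fin N ⊕ Fin N), ← map_sub]
    rw [this]
    exact F.sub_taylor_mem _
  have hφ0 : ∀ (l : Fin N) (l' : {l // l ∉ A}), pderiv ℂ l'.1 (φ l) = 0 := by
    intro l l'
    refine rename_injective (R := ℂ) (Function.Embedding.inl : Fin N ↪ Fin N ⊕ Fin N) ?_
    rw [← pderiv_rename, map_zero]
    have h1 := F.pderiv_taylor_eq_zero (i := Sum.inl l'.1) (by simpa using l'.2) (X (Sum.inl l))
    change pderiv ℂ (Sum.inl l'.1) (F.param (Sum.inl l)) = 0 at h1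
    rw [hφ] at h1
    exact h1
  have hfli : LinearIndependent ℂ (jacobianZero f).row := by
    rw [Fintype.linearIndependent_iff]
    intro a ha l
    have h1 := congrFun ha l.1
    rw [Finset.sum_apply, Finset.sum_eq_single l] at h1
    · simpa [jacobianZero_apply, f, hφ0, pderiv_X_self] using h1
    · intro b _ hb
      have hb' : b.1 ≠ l.1 := fun h => hb (Subtype.ext h)
      simp [jacobianZero_apply, f, hφ0, pderiv_X_of_ne hb']
    · simp
  refine ⟨f ∘ E, ?_⟩
  have hle : joinIdeal (f ∘ E) ρ ≤ crOrbit M := by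
    rw [joinIdeal, Ideal.span_le]
    rintro _ (⟨k, rfl⟩ | ⟨j, rfl⟩)
    · exact hfQ _
    · exact le_crOrbit hM (hρ ▸ Ideal.subset_span ⟨j, rfl⟩)
  refine IsManifoldIdeal.eq_of_le (c := e + d) ?_ ?_ hle
  · rw [joinIdeal_eq_span] at hle ⊢
    have := isManifoldIdeal_span
      (fun i => constantCoeff_of_mem_crOrbit (hle (Ideal.subset_span ⟨i, rfl⟩)))
      (linearIndependent_joinTuple ((linearIndependent_jacobianZero_comp f E).2 hfli)
        (hM.rank_jacobian_conj hρ))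
    rwa [Fintype.card_sum, Fintype.card_fin, Fintype.card_fin] at this
  · have := isManifoldIdeal_crOrbit hn hM
    rwa [show 2 * N - dimLieAlgZero M = e + d by omega] at this

theorem isManifoldIdeal_of_joinIdeal (hn : n + d = N) (hM : IsGeneric M d)
    {e : ℕ} (he : e + d + dimLieAlgZero M = 2 * N)
    {f : Fin e → FPS (Fin N)} (hf : joinIdeal f ρ = crOrbit M) :
    IsFormalMapping f ∧ LinearIndependent ℂ (jacobianZero f).row := by
  have hm := isManifoldIdeal_crOrbit hn hM
  rw [joinIdeal_eq_span] at hf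
  obtain ⟨h1, h2⟩ := hm.linearIndependent (ι := Fin e ⊕ Fin d)
    (by rw [Fintype.card_sum, Fintype.card_fin, Fintype.card_fin]; omega) hf
  refine ⟨fun k => ?_, linearIndependent_of_joinTuple h2⟩
  have := h1 (Sum.inl k)
  rwa [joinTuple, Sum.elim_inl, constantCoeff_rename] at this

/-! ### Vector fields that lift through a formal mapping. -/

section Liftable

variable {σ τ : Type} [Fintype σ]

/-- The vector fields `V` that are, up to a nonzero factor, `D`-related to a vector field on the
source of the formal mapping `D`. -/
def liftableAlg (D : σ → FPS τ) (hD : IsFormalMapping D) :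
    LieSubalgebra ℂ (FormalVectorField σ) where
  carrier := {V | ∃ q : FPS τ, q ≠ 0 ∧ ∃ A : FormalVectorField τ,
    ∀ h, q * subst D (V h) = A (subst D h)}
  zero_mem' := ⟨1, one_ne_zero, 0, fun h => by
    rw [Derivation.zero_apply, Derivation.zero_apply, subst_formal_zero hD, mul_zero]⟩
  add_mem' := by
    rintro V W ⟨q, hq, A, hA⟩ ⟨p, hp, B, hB⟩
    refine ⟨q * p, mul_ne_zero hq hp, p • A + q • B, fun h => ?_⟩
    rw [Derivation.add_apply, subst_add (hasSubst D hD), Derivation.add_apply,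
      Derivation.smul_apply, Derivation.smul_apply, ← hA, ← hB, smul_eq_mul, smul_eq_mul]
    ring
  smul_mem' := by
    rintro c V ⟨q, hq, A, hA⟩
    refine ⟨q, hq, c • A, fun h => ?_⟩
    rw [Derivation.smul_apply, subst_smul (hasSubst D hD), Derivation.smul_apply, ← hA,
      mul_smul_comm]
  lie_mem' := by
    rintro V W ⟨q, hq, A, hA⟩ ⟨p, hp, B, hB⟩
    -- `V` and `W` correspond to `A / q` and `B / p`; the witness is `p² q² [A / q, B / p]` with the
    -- denominators cleared.
    refine ⟨p ^ 2 * q ^ 2, mul_ne_zero (pow_ne_zero _ hp) (pow_ne_zero _ hq),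
      (p * q) • ⁅A, B⁆ - (q * A p) • B + (p * B q) • A, fun h => ?_⟩
    have h1 : q * subst D (V (W h)) = A (subst D (W h)) := hA (W h)
    have h2 : p * subst D (W (V h)) = B (subst D (V h)) := hB (V h)
    have h3 : A (p * subst D (W h)) = A (B (subst D h)) := by rw [hB h]
    have h4 : B (q * subst D (V h)) = B (A (subst D h)) := by rw [hA h]
    rw [Derivation.leibniz, smul_eq_mul, smul_eq_mul] at h3 h4
    rw [Derivation.commutator_apply, subst_sub (hasSubst D hD), Derivation.add_apply,
      Derivation.sub_apply, Derivation.smul_apply, Derivation.smul_apply, Derivation.smul_apply,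
      Derivation.commutator_apply, ← h3, ← h4, ← hA h, ← hB h, smul_eq_mul, smul_eq_mul,
      smul_eq_mul]
    linear_combination (p ^ 2 * q) * h1 - (p * q ^ 2) * h2

variable [Fintype τ]

/-- The tangent space to the image of `D` at its generic point. -/
def tangentSpan (D : σ → FPS τ) : Submodule (FractionRing (FPS τ)) (σ → FractionRing (FPS τ)) :=
  Submodule.span _ (Set.range
    ((jacobian D).map (algebraMap (FPS τ) (FractionRing (FPS τ)))).col)

/-- The value of `V` at the generic point of the image of `D`. -/
def genericValue (D : σ → FPS τ) (V : FormalVectorField σ) (i : σ) : FractionRing (FPS τ) :=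
  algebraMap _ _ (subst D (V (X i)))

omit [Fintype σ] in
theorem finrank_tangentSpan (D : σ → FPS τ) :
    Module.finrank (FractionRing (FPS τ)) (tangentSpan D) = Rk D :=
  (Matrix.rank_eq_finrank_span_cols _).symm

omit [Fintype σ] in
theorem mem_tangentSpan {D : σ → FPS τ} {u : σ → FractionRing (FPS τ)} :
    u ∈ tangentSpan D ↔ ∃ x : τ → FractionRing (FPS τ), ∀ i,
      u i = ∑ s, x s * algebraMap _ _ (pderiv ℂ s (D i)) := by
  rw [tangentSpan, Submodule.mem_span_range_iff_exists_fun]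
  refine exists_congr fun x => ⟨fun h i => ?_, fun h => ?_⟩
  · rw [← h, Finset.sum_apply]
    rfl
  · ext1 i
    rw [h, Finset.sum_apply]
    rfl

/-- Clearing a common denominator passes from generic values to lifts. It joins a condition visibly
closed under brackets to one of linear algebra. -/
theorem mem_liftableAlg {D : σ → FPS τ} (hD : IsFormalMapping D) {V : FormalVectorField σ} :
    V ∈ liftableAlg D hD ↔ genericValue D V ∈ tangentSpan D := by
  have hinj := IsFractionRing.injective (FPS τ) (FractionRing (FPS τ))
  rw [mem_tangentSpan]
  constructor
  · rintro ⟨q, hq, A, hA⟩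
    refine ⟨fun s => algebraMap _ _ (A (X s)) / algebraMap _ _ q, fun i => ?_⟩
    have hq' : algebraMap (FPS τ) (FractionRing (FPS τ)) q ≠ 0 := fun h =>
      hq (hinj (h.trans (map_zero _).symm))
    have h1 := congrArg (algebraMap (FPS τ) (FractionRing (FPS τ))) (hA (X i))
    rw [vectorField_apply A, subst_X (hasSubst D hD), map_mul, map_sum] at h1
    rw [genericValue, eq_comm]
    simp only [div_mul_eq_mul_div, ← Finset.sum_div]
    rw [div_eq_iff hq', mul_comm, h1]
    simp only [map_mul]
  · rintro ⟨x, hx⟩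
    obtain ⟨q, hq⟩ := IsLocalization.exist_integer_multiples (nonZeroDivisors (FPS τ))
      (Finset.univ : Finset τ) x
    choose a ha using fun s => hq s (Finset.mem_univ s)
    have hV : ∀ i, q.1 * subst D (V (X i)) = ∑ s, a s * pderiv ℂ s (D i) := by
      intro i
      refine hinj ?_
      rw [map_mul, map_sum]
      refine (congrArg _ (hx i)).trans ?_
      rw [Finset.mul_sum]
      refine Finset.sum_congr rfl fun s _ => ?_
      rw [map_mul, ha s, ← mul_assoc, Algebra.smul_def]
    refine ⟨q.1, nonZeroDivisors.ne_zero q.2, ∑ s, a s • pderiv ℂ s, fun h => ?_⟩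
    rw [vectorField_apply V, subst_formal_sum hD, Finset.mul_sum, sum_vectorField_apply]
    simp only [Derivation.smul_apply, smul_eq_mul, pderiv_subst hD, subst_mul (hasSubst D hD)]
    simp only [← mul_assoc, hV, Finset.mul_sum, Finset.sum_mul]
    rw [Finset.sum_comm]
    refine Finset.sum_congr rfl fun s _ => Finset.sum_congr rfl fun i _ => by ring

/-- Duality with the coordinates survives substitution of `D`, so the frame gives independent
vectors in the generic tangent space. -/
theorem AdaptedFrame.card_le_Rk {g : LieSubalgebra ℂ (FormalVectorField σ)} {I : Finset σ}
    (F : AdaptedFrame g I) {D : σ → FPS τ} (hD : IsFormalMapping D)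
    (h : g ≤ liftableAlg D hD) : I.card ≤ Rk D := by
  classical
  rw [← finrank_tangentSpan, ← Fintype.card_coe]
  have hu : ∀ i, genericValue D (F.frame i) ∈ tangentSpan D := fun i =>
    (mem_liftableAlg hD).1 (h (F.frame_mem i))
  have hli : LinearIndependent (FractionRing (FPS τ))
      (fun i : I => (⟨_, hu i.1⟩ : tangentSpan D)) := by
    rw [Fintype.linearIndependent_iff]
    intro a ha j
    have h1 : ∑ i : I, a i * algebraMap _ (FractionRing (FPS τ))
        (subst D (F.frame i.1 (X j.1))) = 0 := by
      have h2 := congrFun (congrArg Subtype.val ha) j.1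
      rw [Submodule.coe_sum, Finset.sum_apply] at h2
      exact h2
    rw [Finset.sum_eq_single j] at h1
    · rwa [F.frame_self _ j.2, subst_formal_one hD, map_one, mul_one] at h1
    · intro i _ hij
      rw [F.frame_of_ne _ _ j.2 (fun h => hij (Subtype.ext h)), subst_formal_zero hD, map_zero,
        mul_zero]
    · simp
  exact hli.fintype_card_le_finrank

end Liftable

theorem finrank_map_add_finrank_inf_ker {K V W : Type*} [Field K] [AddCommGroup V] [Module K V]
    [AddCommGroup W] [Module K W] [FiniteDimensional K V] (p : V →ₗ[K] W) (S : Submodule K V) :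
    Module.finrank K (S.map p) + Module.finrank K (S ⊓ LinearMap.ker p : Submodule K V) =
      Module.finrank K S := by
  have h := LinearMap.finrank_range_add_finrank_ker (p.domRestrict S)
  rw [LinearMap.range_domRestrict] at h
  rw [← h, LinearMap.ker_domRestrict, ← Submodule.map_comap_subtype,
    Submodule.finrank_map_subtype_eq]

theorem finrank_add_rank_le {K α γ ι : Type*} [Field K] [Fintype α] [Fintype ι] [Finite γ]
    (R : Matrix γ ι K) {e : α → ι} (he : Function.Injective e) (T : Submodule K (ι → K))
    (hR : ∀ u ∈ T, R.mulVec u = 0) (hT : ∀ u ∈ T, ∀ i ∉ Set.range e, u i = 0) :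
    Module.finrank K T + (R.submatrix id e).rank ≤ Fintype.card α := by
  classical
  have h1 := finrank_map_add_finrank_inf_ker (LinearMap.funLeft K K e) T
  have h2 : T ⊓ LinearMap.ker (LinearMap.funLeft K K e) = ⊥ := by
    rw [eq_bot_iff]
    rintro u ⟨huT, hu⟩
    refine (Submodule.mem_bot K).2 (funext fun i => ?_)
    by_cases hi : i ∈ Set.range e
    · obtain ⟨a, rfl⟩ := hi
      exact congrFun (LinearMap.mem_ker.1 hu) a
    · exact hT u huT i hi
  have h3 : T.map (LinearMap.funLeft K K e) ≤ LinearMap.ker (R.submatrix id e).mulVecLin := by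
    rintro _ ⟨u, hu, rfl⟩
    rw [LinearMap.mem_ker]
    ext1 c
    refine Eq.trans ?_ (congrFun (hR u hu) c)
    change ∑ a, R c (e a) * u (e a) = ∑ i, R c i * u i
    rw [← Finset.sum_image (f := fun i => R c i * u i) (fun _ _ _ _ h => he h)]
    refine Finset.sum_subset (Finset.subset_univ _) fun i _ hi => ?_
    rw [hT u hu i (by simpa using hi), mul_zero]
  have h4 := LinearMap.finrank_range_add_finrank_ker (R.submatrix id e).mulVecLin
  rw [Module.finrank_fintype_fun_eq_card] at h4
  have h5 := Submodule.finrank_mono h3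
  rw [h2, finrank_bot, add_zero] at h1
  rw [Matrix.rank]
  omega

/-! ### Generic tangent spaces of the iterated Segre mappings. -/

section Segre

variable {N n d : ℕ} {M : Ideal (FPS₂ N)} {ρ : Fin d → FPS₂ N} {γ : Fin N → FPS (Fin N ⊕ Fin n)}

/-- The inclusion of the variables `t^1, …, t^j` in `t^1, …, t^{j+1}`. -/
def oldVar {n : ℕ} (j : ℕ) : Fin j × Fin n → Fin (j + 1) × Fin n := Prod.map Fin.castSucc id

theorem oldVar_injective (j : ℕ) : Function.Injective (oldVar (n := n) j) :=
  (Fin.castSucc_injective j).prodMap Function.injective_id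

theorem oldVar_ne_last (j : ℕ) (s : Fin j × Fin n) (k : Fin n) : oldVar j s ≠ (Fin.last j, k) :=
  fun h => (Fin.castSucc_lt_last s.1).ne (congrArg Prod.fst h)

theorem eq_last_or_eq_oldVar (j : ℕ) (s : Fin (j + 1) × Fin n) :
    (∃ k, s = (Fin.last j, k)) ∨ ∃ s', s = oldVar j s' := by
  obtain ⟨i, k⟩ := s
  induction i using Fin.lastCases with
  | last => exact Or.inl ⟨k, rfl⟩
  | cast i => exact Or.inr ⟨(i, k), rfl⟩

/-- The mapping `v̄^j(t^1, …, t^j)`, as a mapping of the variables `t^1, …, t^{j+1}`. -/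
def conjSegre (γ : Fin N → FPS (Fin N ⊕ Fin n)) (j : ℕ) : Fin N → FPS (Fin (j + 1) × Fin n) :=
  fun l => rename (oldVar j) (conjSeries (iterSegre γ j l))

/-- The mapping `(v̄^j(t^1, …, t^j), t^{j+1})`. -/
def segreArg (γ : Fin N → FPS (Fin N ⊕ Fin n)) (j : ℕ) :
    Fin N ⊕ Fin n → FPS (Fin (j + 1) × Fin n) :=
  Sum.elim (conjSegre γ j) fun k => X (Fin.last j, k)

/-- The mapping `(v^{j+1}, v̄^j)` into the manifold. -/
def segrePair (γ : Fin N → FPS (Fin N ⊕ Fin n)) (j : ℕ) :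
    Fin N ⊕ Fin N → FPS (Fin (j + 1) × Fin n) :=
  Sum.elim (iterSegre γ (j + 1)) (conjSegre γ j)

theorem iterSegre_succ (γ : Fin N → FPS (Fin N ⊕ Fin n)) (j : ℕ) (i : Fin N) :
    iterSegre γ (j + 1) i = subst (segreArg γ j) (γ i) := rfl

theorem IsFormalMapping.conjSegre {j : ℕ} (h : IsFormalMapping (iterSegre γ j)) :
    IsFormalMapping (conjSegre γ j) := fun l => by
  rw [FormalSegre.conjSegre, constantCoeff_rename, constantCoeff_conjSeries, h l, map_zero]

theorem isFormalMapping_iterSegre (hγ : IsFormalMapping γ) (j : ℕ) :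
    IsFormalMapping (iterSegre γ j) := by
  induction j with
  | zero => exact fun _ => map_zero _
  | succ j ih =>
    intro i
    rw [iterSegre_succ, constantCoeff_subst_formal, hγ i]
    exact ih.conjSegre.sumElim fun k => constantCoeff_X _

theorem isFormalMapping_conjSegre (hγ : IsFormalMapping γ) (j : ℕ) :
    IsFormalMapping (conjSegre γ j) := (isFormalMapping_iterSegre hγ j).conjSegre

theorem isFormalMapping_segreArg (hγ : IsFormalMapping γ) (j : ℕ) :
    IsFormalMapping (segreArg γ j) :=
  (isFormalMapping_conjSegre hγ j).sumElim fun _ => constantCoeff_X _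

theorem isFormalMapping_segrePair (hγ : IsFormalMapping γ) (j : ℕ) :
    IsFormalMapping (segrePair γ j) :=
  (isFormalMapping_iterSegre hγ (j + 1)).sumElim (isFormalMapping_conjSegre hγ j)

theorem subst_segrePair_eq_zero (hγ : IsSegreMapping ρ γ) (j : ℕ) {h : FPS₂ N}
    (hh : h ∈ Ideal.span (Set.range ρ)) : subst (segrePair γ j) h = 0 := by
  have hP := isFormalMapping_segrePair hγ.1 j
  have hA := isFormalMapping_segreArg hγ.1 j
  have hle : Ideal.span (Set.range ρ) ≤
      RingHom.ker (substAlgHom (R := ℂ) (hasSubst _ hP)) := by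
    rw [Ideal.span_le]
    rintro _ ⟨i, rfl⟩
    rw [SetLike.mem_coe, RingHom.mem_ker, substAlgHom_apply]
    have h1 := congrArg (subst (segreArg γ j)) (hγ.2.1 i)
    rw [subst_comp_subst_apply (hasSubst _ (hγ.1.sumElim fun k => constantCoeff_X _))
      (hasSubst _ hA), subst_formal_zero hA] at h1
    rw [← h1]
    congr 1
    ext1 s
    rcases s with k | k
    · rfl
    · rw [Sum.elim_inr, subst_X (hasSubst _ hA)]
      rfl
  have := hle hh
  rwa [RingHom.mem_ker, substAlgHom_apply] at this

theorem Rk_eq_rank_map {σ τ : Type} [Fintype σ] [Fintype τ] {K : Type*} [Field K]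
    (F : τ → FPS σ) (φ : FPS σ →+* K) (hφ : Function.Injective φ) :
    Rk F = ((jacobian F).map φ).rank := by
  have hinj := IsFractionRing.injective (FPS σ) (FractionRing (FPS σ))
  refine le_antisymm ?_ ?_
  · exact rank_map_le_of_ker_le _ _ (fun x hx => by
      rw [hφ (hx.trans (map_zero φ).symm), map_zero]) _
  · exact rank_map_le_of_ker_le _ _ (fun x hx => by
      rw [hinj (hx.trans (map_zero _).symm), map_zero]) _

theorem pderiv_conjSegre_last (j : ℕ) (k : Fin n) (l : Fin N) :
    pderiv ℂ (Fin.last j, k) (conjSegre γ j l) = 0 :=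
  pderiv_rename_of_notMem _ (fun s => oldVar_ne_last j s k) _

/-- Conjugation and renaming are injective and respect derivatives; the new variables only add zero
columns. -/
theorem Rk_conjSegre (γ : Fin N → FPS (Fin N ⊕ Fin n)) (j : ℕ) :
    Rk (conjSegre γ j) = Rk (iterSegre γ j) := by
  let e : Fin j × Fin n ↪ Fin (j + 1) × Fin n := ⟨oldVar j, oldVar_injective j⟩
  let K := FractionRing (FPS (Fin (j + 1) × Fin n))
  let φ : FPS (Fin j × Fin n) →+* K :=
    (algebraMap _ K).comp ((rename (R := ℂ) e).toRingHom.comp conjSeries)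
  have hφ : Function.Injective φ :=
    (IsFractionRing.injective _ K).comp ((rename_injective e).comp conjSeries_injective)
  have hJ : ((jacobian (iterSegre γ j)).map φ) =
      ((jacobian (conjSegre γ j)).map (algebraMap _ K)).submatrix id (oldVar j) := by
    ext l s
    change algebraMap _ K (rename e (conjSeries (pderiv ℂ s (iterSegre γ j l)))) =
      algebraMap _ K (pderiv ℂ (e s) (rename e (conjSeries (iterSegre γ j l))))
    rw [pderiv_rename, pderiv_conjSeries]
  rw [Rk_eq_rank_map _ φ hφ, hJ]
  refine le_antisymm ?_ (Matrix.rank_submatrix_le _ _ _)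
  rw [Rk, Matrix.rank_eq_finrank_span_cols, Matrix.rank_eq_finrank_span_cols]
  refine Submodule.finrank_mono (Submodule.span_le.2 ?_)
  rintro _ ⟨s, rfl⟩
  rcases eq_last_or_eq_oldVar j s with ⟨k, rfl⟩ | ⟨s', rfl⟩
  · have : (((jacobian (conjSegre γ j)).map (algebraMap _ K)).col (Fin.last j, k)) = 0 := by
      ext1 l
      change algebraMap _ K (pderiv ℂ (Fin.last j, k) (conjSegre γ j l)) = 0
      rw [pderiv_conjSegre_last, map_zero]
    rw [SetLike.mem_coe, this]
    exact Submodule.zero_mem _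
  · exact Submodule.subset_span ⟨s', rfl⟩

theorem map_tangentSpan {σ σ' τ : Type} [Fintype σ] [Fintype σ'] [Fintype τ] (e : σ' → σ)
    (D : σ → FPS τ) : (tangentSpan D).map (LinearMap.funLeft _ _ e) = tangentSpan (D ∘ e) := by
  rw [tangentSpan, Submodule.map_span, ← Set.range_comp]
  rfl

/-- The image of `(v^{j+1}, v̄^j)` is, generically, tangent to the Segre varieties. -/
theorem le_finrank_tangentSpan_inf (hγ : IsSegreMapping ρ γ) (j : ℕ) :
    n ≤ Module.finrank (FractionRing (FPS (Fin (j + 1) × Fin n)))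
      ((tangentSpan (segrePair γ j) ⊓ LinearMap.ker
        (LinearMap.funLeft _ _ (Sum.inr : Fin N → Fin N ⊕ Fin N)) : Submodule _ _).map
        (LinearMap.funLeft (FractionRing (FPS (Fin (j + 1) × Fin n)))
          (FractionRing (FPS (Fin (j + 1) × Fin n))) (Sum.inl : Fin N → Fin N ⊕ Fin N))) := by
  have hA := isFormalMapping_segreArg hγ.1 j
  let K := FractionRing (FPS (Fin (j + 1) × Fin n))
  let C : Matrix (Fin N) (Fin n) (FPS (Fin N ⊕ Fin n)) := (jacobian γ).submatrix id Sum.inr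
  let φ : FPS (Fin N ⊕ Fin n) →+* K :=
    (algebraMap _ K).comp (substAlgHom (R := ℂ) (hasSubst _ hA)).toRingHom
  have hr : n ≤ (C.map φ).rank := by
    have h1 := rank_map_le_of_ker_le φ constantCoeff (fun x hx => ?_) C
    · exact hγ.2.2.symm.le.trans h1
    · have h2 : subst (segreArg γ j) x = 0 := by
        rw [← substAlgHom_apply (R := ℂ) (hasSubst _ hA)]
        exact IsFractionRing.injective _ K (hx.trans (map_zero _).symm)
      rw [← constantCoeff_subst_formal hA, h2, map_zero]
  refine hr.trans ?_
  rw [Matrix.rank_eq_finrank_span_cols]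
  refine Submodule.finrank_mono (Submodule.span_le.2 ?_)
  rintro _ ⟨k, rfl⟩
  -- The derivative in `t^{j+1}_k` has no `ζ`-part, since `v̄^j` does not involve `t^{j+1}`.
  refine ⟨((jacobian (segrePair γ j)).map (algebraMap _ K)).col (Fin.last j, k),
    ⟨Submodule.subset_span ⟨_, rfl⟩, ?_⟩, ?_⟩
  · rw [SetLike.mem_coe, LinearMap.mem_ker]
    ext1 l
    change algebraMap _ K (pderiv ℂ (Fin.last j, k) (conjSegre γ j l)) = 0
    rw [pderiv_conjSegre_last, map_zero]
  · ext1 i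
    change algebraMap _ K (pderiv ℂ (Fin.last j, k) (iterSegre γ (j + 1) i)) =
      algebraMap _ K (substAlgHom (R := ℂ) (hasSubst _ hA) (pderiv ℂ (Sum.inr k) (γ i)))
    rw [iterSegre_succ, pderiv_subst hA, Fintype.sum_sum_type, Finset.sum_eq_zero, zero_add,
      Finset.sum_eq_single k, substAlgHom_apply]
    · rw [segreArg, Sum.elim_inr, pderiv_X_self, mul_one]
    · intro k' _ hk'
      rw [segreArg, Sum.elim_inr, pderiv_X_of_ne (by simpa using hk'), mul_zero]
    · simp
    · intro l _
      rw [segreArg, Sum.elim_inl, pderiv_conjSegre_last, mul_zero]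

/-- The Jacobian matrix of the defining series at the generic point of the image of `D`. -/
def genericJacobian {τ : Type} (ρ : Fin d → FPS₂ N) (D : Fin N ⊕ Fin N → FPS τ) :
    Matrix (Fin d) (Fin N ⊕ Fin N) (FractionRing (FPS τ)) :=
  Matrix.of fun i s => algebraMap _ _ (subst D (pderiv ℂ s (ρ i)))

theorem genericJacobian_mulVec_genericValue {τ : Type} [Fintype τ] {D : Fin N ⊕ Fin N → FPS τ}
    (hD : IsFormalMapping D) (V : FormalVectorField (Fin N ⊕ Fin N)) (i : Fin d) :
    (genericJacobian ρ D).mulVec (genericValue D V) i =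
      algebraMap _ _ (subst D (V (ρ i))) := by
  rw [vectorField_apply V, subst_formal_sum hD, map_sum]
  simp only [subst_mul (hasSubst D hD), map_mul]
  change ∑ s, algebraMap _ (FractionRing (FPS τ)) (subst D (pderiv ℂ s (ρ i))) *
    algebraMap _ (FractionRing (FPS τ)) (subst D (V (X s))) = _
  exact Finset.sum_congr rfl fun s _ => mul_comm _ _

theorem genericJacobian_mulVec_tangentSpan {τ : Type} [Fintype τ] {D : Fin N ⊕ Fin N → FPS τ}
    (hD : IsFormalMapping D) (h : ∀ i, subst D (ρ i) = 0)
    {u : Fin N ⊕ Fin N → FractionRing (FPS τ)} (hu : u ∈ tangentSpan D) :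
    (genericJacobian ρ D).mulVec u = 0 := by
  have hle : tangentSpan D ≤ LinearMap.ker (genericJacobian ρ D).mulVecLin := by
    rw [tangentSpan, Submodule.span_le]
    rintro _ ⟨t, rfl⟩
    rw [SetLike.mem_coe, LinearMap.mem_ker]
    ext1 i
    have h1 := congrArg (pderiv ℂ t) (h i)
    rw [pderiv_subst hD, map_zero] at h1
    have h2 := congrArg (algebraMap (FPS τ) (FractionRing (FPS τ))) h1
    rw [map_sum, map_zero] at h2
    simp only [map_mul] at h2
    exact h2
  exact LinearMap.mem_ker.1 (hle hu)

theorem rank_genericJacobian {τ : Type} {D : Fin N ⊕ Fin N → FPS τ}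
    (hD : IsFormalMapping D) {e : Fin N → Fin N ⊕ Fin N}
    (h : ((jacobianZero ρ).submatrix id e).rank = d) :
    d ≤ ((genericJacobian ρ D).submatrix id e).rank := by
  let φ : FPS₂ N →+* FractionRing (FPS τ) :=
    (algebraMap _ _).comp (substAlgHom (R := ℂ) (hasSubst _ hD)).toRingHom
  have h1 : (((jacobian ρ).submatrix id e).map constantCoeff).rank ≤
      (((jacobian ρ).submatrix id e).map φ).rank := by
    refine rank_map_le_of_ker_le φ constantCoeff (fun x hx => ?_) _
    have h2 : subst D x = 0 := by
      rw [← substAlgHom_apply (R := ℂ) (hasSubst _ hD)]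
      exact IsFractionRing.injective _ (FractionRing (FPS τ)) (hx.trans (map_zero _).symm)
    rw [← constantCoeff_subst_formal hD, h2, map_zero]
  · refine h.symm.le.trans (h1.trans (le_of_eq (congrArg Matrix.rank ?_)))
    ext i s
    change algebraMap _ _ (substAlgHom (R := ℂ) (hasSubst _ hD) (pderiv ℂ (e s) (ρ i))) = _
    rw [substAlgHom_apply]
    rfl

/-- The monotonicity of the ranks of the iterated Segre mappings, together with the fact that the
CR vector fields are tangent to the image of `(v^{j+1}, v̄^j)` as soon as the rank stabilizes. -/
theorem Rk_iterSegre_step (hn : n + d = N) (hM : IsGeneric M d)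
    (hρ : Ideal.span (Set.range ρ) = M) (hγ : IsSegreMapping ρ γ) (j : ℕ) :
    n ≤ Rk (iterSegre γ (j + 1)) ∧ Rk (iterSegre γ j) ≤ Rk (iterSegre γ (j + 1)) ∧
      (Rk (iterSegre γ j) = Rk (iterSegre γ (j + 1)) →
        dimLieAlgZero M ≤ Rk (iterSegre γ j) + n) := by
  set D := segrePair γ j with hD'
  have hD : IsFormalMapping D := isFormalMapping_segrePair hγ.1 j
  have hρD : ∀ i, subst D (ρ i) = 0 := fun i =>
    subst_segrePair_eq_zero hγ j (Ideal.subset_span ⟨i, rfl⟩)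
  let K := FractionRing (FPS (Fin (j + 1) × Fin n))
  let S : Submodule K (Fin N ⊕ Fin N → K) := tangentSpan D
  let R := genericJacobian ρ D
  let pZ := LinearMap.funLeft K K (Sum.inl : Fin N → Fin N ⊕ Fin N)
  let pζ := LinearMap.funLeft K K (Sum.inr : Fin N → Fin N ⊕ Fin N)
  -- The (1,0)- and (0,1)-tangent spaces of `M` at the generic point of the image, each of dimension
  -- at most `N - d = n`.
  let TZ : Submodule K (Fin N ⊕ Fin N → K) := LinearMap.ker R.mulVecLin ⊓ LinearMap.ker pζ
  let Tζ : Submodule K (Fin N ⊕ Fin N → K) := LinearMap.ker R.mulVecLin ⊓ LinearMap.ker pZ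
  have hSR : S ≤ LinearMap.ker R.mulVecLin := fun u hu =>
    LinearMap.mem_ker.2 (genericJacobian_mulVec_tangentSpan hD hρD hu)
  have hTZ : Module.finrank K TZ ≤ n := by
    have h1 : Module.finrank K TZ + (R.submatrix id Sum.inl).rank ≤ Fintype.card (Fin N) := by
      refine finrank_add_rank_le R Sum.inl_injective TZ (fun u hu => hu.1) fun u hu i hi => ?_
      rcases i with i | i
      · exact absurd ⟨i, rfl⟩ hi
      · exact congrFun (LinearMap.mem_ker.1 hu.2) i
    have h2 : d ≤ (R.submatrix id Sum.inl).rank :=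
      rank_genericJacobian hD (hM.rank_jacobianZZero hρ)
    rw [Fintype.card_fin] at h1
    omega
  have hTζ : Module.finrank K Tζ ≤ n := by
    have h1 : Module.finrank K Tζ + (R.submatrix id Sum.inr).rank ≤ Fintype.card (Fin N) := by
      refine finrank_add_rank_le R Sum.inr_injective Tζ (fun u hu => hu.1) fun u hu i hi => ?_
      rcases i with i | i
      · exact congrFun (LinearMap.mem_ker.1 hu.2) i
      · exact absurd ⟨i, rfl⟩ hi
    have h2 : d ≤ (R.submatrix id Sum.inr).rank :=
      rank_genericJacobian hD (hM.rank_jacobian_conj hρ)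
    rw [Fintype.card_fin] at h1
    omega
  have hZ1 : n ≤ Module.finrank K ((S ⊓ LinearMap.ker pζ : Submodule K _).map pZ) :=
    le_finrank_tangentSpan_inf hγ j
  have hZ2 : n ≤ Module.finrank K (S ⊓ LinearMap.ker pζ : Submodule K _) :=
    hZ1.trans (Submodule.finrank_map_le _ _)
  have hZle : S ⊓ LinearMap.ker pζ ≤ TZ := inf_le_inf_right _ hSR
  have hζle : S ⊓ LinearMap.ker pZ ≤ Tζ := inf_le_inf_right _ hSR
  have hZeq : S ⊓ LinearMap.ker pζ = TZ :=
    Submodule.eq_of_le_of_finrank_le hZle (hTZ.trans hZ2)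
  have hmapZ : Module.finrank K (S.map pZ) = Rk (iterSegre γ (j + 1)) := by
    rw [map_tangentSpan, finrank_tangentSpan]
    rfl
  have hmapζ : Module.finrank K (S.map pζ) = Rk (iterSegre γ j) := by
    rw [map_tangentSpan, finrank_tangentSpan, ← Rk_conjSegre]
    rfl
  have hdZ := finrank_map_add_finrank_inf_ker pZ S
  have hdζ := finrank_map_add_finrank_inf_ker pζ S
  have hle1 := Submodule.finrank_mono hZle
  have hle2 := Submodule.finrank_mono hζle
  -- `dim S` is `Rk v^j + n` by the `ζ`-projection and at most `Rk v^{j+1} + n` by the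
  -- `Z`-projection.
  refine ⟨?_, by omega, fun heq => ?_⟩
  · rw [← hmapZ]
    exact hZ1.trans (Submodule.finrank_mono (Submodule.map_mono inf_le_left))
  -- Equal ranks leave dimension `n` for the kernel of the `Z`-projection, so it fills the
  -- (0,1)-tangent space.
  · have hζeq : S ⊓ LinearMap.ker pZ = Tζ :=
      Submodule.eq_of_le_of_finrank_le hζle (by omega)
    have hlift : lieAlg M ≤ liftableAlg D hD := by
      refine LieSubalgebra.lieSpan_le.2 ?_
      rintro V ⟨h01, hV⟩
      refine (mem_liftableAlg hD).2 ?_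
      have hker : genericValue D V ∈ LinearMap.ker R.mulVecLin := by
        rw [LinearMap.mem_ker]
        ext1 i
        refine (genericJacobian_mulVec_genericValue hD V i).trans ?_
        rw [subst_segrePair_eq_zero hγ j, map_zero]
        · rfl
        · rw [hρ]
          exact hV _ (hρ ▸ Ideal.subset_span ⟨i, rfl⟩)
      rcases h01 with h | h
      · rw [isOneZero_iff] at h
        have : genericValue D V ∈ TZ := ⟨hker, by
          rw [SetLike.mem_coe, LinearMap.mem_ker]
          ext1 k
          change algebraMap _ K (subst D (V (X (Sum.inr k)))) = 0
          rw [h k, subst_formal_zero hD, map_zero]⟩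
        rw [← hZeq] at this
        exact this.1
      · rw [isZeroOne_iff] at h
        have : genericValue D V ∈ Tζ := ⟨hker, by
          rw [SetLike.mem_coe, LinearMap.mem_ker]
          ext1 k
          change algebraMap _ K (subst D (V (X (Sum.inl k)))) = 0
          rw [h k, subst_formal_zero hD, map_zero]⟩
        rw [← hζeq] at this
        exact this.1
    obtain ⟨A, B, F, -, -⟩ := exists_adaptedFrame hn hM hρ
    have h1 := F.card_le_Rk hD hlift
    have h2 : Module.finrank K S = Rk D := finrank_tangentSpan D
    rw [← F.finrank_map_evalZero] at h1
    change dimLieAlgZero M ≤ _ at h1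
    omega

end Segre

/-! ### The upper bound for the ranks. -/

section Upper

variable {N n d e : ℕ} {M : Ideal (FPS₂ N)} {ρ : Fin d → FPS₂ N}
  {γ : Fin N → FPS (Fin N ⊕ Fin n)} {f : Fin e → FPS (Fin N)}

/-- The iterated Segre mappings take their values in `{f = 0}`. -/
theorem subst_iterSegre_eq_zero (hM : IsGeneric M d) (hρ : Ideal.span (Set.range ρ) = M)
    (hγ : IsSegreMapping ρ γ) (hf0 : IsFormalMapping f) (hf : joinIdeal f ρ = crOrbit M) (j : ℕ)
    (k : Fin e) : subst (iterSegre γ j) (f k) = 0 := by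
  induction j generalizing k with
  | zero =>
    have : iterSegre γ 0 = fun _ => 0 := rfl
    rw [this]
    exact subst_zero_of_constantCoeff_zero (hf0 k)
  | succ j ih =>
    have hv := isFormalMapping_iterSegre hγ.1 j
    set D := segrePair γ j with hD'
    have hD : IsFormalMapping D := isFormalMapping_segrePair hγ.1 j
    -- For `f` this is the conjugate of the induction hypothesis, since `σ(f)` involves only `ζ`;
    -- for `ρ` it is reality of `M`.
    have hker : crOrbit M ≤
        (RingHom.ker (substAlgHom (R := ℂ) (hasSubst _ hD))).comap sigmaHom := by
      rw [← hf, joinIdeal, Ideal.span_le]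
      rintro _ (⟨i, rfl⟩ | ⟨i, rfl⟩)
      · rw [SetLike.mem_coe, Ideal.mem_comap, RingHom.mem_ker, substAlgHom_apply, sigmaHom_apply,
          sigma_rename_inl, subst_rename _ hD]
        change subst (conjSegre γ j) (conjSeries (f i)) = 0
        have h1 := congrArg (fun g => rename (oldVar j) (conjSeries g)) (ih i)
        simp only [map_zero, conjSeries_subst hv] at h1
        rwa [rename_subst _ hv.conjSeries] at h1
      · rw [SetLike.mem_coe, Ideal.mem_comap, RingHom.mem_ker, substAlgHom_apply, sigmaHom_apply]
        refine subst_segrePair_eq_zero hγ j ?_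
        rw [hρ]
        exact hM.2.1 _ (hρ ▸ Ideal.subset_span ⟨i, rfl⟩)
    -- Applying `hker` to `σ(f_k)` returns `f_k` itself, evaluated at `v^{j+1}`.
    have hfO : sigma (rename Sum.inl (f k) : FPS₂ N) ∈ crOrbit M := by
      refine isRealIdeal_crOrbit hM _ ?_
      rw [← hf]
      exact Ideal.subset_span (Or.inl ⟨k, rfl⟩)
    have := hker hfO
    rw [Ideal.mem_comap, RingHom.mem_ker, substAlgHom_apply, sigmaHom_apply, sigma_sigma,
      subst_rename _ hD] at this
    exact this

/-- Differentiating `f ∘ v = 0` makes a product of Jacobians vanish, and the left factor has full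
rank generically because it does at the origin. -/
theorem Rk_add_le_of_subst_eq_zero {σ τ ι : Type} [Fintype σ] [Fintype τ] [Fintype ι]
    {v : τ → FPS σ} (hv : IsFormalMapping v) {f : ι → FPS τ}
    (hf : LinearIndependent ℂ (jacobianZero f).row) (h : ∀ k, subst v (f k) = 0) :
    Rk v + Fintype.card ι ≤ Fintype.card τ := by
  let K := FractionRing (FPS σ)
  let φ : FPS τ →+* K := (algebraMap _ K).comp (substAlgHom (R := ℂ) (hasSubst _ hv)).toRingHom
  have hr : Fintype.card ι ≤ ((jacobian f).map φ).rank := by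
    rw [row_linearIndependent_iff_rank] at hf
    have h1 := rank_map_le_of_ker_le φ constantCoeff (fun x hx => ?_) (jacobian f)
    · exact hf.symm.le.trans h1
    · have h2 : subst v x = 0 := by
        rw [← substAlgHom_apply (R := ℂ) (hasSubst _ hv)]
        exact IsFractionRing.injective _ K (hx.trans (map_zero _).symm)
      rw [← constantCoeff_subst_formal hv, h2, map_zero]
  have h0 : (jacobian f).map φ * (jacobian v).map (algebraMap _ K) = 0 := by
    ext k s
    have h1 := congrArg (algebraMap _ K) (congrArg (pderiv ℂ s) (h k))
    rw [pderiv_subst hv, map_zero, map_sum, map_zero] at h1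
    rw [Matrix.mul_apply, Matrix.zero_apply, ← h1]
    refine Finset.sum_congr rfl fun i _ => ?_
    rw [map_mul, ← substAlgHom_apply (R := ℂ) (hasSubst _ hv)]
    rfl
  have := Matrix.rank_add_rank_le_card_of_mul_eq_zero h0
  change Fintype.card ι ≤ _ at hr
  change ((jacobian v).map (algebraMap _ K)).rank + _ ≤ _
  omega

end Upper

/-! ### Generic rank under composition. -/

section Composition

variable {σ τ κ : Type} [Fintype σ]

theorem subst_subst_formal {υ : Type} [Fintype κ] {K : κ → FPS σ} (hK : IsFormalMapping K)
    {F : σ → FPS υ} (hF : IsFormalMapping F) (h : FPS κ) :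
    subst F (subst K h) = subst (fun i => subst F (K i)) h :=
  subst_comp_subst_apply (hasSubst K hK) (hasSubst F hF) h

theorem jacobian_subst {F : σ → FPS τ} (hF : IsFormalMapping F) (K : κ → FPS σ) :
    jacobian (fun i => (subst F (K i) : FPS τ)) =
      (jacobian K).map (substAlgHom (R := ℂ) (hasSubst F hF)) * jacobian F := by
  refine Matrix.ext fun i k => ?_
  change pderiv ℂ k (subst F (K i)) = _
  rw [pderiv_subst hF, Matrix.mul_apply]
  refine Finset.sum_congr rfl fun s _ => ?_
  rw [Matrix.map_apply, substAlgHom_apply]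
  rfl

theorem jacobianZero_subst {F : σ → FPS τ} (hF : IsFormalMapping F) (K : κ → FPS σ) :
    jacobianZero (fun i => (subst F (K i) : FPS τ)) = jacobianZero K * jacobianZero F := by
  rw [jacobianZero, jacobian_subst hF, Matrix.map_mul, Matrix.map_map]
  congr 1
  ext i k
  change constantCoeff (substAlgHom (R := ℂ) (hasSubst F hF) (jacobian K i k)) = _
  rw [substAlgHom_apply, constantCoeff_subst_formal hF]
  rfl

theorem map_jacobian_subst {F : σ → FPS τ} (hF : IsFormalMapping F) (K : κ → FPS σ) :
    (jacobian (fun i => (subst F (K i) : FPS τ))).map (algebraMap _ (FractionRing (FPS τ))) =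
      (jacobian K).map ((algebraMap _ (FractionRing (FPS τ))).comp
        (substAlgHom (R := ℂ) (hasSubst F hF)).toRingHom) *
      (jacobian F).map (algebraMap _ (FractionRing (FPS τ))) := by
  rw [jacobian_subst hF, Matrix.map_mul, Matrix.map_map]
  rfl

variable [Fintype τ]

/-- Composition on the left does not increase the generic rank. -/
theorem Rk_subst_le_right {F : σ → FPS τ} (hF : IsFormalMapping F) (K : κ → FPS σ) :
    Rk (fun i => (subst F (K i) : FPS τ)) ≤ Rk F := by
  rw [Rk, map_jacobian_subst hF]
  exact Matrix.rank_mul_le_right _ _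

/-- Composition on the right does not increase the generic rank. -/
theorem Rk_subst_le_left [Fintype κ] {F : σ → FPS τ} (hF : IsFormalMapping F) (K : κ → FPS σ) :
    Rk (fun i => (subst F (K i) : FPS τ)) ≤ Rk K := by
  rw [Rk, map_jacobian_subst hF]
  refine (Matrix.rank_mul_le_left _ _).trans (rank_map_le_of_ker_le _ _ (fun x hx => ?_) _)
  rw [IsFractionRing.injective _ (FractionRing (FPS σ)) (hx.trans (map_zero _).symm), map_zero]

/-- A change of coordinates in the target does not change the generic rank. -/
theorem Rk_le_Rk_subst {F : σ → FPS τ} [DecidableEq σ] (hF : IsFormalMapping F) {K : σ → FPS σ}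
    (hK : IsUnit (jacobianZero K)) : Rk F ≤ Rk (fun i => (subst F (K i) : FPS τ)) := by
  rw [Rk, Rk, map_jacobian_subst hF, Matrix.rank_mul_eq_right_of_isUnit_det]
  have h1 : IsUnit (jacobian K).det :=
    isUnit_det_of_map ((Matrix.isUnit_iff_isUnit_det _).1 hK).ne_zero
  have h2 := h1.map ((algebraMap _ (FractionRing (FPS τ))).comp
    (substAlgHom (R := ℂ) (hasSubst F hF)).toRingHom)
  rwa [RingHom.map_det] at h2

end Composition

/-! ### Lifting through a parametrization of Segre varieties. -/

section Lift

variable {N n d : ℕ}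

/-- By dimension the kernel of `R` is the range of `B`, on which the coordinates `A` are injective.
-/
theorem mulVec_injective_sum_of_mul_eq_zero {K : Type*} [Field K] (hn : n + d = N)
    {R : Matrix (Fin d) (Fin N) K} {B : Matrix (Fin N) (Fin n) K} (hR : R.rank = d)
    (hB : B.rank = n) (hRB : R * B = 0) {A : Fin n → Fin N}
    (hA : (B.submatrix A id).det ≠ 0) {x : Fin N → K} (hx : R.mulVec x = 0)
    (hxA : ∀ k, x (A k) = 0) : x = 0 := by
  have hle : LinearMap.range B.mulVecLin ≤ LinearMap.ker R.mulVecLin := by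
    rintro _ ⟨y, rfl⟩
    rw [LinearMap.mem_ker, Matrix.mulVecLin_apply, Matrix.mulVecLin_apply, Matrix.mulVec_mulVec,
      hRB, Matrix.zero_mulVec]
  have h1 := LinearMap.finrank_range_add_finrank_ker R.mulVecLin
  rw [Module.finrank_fintype_fun_eq_card, Fintype.card_fin] at h1
  change R.rank + _ = _ at h1
  change Module.finrank K (LinearMap.range B.mulVecLin) = n at hB
  have heq := Submodule.eq_of_le_of_finrank_eq hle (by omega)
  have hmem : x ∈ LinearMap.ker R.mulVecLin := hx
  rw [← heq] at hmem
  obtain ⟨y, rfl⟩ := hmem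
  have hy : y = 0 := by
    refine Matrix.eq_zero_of_mulVec_eq_zero hA ?_
    ext1 k
    exact hxA k
  rw [hy, map_zero]

theorem eq_zero_of_mulVec_eq_zero_of_map {σ ι : Type} [Fintype ι]
    {S : Matrix ι (Fin N) (FPS σ)}
    (hS : ∀ x, (S.map constantCoeff).mulVec x = 0 → x = 0) {w : Fin N → FPS σ}
    (hw : S.mulVec w = 0) : w = 0 := by
  have hr : (S.map constantCoeff).rank = N := by
    rw [Matrix.rank, LinearMap.finrank_range_of_inj, Module.finrank_fintype_fun_eq_card,
      Fintype.card_fin]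
    rw [← LinearMap.ker_eq_bot, LinearMap.ker_eq_bot']
    exact hS
  obtain ⟨r, c, hrc⟩ := exists_minor_ne_zero _ hr
  have hdet : ((S.submatrix r id).map constantCoeff).det ≠ 0 :=
    det_ne_zero_of_card_le_rank
      (card_le_rank_of_minor_ne_zero ((S.submatrix r id).map constantCoeff) id c hrc)
  have hu := isUnit_det_of_map hdet
  have h0 : (S.submatrix r id).mulVec w = 0 := funext fun i => congrFun hw (r i)
  rw [← Matrix.one_mulVec w, ← Matrix.nonsing_inv_mul _ hu, ← Matrix.mulVec_mulVec, h0,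
    Matrix.mulVec_zero]

variable {α : Type} [Fintype α]

/-- A family `Γ(a, t)` of `n`-dimensional parametrizations of the Segre varieties `ρ(·, q(a)) = 0`
lifts every mapping `p(a)` into these Segre varieties. -/
theorem exists_lift (hn : n + d = N) {ρ : Fin d → FPS₂ N}
    (hρr : ((jacobianZero ρ).submatrix id Sum.inl).rank = d) {p q : Fin N → FPS α}
    (hp : IsFormalMapping p) (hq : IsFormalMapping q) (hρp : ∀ j, subst (Sum.elim p q) (ρ j) = 0)
    {Γ : Fin N → FPS (α ⊕ Fin n)} (hΓ : IsFormalMapping Γ)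
    (hρΓ : ∀ j, subst (Sum.elim Γ fun k => rename Sum.inl (q k)) (ρ j) = 0)
    (hΓr : ((jacobianZero Γ).submatrix id Sum.inr).rank = n) :
    ∃ θ : Fin n → FPS α, IsFormalMapping θ ∧
      ∀ i, subst (Sum.elim (X : α → FPS α) θ) (Γ i) = p i := by
  have hqα : IsFormalMapping fun k => (rename Sum.inl (q k) : FPS (α ⊕ Fin n)) := fun k => by
    rw [constantCoeff_rename, hq k]
  have hΓq := hΓ.sumElim hqα
  obtain ⟨A, c, hAc⟩ := exists_minor_ne_zero _ hΓr
  have hA : (((jacobianZero Γ).submatrix id Sum.inr).submatrix A id).det ≠ 0 :=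
    det_ne_zero_of_card_le_rank (card_le_rank_of_minor_ne_zero _ id c hAc)
  have hpd : ∀ k i, pderiv ℂ (Sum.inr k) (rename Sum.inl (p i) : FPS (α ⊕ Fin n)) = 0 :=
    fun k i => pderiv_rename_of_notMem _ (by simp) _
  have hqd : ∀ k i, pderiv ℂ (Sum.inr k) (rename Sum.inl (q i) : FPS (α ⊕ Fin n)) = 0 :=
    fun k i => pderiv_rename_of_notMem _ (by simp) _
  -- Only the `n` components selected by `A` are matched with `p` here; the equations `ρ` will force
  -- the others.
  obtain ⟨θ, hθ, hG⟩ := exists_implicit_function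
    (G := fun j : Fin n => Γ (A j) - rename Sum.inl (p (A j)))
    (fun j => by rw [map_sub, hΓ, constantCoeff_rename, hp, sub_zero]) (by
      convert hA using 2
      ext i k
      change constantCoeff (pderiv ℂ (Sum.inr k) (Γ (A i) - rename Sum.inl (p (A i)))) =
        constantCoeff (pderiv ℂ (Sum.inr k) (Γ (A i)))
      rw [map_sub, hpd, sub_zero])
  have hXθ : IsFormalMapping (Sum.elim (X : α → FPS α) θ) :=
    IsFormalMapping.sumElim (fun a => constantCoeff_X a) hθ
  refine ⟨θ, hθ, ?_⟩
  let p₂ : Fin N → FPS α := fun i => subst (Sum.elim (X : α → FPS α) θ) (Γ i)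
  have hp₂ : IsFormalMapping p₂ := hXθ.subst hΓ
  have hXq : ∀ f : FPS α, subst (Sum.elim (X : α → FPS α) θ) (rename Sum.inl f) = f := by
    intro f
    rw [subst_rename _ hXθ]
    simp only [Sum.elim_inl]
    exact congrFun subst_self f
  have hp₂A : ∀ k, p₂ (A k) = p (A k) := fun k => by
    have := hG k
    rw [subst_sub (hasSubst _ hXθ), hXq] at this
    exact sub_eq_zero.1 this
  have hρp₂ : ∀ j, subst (Sum.elim p₂ q) (ρ j) = 0 := fun j => by
    have h1 := congrArg (subst (Sum.elim (X : α → FPS α) θ)) (hρΓ j)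
    rw [subst_subst_formal hΓq hXθ, subst_formal_zero hXθ] at h1
    rw [← h1]
    congr 1
    ext1 s
    rcases s with k | k
    · rfl
    · exact (hXq _).symm
  choose C hC hC0 using fun j => subst_sub_subst (hp₂.sumElim hq) (hp.sumElim hq) (ρ j)
  have hRB : (jacobianZero ρ).submatrix id Sum.inl * (jacobianZero Γ).submatrix id Sum.inr = 0 := by
    ext j k
    have h1 : jacobianZero (fun j => (subst (Sum.elim Γ fun k => rename Sum.inl (q k)) (ρ j) :
        FPS (α ⊕ Fin n))) j (Sum.inr k) = 0 := by
      rw [jacobianZero_apply, hρΓ, map_zero, map_zero]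
    rw [jacobianZero_subst hΓq, Matrix.mul_apply, Fintype.sum_sum_type] at h1
    have h2 : ∑ l, jacobianZero ρ j (Sum.inr l) * jacobianZero
        (Sum.elim Γ fun k => rename Sum.inl (q k)) (Sum.inr l) (Sum.inr k) = 0 := by
      refine Finset.sum_eq_zero fun l _ => ?_
      rw [jacobianZero_apply (Sum.elim Γ _), Sum.elim_inr, hqd, map_zero, mul_zero]
    rw [h2, add_zero] at h1
    exact h1
  -- Both `p₂` and `p` solve `ρ(·, q) = 0`, so `C` annihilates `p₂ - p`, and the rows from `A` do
  -- too. At the origin `C` is `∂ρ/∂Z`, so `S` is injective there.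
  let S : Matrix (Fin d ⊕ Fin n) (Fin N) (FPS α) :=
    Matrix.fromRows (Matrix.of fun j i => C j (Sum.inl i))
      ((1 : Matrix (Fin N) (Fin N) (FPS α)).submatrix A id)
  have h0 : (fun i => p₂ i - p i) = 0 := by
    refine eq_zero_of_mulVec_eq_zero_of_map (S := S) (fun x hx => ?_) ?_
    · refine mulVec_injective_sum_of_mul_eq_zero hn hρr hΓr hRB hA (x := x) ?_ fun k => ?_
      · ext1 j
        refine Eq.trans ?_ (congrFun hx (Sum.inl j))
        change ∑ i, constantCoeff (pderiv ℂ (Sum.inl i) (ρ j)) * x i =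
          ∑ i, constantCoeff (C j (Sum.inl i)) * x i
        simp only [hC0]
      · have h1 := congrFun hx (Sum.inr k)
        change ∑ i, constantCoeff ((1 : Matrix (Fin N) (Fin N) (FPS α)) (A k) i) * x i = 0 at h1
        rw [Finset.sum_eq_single (A k)] at h1
        · simpa using h1
        · intro i _ hi
          rw [Matrix.one_apply_ne hi.symm, map_zero, zero_mul]
        · simp
    · ext1 s
      rcases s with j | k
      · have h1 := hC j
        rw [hρp₂, hρp, sub_zero, Fintype.sum_sum_type] at h1
        simp only [Sum.elim_inl, Sum.elim_inr, sub_self, mul_zero, Finset.sum_const_zero,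
          add_zero] at h1
        exact h1.symm
      · change ∑ i, (1 : Matrix (Fin N) (Fin N) (FPS α)) (A k) i * (p₂ i - p i) = 0
        rw [Finset.sum_eq_single (A k)]
        · rw [hp₂A, sub_self, mul_zero]
        · intro i _ hi
          rw [Matrix.one_apply_ne hi.symm, zero_mul]
        · simp
  exact fun i => sub_eq_zero.1 (congrFun h0 i)

end Lift

/-! ### Independence of coordinates, generators and Segre mapping. -/

section Invariance

variable {N n d : ℕ}

/-- `γ` parametrizes, in the coordinates `Z' = H(Z)`, Segre varieties of `{ρ' = 0}`. -/
structure IsSegreIn (H : Fin N → FPS (Fin N)) (ρ' : Fin d → FPS₂ N)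
    (γ : Fin N → FPS (Fin N ⊕ Fin n)) : Prop where
  formal : IsFormalMapping γ
  subst_eq_zero : ∀ j, subst (Sum.elim (fun i => (subst γ (H i) : FPS (Fin N ⊕ Fin n)))
    fun k => rename Sum.inl (conjSeries (H k))) (ρ' j) = 0
  rank_eq : ((jacobianZero γ).submatrix id Sum.inr).rank = n

theorem isCoordChange_X : IsCoordChange (X : Fin N → FPS (Fin N)) := by
  refine ⟨fun i => constantCoeff_X i, ?_⟩
  have : jacobianZero (X : Fin N → FPS (Fin N)) = 1 := by
    refine Matrix.ext fun i k => ?_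
    rw [jacobianZero_apply]
    by_cases h : i = k
    · rw [h, pderiv_X_self, map_one, Matrix.one_apply_eq]
    · rw [pderiv_X_of_ne h, map_zero, Matrix.one_apply_ne h]
  rw [this]
  exact isUnit_one

theorem IsSegreMapping.isSegreIn_X {ρ : Fin d → FPS₂ N} {γ : Fin N → FPS (Fin N ⊕ Fin n)}
    (h : IsSegreMapping ρ γ) : IsSegreIn X ρ γ := by
  refine ⟨h.1, fun j => ?_, h.2.2⟩
  rw [← h.2.1 j]
  congr 1
  ext1 s
  rcases s with i | k
  · exact subst_X (hasSubst γ h.1) i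
  · rw [Sum.elim_inr, Sum.elim_inr, conjSeries_X, rename_X]

theorem isFormalMapping_doubled {H : Fin N → FPS (Fin N)} (hH : IsFormalMapping H) :
    IsFormalMapping (doubled H) := by
  refine IsFormalMapping.sumElim (fun k => ?_) fun k => ?_
  · rw [constantCoeff_rename, hH]
  · rw [constantCoeff_rename, constantCoeff_conjSeries, hH, map_zero]

theorem IsSegreMapping.isSegreIn {M : Ideal (FPS₂ N)} {ρ ρ' : Fin d → FPS₂ N}
    {γ : Fin N → FPS (Fin N ⊕ Fin n)} (h : IsSegreMapping ρ γ)
    (hρ : Ideal.span (Set.range ρ) = M) {H : Fin N → FPS (Fin N)} (hH : IsFormalMapping H)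
    (hρ' : IsDefiningIn H M ρ') : IsSegreIn H ρ' γ := by
  refine ⟨h.1, fun j => ?_, h.2.2⟩
  have hE : IsFormalMapping (Sum.elim γ fun k => (X (Sum.inl k) : FPS (Fin N ⊕ Fin n))) :=
    h.1.sumElim fun k => constantCoeff_X _
  have hle : M ≤ RingHom.ker (substAlgHom (R := ℂ) (hasSubst _ hE)) := by
    rw [← hρ, Ideal.span_le]
    rintro _ ⟨i, rfl⟩
    rw [SetLike.mem_coe, RingHom.mem_ker, substAlgHom_apply]
    exact h.2.1 i
  have hmem : subst (doubled H) (ρ' j) ∈ M := by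
    rw [← hρ']
    exact Ideal.subset_span ⟨j, rfl⟩
  have h1 := hle hmem
  rw [RingHom.mem_ker, substAlgHom_apply, subst_subst_formal (isFormalMapping_doubled hH) hE] at h1
  rw [← h1]
  congr 1
  ext1 s
  rcases s with i | k
  · rw [doubled, Sum.elim_inl, Sum.elim_inl, subst_rename _ hE]
    rfl
  · rw [doubled, Sum.elim_inr, Sum.elim_inr, subst_rename _ hE, rename_eq_subst_X]
    rfl

theorem IsDefiningIn.rank_jacobianZero {M : Ideal (FPS₂ N)} (hM : IsGeneric M d)
    {H : Fin N → FPS (Fin N)} (hH : IsFormalMapping H) {ρ' : Fin d → FPS₂ N}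
    (hρ' : IsDefiningIn H M ρ') : ((jacobianZero ρ').submatrix id Sum.inl).rank = d := by
  have h1 := hM.rank_jacobianZZero hρ'
  have h2 : (jacobianZero fun j => (subst (doubled H) (ρ' j) : FPS₂ N)).submatrix id Sum.inl =
      (jacobianZero ρ').submatrix id Sum.inl * jacobianZero H := by
    rw [jacobianZero_subst (isFormalMapping_doubled hH)]
    refine Matrix.ext fun j k => ?_
    rw [Matrix.submatrix_apply, Matrix.mul_apply, Fintype.sum_sum_type, Matrix.mul_apply]
    have h3 : ∑ l, jacobianZero ρ' j (Sum.inr l) *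
        jacobianZero (doubled H) (Sum.inr l) (Sum.inl k) = 0 := by
      refine Finset.sum_eq_zero fun l _ => ?_
      rw [jacobianZero_apply (doubled H), doubled, Sum.elim_inr,
        pderiv_rename_of_notMem _ (by simp), map_zero, mul_zero]
    rw [id, h3, add_zero]
    refine Finset.sum_congr rfl fun l _ => ?_
    rw [jacobianZero_apply (doubled H), doubled, Sum.elim_inl, constantCoeff_pderiv_rename_inl]
    rfl
  refine le_antisymm (Matrix.rank_le_height _) ?_
  conv_lhs => rw [← h1, h2]
  exact Matrix.rank_mul_le_left _ _

/-- The iterated Segre mappings for two choices of coordinates and of Segre variety mappings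
agree up to a reparametrization. -/
theorem exists_reparametrization (hn : n + d = N) {ρ' : Fin d → FPS₂ N}
    (hρ' : ((jacobianZero ρ').submatrix id Sum.inl).rank = d)
    {H K : Fin N → FPS (Fin N)} (hH : IsFormalMapping H) (hK : IsCoordChange K)
    {γ δ : Fin N → FPS (Fin N ⊕ Fin n)} (hγ : IsSegreIn H ρ' γ) (hδ : IsSegreIn K ρ' δ) (j : ℕ) :
    ∃ Θ : Fin j × Fin n → FPS (Fin j × Fin n), IsFormalMapping Θ ∧
      ∀ i, subst (iterSegre γ j) (H i) = subst Θ (subst (iterSegre δ j) (K i)) := by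
  induction j with
  | zero =>
    have hX : IsFormalMapping (X : Fin 0 × Fin n → FPS (Fin 0 × Fin n)) :=
      fun s => constantCoeff_X s
    refine ⟨X, hX, fun i => ?_⟩
    have h1 : iterSegre γ 0 = 0 := rfl
    have h2 : iterSegre δ 0 = 0 := rfl
    rw [h1, h2, subst_zero_of_constantCoeff_zero (hH i),
      subst_zero_of_constantCoeff_zero (hK.1 i), subst_formal_zero hX]
  | succ j ih =>
    obtain ⟨Θ, hΘ, hv⟩ := ih
    have hvγ := isFormalMapping_iterSegre hγ.formal j
    have hvδ := isFormalMapping_iterSegre hδ.formal j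
    have hA := isFormalMapping_segreArg hγ.formal j
    have hB := isFormalMapping_segreArg hδ.formal j
    let Ξ : Fin j × Fin n → FPS (Fin (j + 1) × Fin n) := fun s =>
      rename (oldVar j) (conjSeries (Θ s))
    have hΞ : IsFormalMapping Ξ := fun s => by
      rw [constantCoeff_rename, constantCoeff_conjSeries, hΘ, map_zero]
    let w : Fin N → FPS (Fin (j + 1) × Fin n) := fun l =>
      subst Ξ (conjSeries (iterSegre δ j l))
    have hw : IsFormalMapping w := hΞ.subst hvδ.conjSeries
    let q : Fin N → FPS (Fin (j + 1) × Fin n) := fun k =>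
      subst (conjSegre γ j) (conjSeries (H k))
    have hqw : ∀ k, q k = subst w (conjSeries (K k)) := fun k => by
      have h1 := congrArg (fun g => rename (oldVar j) (conjSeries g)) (hv k)
      simp only [conjSeries_subst hvγ, conjSeries_subst hΘ, conjSeries_subst hvδ,
        rename_subst _ hvγ.conjSeries, rename_subst _ hΘ.conjSeries] at h1
      rw [subst_subst_formal hvδ.conjSeries hΞ] at h1
      exact h1
    have hq : IsFormalMapping q := (isFormalMapping_conjSegre hγ.formal j).subst hH.conjSeries
    let p : Fin N → FPS (Fin (j + 1) × Fin n) := fun i => subst (iterSegre γ (j + 1)) (H i)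
    have hp : IsFormalMapping p := (isFormalMapping_iterSegre hγ.formal (j + 1)).subst hH
    let E : Fin N ⊕ Fin n → FPS ((Fin (j + 1) × Fin n) ⊕ Fin n) :=
      Sum.elim (fun l => rename Sum.inl (w l)) fun k => X (Sum.inr k)
    have hEl : ∀ l, E (Sum.inl l) = rename Sum.inl (w l) := fun _ => rfl
    have hEr : ∀ k, E (Sum.inr k) = X (Sum.inr k) := fun _ => rfl
    have hE : IsFormalMapping E := by
      refine IsFormalMapping.sumElim (fun l => ?_) fun k => constantCoeff_X _
      rw [constantCoeff_rename, hw]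
    have hKδ : IsFormalMapping fun i => (subst δ (K i) : FPS (Fin N ⊕ Fin n)) :=
      hδ.formal.subst hK.1
    have hHγ : IsFormalMapping fun i => (subst γ (H i) : FPS (Fin N ⊕ Fin n)) :=
      hγ.formal.subst hH
    have hHc : IsFormalMapping fun k => (rename Sum.inl (conjSeries (H k)) :
        FPS (Fin N ⊕ Fin n)) := fun k => by
      rw [constantCoeff_rename, hH.conjSeries]
    have hKc : IsFormalMapping fun k => (rename Sum.inl (conjSeries (K k)) :
        FPS (Fin N ⊕ Fin n)) := fun k => by
      rw [constantCoeff_rename, hK.1.conjSeries]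
    have hρp : ∀ i, subst (Sum.elim p q) (ρ' i) = 0 := fun i => by
      have h1 := congrArg (subst (segreArg γ j)) (hγ.subst_eq_zero i)
      rw [subst_subst_formal (hHγ.sumElim hHc) hA, subst_formal_zero hA] at h1
      rw [← h1]
      congr 1
      ext1 s
      rcases s with k | k
      · rw [Sum.elim_inl, Sum.elim_inl, subst_subst_formal hγ.formal hA]
        rfl
      · rw [Sum.elim_inr, Sum.elim_inr, subst_rename _ hA]
        rfl
    -- The `δ`-parametrization of the Segre variety on which `p` lies: by `hqw` both base points
    -- become `q` in the common coordinates.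
    let Γ : Fin N → FPS ((Fin (j + 1) × Fin n) ⊕ Fin n) := fun i => subst E (subst δ (K i))
    have hΓ : IsFormalMapping Γ := hE.subst hKδ
    have hρΓ : ∀ i, subst (Sum.elim Γ fun k => rename Sum.inl (q k)) (ρ' i) = 0 := fun i => by
      have h1 := congrArg (subst E) (hδ.subst_eq_zero i)
      rw [subst_subst_formal (hKδ.sumElim hKc) hE, subst_formal_zero hE] at h1
      rw [← h1]
      congr 1
      ext1 s
      rcases s with k | k
      · rfl
      · rw [Sum.elim_inr, Sum.elim_inr, subst_rename _ hE, hqw, rename_subst _ hw]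
        rfl
    have hΓr : ((jacobianZero Γ).submatrix id Sum.inr).rank = n := by
      have h2 : (jacobianZero δ * jacobianZero E).submatrix id Sum.inr =
          (jacobianZero δ).submatrix id Sum.inr := by
        refine Matrix.ext fun i k => ?_
        rw [Matrix.submatrix_apply, Matrix.mul_apply, Fintype.sum_sum_type,
          Finset.sum_eq_zero, zero_add, Finset.sum_eq_single k]
        · rw [jacobianZero_apply E, hEr, pderiv_X_self, map_one, mul_one]
          rfl
        · intro k' _ hk'
          rw [jacobianZero_apply E, hEr, pderiv_X_of_ne (by simpa using hk'), map_zero,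
            mul_zero]
        · simp
        · intro l _
          rw [jacobianZero_apply E, hEl, pderiv_rename_of_notMem _ (by simp), map_zero,
            mul_zero]
      have h3 : (jacobianZero fun i => (subst E (subst δ (K i)) :
          FPS ((Fin (j + 1) × Fin n) ⊕ Fin n))).submatrix id Sum.inr =
          jacobianZero K * (jacobianZero δ).submatrix id Sum.inr := by
        rw [jacobianZero_subst hE, jacobianZero_subst hδ.formal, Matrix.mul_assoc, ← h2]
        rfl
      rw [h3, Matrix.rank_mul_eq_right_of_isUnit_det _ _
        ((Matrix.isUnit_iff_isUnit_det _).1 hK.2)]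
      exact hδ.rank_eq
    obtain ⟨θ, hθ, hlift⟩ := exists_lift hn hρ' hp hq hρp hΓ hρΓ hΓr
    have hXθ : IsFormalMapping (Sum.elim (X : _ → FPS (Fin (j + 1) × Fin n)) θ) :=
      IsFormalMapping.sumElim (fun a => constantCoeff_X a) hθ
    -- Old blocks use the conjugate of `Θ`, because `v^{j+1}` involves `v̄^j`; the last block is the
    -- lift.
    let Θ' : Fin (j + 1) × Fin n → FPS (Fin (j + 1) × Fin n) := fun s =>
      Fin.lastCases (motive := fun _ => FPS (Fin (j + 1) × Fin n)) (θ s.2)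
        (fun i => Ξ (i, s.2)) s.1
    have hΘlast : ∀ k, Θ' (Fin.last j, k) = θ k := fun k => Fin.lastCases_last
    have hΘold : ∀ s, Θ' (oldVar j s) = Ξ s := fun s => Fin.lastCases_castSucc _
    have hΘ' : IsFormalMapping Θ' := fun s => by
      rcases eq_last_or_eq_oldVar j s with ⟨k, rfl⟩ | ⟨s', rfl⟩
      · rw [hΘlast, hθ]
      · rw [hΘold, hΞ]
    refine ⟨Θ', hΘ', fun i => (hlift i).symm.trans ?_⟩
    change subst _ (subst E (subst δ (K i))) = _
    rw [subst_subst_formal hδ.formal hE, subst_subst_formal (hE.subst hδ.formal) hXθ,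
      subst_subst_formal (isFormalMapping_iterSegre hδ.formal (j + 1)) hΘ']
    congr 1
    ext1 l
    rw [iterSegre_succ, subst_subst_formal hE hXθ, subst_subst_formal hB hΘ']
    congr 1
    ext1 s
    rcases s with m | k
    · change subst _ (rename Sum.inl (w m)) = subst Θ' (rename (oldVar j) _)
      rw [subst_rename _ hXθ, subst_rename _ hΘ']
      simp only [Sum.elim_inl, hΘold]
      exact congrFun subst_self (w m)
    · change subst _ (X (Sum.inr k)) = subst Θ' (X (Fin.last j, k))
      rw [subst_X (hasSubst _ hXθ), subst_X (hasSubst _ hΘ'), hΘlast, Sum.elim_inr]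

theorem Rk_iterSegre_le (hn : n + d = N) {ρ' : Fin d → FPS₂ N}
    (hρ' : ((jacobianZero ρ').submatrix id Sum.inl).rank = d)
    {H K : Fin N → FPS (Fin N)} (hH : IsCoordChange H) (hK : IsCoordChange K)
    {γ δ : Fin N → FPS (Fin N ⊕ Fin n)} (hγ : IsSegreIn H ρ' γ) (hδ : IsSegreIn K ρ' δ) (j : ℕ) :
    Rk (iterSegre γ j) ≤ Rk (iterSegre δ j) := by
  obtain ⟨Θ, hΘ, h⟩ := exists_reparametrization hn hρ' hH.1 hK hγ hδ j
  refine (Rk_le_Rk_subst (isFormalMapping_iterSegre hγ.formal j) hH.2).trans ?_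
  rw [funext h]
  exact (Rk_subst_le_left hΘ _).trans
    (Rk_subst_le_right (isFormalMapping_iterSegre hδ.formal j) K)

/-- The ranks of the iterated Segre mappings do not depend on any choices. -/
theorem Rk_iterSegre_eq (hn : n + d = N) {M : Ideal (FPS₂ N)} (hM : IsGeneric M d)
    {ρ ρ' : Fin d → FPS₂ N} (hρ : Ideal.span (Set.range ρ) = M)
    {γ γ' : Fin N → FPS (Fin N ⊕ Fin n)} (hγ : IsSegreMapping ρ γ) {H : Fin N → FPS (Fin N)}
    (hH : IsCoordChange H) (hρ' : IsDefiningIn H M ρ') (hγ' : IsSegreMapping ρ' γ') (j : ℕ) :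
    Rk (iterSegre γ' j) = Rk (iterSegre γ j) := by
  have hr := hρ'.rank_jacobianZero hM hH.1
  have h1 := hγ.isSegreIn hρ hH.1 hρ'
  have h2 := hγ'.isSegreIn_X
  exact le_antisymm (Rk_iterSegre_le hn hr isCoordChange_X hH h2 h1 j)
    (Rk_iterSegre_le hn hr hH isCoordChange_X h1 h2 j)

end Invariance

/-! ### The stabilization index. -/

section Stabilization

variable {N n d : ℕ} {M : Ideal (FPS₂ N)} {ρ : Fin d → FPS₂ N} {γ : Fin N → FPS (Fin N ⊕ Fin n)}

theorem Rk_iterSegre_add_le (hn : n + d = N) (hM : IsGeneric M d)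
    (hρ : Ideal.span (Set.range ρ) = M) (hγ : IsSegreMapping ρ γ) (j : ℕ) :
    Rk (iterSegre γ j) + n ≤ dimLieAlgZero M := by
  have hle := dimLieAlgZero_le hn hM
  have he : 2 * N - d - dimLieAlgZero M + d + dimLieAlgZero M = 2 * N := by omega
  obtain ⟨f, hf⟩ := exists_joinIdeal_eq_crOrbit hn hM hρ he
  obtain ⟨hf0, hfli⟩ := isManifoldIdeal_of_joinIdeal hn hM he hf
  have h := Rk_add_le_of_subst_eq_zero (isFormalMapping_iterSegre hγ.1 j) hfli
    (subst_iterSegre_eq_zero hM hρ hγ hf0 hf j)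
  rw [Fintype.card_fin, Fintype.card_fin] at h
  omega

/-- The rank of the iterated Segre mappings stabilizes as soon as it fails to increase. -/
theorem Rk_iterSegre_add_eq_iff (hn : n + d = N) (hM : IsGeneric M d)
    (hρ : Ideal.span (Set.range ρ) = M) (hγ : IsSegreMapping ρ γ) (j : ℕ) :
    Rk (iterSegre γ j) = Rk (iterSegre γ (j + 1)) ↔
      Rk (iterSegre γ j) + n = dimLieAlgZero M := by
  have h1 := Rk_iterSegre_step hn hM hρ hγ j
  have h2 := Rk_iterSegre_add_le hn hM hρ hγ j
  have h3 := Rk_iterSegre_add_le hn hM hρ hγ (j + 1)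
  refine ⟨fun h => le_antisymm h2 (h1.2.2 h), fun h => le_antisymm h1.2.1 (by omega)⟩

/-- Starting from at least `n` at index 1, the sequence gains at least one per step until it equals
`m ≤ n + d`, so index `d + 1` suffices; `k₀` is the least positive index with value `m`. -/
theorem exists_stabilization_index {r : ℕ → ℕ} {n d m : ℕ} (hm : m ≤ n + d)
    (h1 : n ≤ r 1) (hmono : ∀ j, r j ≤ r (j + 1)) (hle : ∀ j, r j ≤ m)
    (hst : ∀ j, r j = r (j + 1) ↔ r j = m) :
    ∃ k₀, 1 ≤ k₀ ∧ k₀ ≤ d + 1 ∧ (∀ j, k₀ ≤ j → r j = m) ∧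
      ∀ j, 1 ≤ j → j < k₀ → r j < r (j + 1) := by
  classical
  have hmon : Monotone r := monotone_nat_of_le_succ hmono
  have hgrow : ∀ i, r (i + 1) = m ∨ n + i ≤ r (i + 1) := by
    intro i
    induction i with
    | zero => exact Or.inr h1
    | succ i ih =>
      by_cases h : r (i + 1) = m
      · exact Or.inl (le_antisymm (hle _) (h ▸ hmono (i + 1)))
      · have h2 := lt_of_le_of_ne (hmono (i + 1)) fun h' => h ((hst _).1 h')
        have h3 := ih.resolve_left h
        exact Or.inr (by omega)
  have hd : r (d + 1) = m := (hgrow d).elim id fun h => le_antisymm (hle _) (hm.trans h)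
  have hex : ∃ k, 1 ≤ k ∧ r k = m := ⟨d + 1, by omega, hd⟩
  refine ⟨Nat.find hex, (Nat.find_spec hex).1, Nat.find_min' hex ⟨by omega, hd⟩, fun j hj => ?_,
    fun j hj1 hj => ?_⟩
  · exact le_antisymm (hle j) ((Nat.find_spec hex).2.symm.le.trans (hmon hj))
  · exact lt_of_le_of_ne (hmono j) fun h => Nat.find_min hex hj ⟨hj1, (hst j).1 h⟩

theorem mapsInto_span {σ τ ι : Type} [Fintype τ] {F : τ → FPS σ} (hF : IsFormalMapping F)
    {f : ι → FPS τ} (h : ∀ k, subst F (f k) = 0) : MapsInto F (Ideal.span (Set.range f)) := by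
  have hle : Ideal.span (Set.range f) ≤ RingHom.ker (substAlgHom (R := ℂ) (hasSubst _ hF)) := by
    rw [Ideal.span_le]
    rintro _ ⟨i, rfl⟩
    rw [SetLike.mem_coe, RingHom.mem_ker, substAlgHom_apply]
    exact h i
  intro g hg
  have := hle hg
  rwa [RingHom.mem_ker, substAlgHom_apply] at this

end Stabilization

end FormalSegre

end

theorem theorem2p3 (N n d : ℕ) (hn : n + d = N)
    (M : Ideal (FormalSegre.FPS₂ N)) (hM : FormalSegre.IsGeneric M d)
    (ρ : Fin d → FormalSegre.FPS₂ N) (hρ : Ideal.span (Set.range ρ) = M)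
    (γ : Fin N → FormalSegre.FPS (Fin N ⊕ Fin n)) (hγ : FormalSegre.IsSegreMapping ρ γ) :
    -- the rank is nondecreasing
    (∀ j, 1 ≤ j →
      FormalSegre.Rk (FormalSegre.iterSegre γ j) ≤
        FormalSegre.Rk (FormalSegre.iterSegre γ (j + 1))) ∧
    -- the rank is independent of the coordinates, the defining series and the Segre mapping
    (∀ (H : Fin N → FormalSegre.FPS (Fin N)) (ρ' : Fin d → FormalSegre.FPS₂ N)
        (γ' : Fin N → FormalSegre.FPS (Fin N ⊕ Fin n)),
      FormalSegre.IsCoordChange H → FormalSegre.IsDefiningIn H M ρ' →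
      FormalSegre.IsSegreMapping ρ' γ' →
      ∀ j, 1 ≤ j →
        FormalSegre.Rk (FormalSegre.iterSegre γ' j) =
          FormalSegre.Rk (FormalSegre.iterSegre γ j)) ∧
    -- strict increase up to `k₀`, constancy afterwards
    ∃ k₀ : ℕ, 1 ≤ k₀ ∧ k₀ ≤ d + 1 ∧
      (∀ j, k₀ ≤ j →
        FormalSegre.Rk (FormalSegre.iterSegre γ j) =
          FormalSegre.Rk (FormalSegre.iterSegre γ (j + 1))) ∧
      (∀ j, 1 ≤ j → j < k₀ →
        FormalSegre.Rk (FormalSegre.iterSegre γ j) <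
          FormalSegre.Rk (FormalSegre.iterSegre γ (j + 1))) ∧
      -- existence and uniqueness of the formal CR orbit
      ∃ O : Ideal (FormalSegre.FPS₂ N),
        FormalSegre.IsCROrbit M O ∧ (∀ O', FormalSegre.IsCROrbit M O' → O' = O) ∧
        ∃ e : ℕ, e + d + FormalSegre.dimLieAlgZero M = 2 * N ∧
          (∃ f : Fin e → FormalSegre.FPS (Fin N), FormalSegre.joinIdeal f ρ = O) ∧
          -- the formal complex manifold `W = {f = 0}`, for every such choice of `f`
          ∀ f : Fin e → FormalSegre.FPS (Fin N), FormalSegre.joinIdeal f ρ = O →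
            (∀ j, 1 ≤ j →
              FormalSegre.MapsInto (FormalSegre.iterSegre γ j) (Ideal.span (Set.range f))) ∧
            (FormalSegre.Rk (FormalSegre.iterSegre γ k₀) : ℤ) =
              (FormalSegre.dimLieAlgZero M : ℤ) + d - N ∧
            FormalSegre.IsManifoldIdealOfDim (Ideal.span (Set.range f))
              (FormalSegre.Rk (FormalSegre.iterSegre γ k₀)) := by
  have hle := FormalSegre.dimLieAlgZero_le hn hM
  have hmono := fun j => (FormalSegre.Rk_iterSegre_step hn hM hρ hγ j).2.1
  have hup := FormalSegre.Rk_iterSegre_add_le hn hM hρ hγ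
  have hst := FormalSegre.Rk_iterSegre_add_eq_iff hn hM hρ hγ
  refine ⟨fun j _ => hmono j, fun H ρ' γ' hH hρ' hγ' j _ =>
    FormalSegre.Rk_iterSegre_eq hn hM hρ hγ hH hρ' hγ' j, ?_⟩
  obtain ⟨k₀, hk1, hkd, hconst, hstrict⟩ := FormalSegre.exists_stabilization_index
    (r := fun j => FormalSegre.Rk (FormalSegre.iterSegre γ j))
    -- The subtraction is exact since `n ≤ dimLieAlgZero M`, and `m ≤ n + d` follows from
    -- `dimLieAlgZero M + d ≤ 2 * N`.
    (m := FormalSegre.dimLieAlgZero M - n) (n := n) (d := d) (by omega)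
    (FormalSegre.Rk_iterSegre_step hn hM hρ hγ 0).1 hmono
    (fun j => Nat.le_sub_of_add_le (hup j)) (fun j => (hst j).trans (by omega))
  refine ⟨k₀, hk1, hkd, fun j hj => (hconst j hj).trans (hconst (j + 1) (by omega)).symm, hstrict,
    FormalSegre.crOrbit M, FormalSegre.isCROrbit_crOrbit hn hM, fun O' hO' => hO'.eq_crOrbit hn hM,
    2 * N - d - FormalSegre.dimLieAlgZero M, by omega,
    FormalSegre.exists_joinIdeal_eq_crOrbit hn hM hρ (by omega), fun f hf => ?_⟩
  obtain ⟨hf0, hfli⟩ := FormalSegre.isManifoldIdeal_of_joinIdeal hn hM (by omega) hf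
  have hk : FormalSegre.Rk (FormalSegre.iterSegre γ k₀) = FormalSegre.dimLieAlgZero M - n :=
    hconst k₀ le_rfl
  refine ⟨fun j _ => FormalSegre.mapsInto_span (FormalSegre.isFormalMapping_iterSegre hγ.1 j)
    (FormalSegre.subst_iterSegre_eq_zero hM hρ hγ hf0 hf j), by omega,
    _, FormalSegre.isManifoldIdeal_span hf0 hfli, ?_⟩
  rw [Fintype.card_fin, Fintype.card_fin]
  omega
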